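/- **Setting.** Let $1\le m<K$ and $d\ge 1$ be integers, let $\mathcal A=\{A\in\{0,1\}^K:\sum_k (A)_k\le m\}$, and let $E\subseteq\mathcal A$ be the set of the $K$ vectors with exactly one $1$. Contexts lie in $\mathcal X\subseteq\mathbb R^d$ and are drawn i.i.d. from a distribution $\mathcal D$ on $\mathcal X$ with $\|X\|_2\le 1$ a.s. and $\Sigma=\mathbb E[XX^\top]\succ0$; put $\lambda=\lambda_{\min}(\Sigma)$. An oblivious environment fixes (possibly random) coefficients $\theta_{t,k}\in\mathbb R^d$, $\|\theta_{t,k}\|_2\le 1$, for $t\in[T]$, $k\in[K]$, independently of the contexts and of the learner's randomization. In round $t=1,\dots,T$ the learner observes $X_t\sim\mathcal D$, plays $A_t\in\mathcal A$, and observes $\ell_t(X_t,k)=\langle X_t,\theta_{t,k}\rangle+\varepsilon_{t,k}\in[-1,1]$ for all $k$ with $(A_t)_k=1$, where $\varepsilon_{t,k}$ is noise that has mean zero given the past, $X_t$ and $A_t$ (for instance $\varepsilon_{t,k}=0$). Let $u^\star(x)\in\arg\min_{A\in\mathcal A}\mathbb E\big[\sum_{t\le T}\sum_k\langle x,\theta_{t,k}\rangle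 (A)_k\big]$ for $x\in\mathcal X$ (a measurable choice), and let $$\mathcal R_T=\mathbb E\Big[\sum_{t=1}^T\sum_{k=1}^K\ell_t(X_t,k)\big((A_t)_k-(u^\star(X_t))_k\big)\Big].$$ **Algorithm.** Let $H(a)=-\sum_k a_k\ln a_k$ and $$c_1=\sqrt{\frac{(d+\ln T/\lambda)\,K\ln T}{m\ln(K/m)}},\qquad c_2=\frac{8K}{\lambda},\qquad \alpha_t=\frac{4K\ln t}{\lambda}.$$ In round $t$ let $\eta_t=1/\beta_t$ with $\beta_t=\max\{2,c_2\ln T,\beta'_t\}$, $\beta'_1=c_1$, and $\beta'_{t+1}=\beta'_t+c_1\big(1+(m\ln(K/m))^{-1}\sum_{s\le t}H(\bar A_s(X_s))\big)^{-1/2}$. For a context $x$ let $$\bar A_t(x)\in\arg\min_{a\in\mathrm{conv}(\mathcal A)}\ \sum_{s<t}\sum_k\langle x,\tilde\theta_{s,k}\rangle a_k-\frac{H(a)}{\eta_t},$$ let $p_t(\cdot|x)$ be any distribution on $\mathcal A$ with mean $\bar A_t(x)$, and let $\pi_t(a|x)=(1-\alpha_t\eta_t)p_t(a|x)+\alpha_t\eta_t\mathbf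 1[a\in E]/K$. The learner samples $A_t\sim\pi_t(\cdot|X_t)$. It then draws fresh pairs $X(n)\sim\mathcal D$, $A(n)\sim\pi_t(\cdot|X(n))$ for $n=1,\dots,M_t$, where $M_t=\lceil 4K\ln t/(\alpha_t\eta_t\lambda)\rceil=\lceil 1/\eta_t\rceil$ (the last expression is also used for $t=1$), and sets $$C_{n,k}=\prod_{j=1}^n\Big(I-\tfrac12(A(j))_kX(j)X(j)^\top\Big),\qquad \widehat\Sigma^+_{t,k}=\tfrac12\Big(I+\sum_{n=1}^{M_t}C_{n,k}\Big),\qquad \tilde\theta_{t,k}=\widehat\Sigma_{t,k}^+X_t\,\ell_t(X_t,k)(A_t)_k .$$ **Theorem.** Let $\kappa=\sqrt{Kd\ln T+K(\ln T)^2/\lambda}$. There is a universal constant $L>0$ such that the following holds. 1. *Adversarial regime* (no restriction on the $\theta_{t,k}$ beyond the setting). For all $K,m,d,\lambda$ there is $T_0$, depending only on $K,m,d,\lambda$, such that for all $T\ge T_0$ and all such environments $$\mathcal R_T\le L\,\kappa\, m\sqrt{\ln(K/m)\,T}.$$ 2. *Stochastic regime* ($\theta_{t,k}=\theta_k$ for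 all $t$). Let $\Delta_{\min}$ be the infimum over $x\in\mathcal X$ and $A\in\mathcal A\setminus\{u^\star(x)\}$ of $\Delta_A(x)=\sum_k\langle x,\theta_k\rangle((A)_k-(u^\star(x))_k)$. If $\Delta_{\min}>0$, then for all $T\ge 2$ $$\mathcal R_T\le L\,\frac{\kappa^2m^{3/2}\ln((K-m)T)}{\Delta_{\min}} .$$ 3. *Corrupted stochastic regime* ($\sum_{t=1}^T\max_{A\in\mathcal A}\sum_k\|\theta_{t,k}-\theta_k\|_2(A)_k\le C$ for some fixed vectors $\theta_1,\dots,\theta_K$). Let $\Delta_{\min}$ be defined as in 2 from $\theta_1,\dots,\theta_K$, with $u^\star(x)$ replaced by a minimizer of $\sum_k\langle x,\theta_k\rangle (A)_k$ over $A\in\mathcal A$. If $\Delta_{\min}>0$, then for all $T\ge2$ $$\mathcal R_T\le L\Big(\frac{\kappa^2m^{3/2}\ln((K-m)T)}{\Delta_{\min}}+\sqrt m\,C\Big).$$ In particular, for fixed $C$ the corruption is subsumed by the first term as $T\to\infty$. -/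

import Mathlib

open MeasureTheory ProbabilityTheory
open scoped Matrix

noncomputable section

namespace CombBandit

/-- Context vectors: `ℝ^d` with the Euclidean norm. -/
abbrev Ctx (d : ℕ) : Type := EuclideanSpace ℝ (Fin d)

/-- The action set: 0/1-vectors of length `K` with at most `m` ones, given by their supports. -/
def Action (K m : ℕ) : Type := {S : Finset (Fin K) // S.card ≤ m}

instance (K m : ℕ) : Fintype (Action K m) :=
  inferInstanceAs (Fintype {S : Finset (Fin K) // S.card ≤ m})

instance (K m : ℕ) : MeasurableSpace (Action K m) := ⊤

/-- The 0/1-vector of an action. -/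
def Action.vec {K m : ℕ} (a : Action K m) (k : Fin K) : ℝ := if k ∈ a.1 then 1 else 0

/-- The convex hull of the action set in `ℝ^K`. -/
def actionHull (K m : ℕ) : Set (Fin K → ℝ) :=
  convexHull ℝ (Set.range (Action.vec : Action K m → Fin K → ℝ))

/-- The exploration set: the actions with exactly one arm. -/
def explorationSet (K m : ℕ) : Finset (Action K m) :=
  Finset.univ.filter (fun a => a.1.card = 1)

/-- Shannon entropy `- ∑ k, a k * log (a k)`, where `0 log 0 = 0`. -/
def entropy {K : ℕ} (a : Fin K → ℝ) : ℝ := -∑ k, a k * Real.log (a k)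

/-- The second-moment matrix `E[X Xᵀ]` of the context distribution. -/
def secondMoment {d : ℕ} (D : Measure (Ctx d)) : Matrix (Fin d) (Fin d) ℝ :=
  Matrix.of fun i j => ∫ x, x i * x j ∂D

/-- The smallest eigenvalue of a (symmetric) real matrix. -/
def lambdaMin {d : ℕ} (S : Matrix (Fin d) (Fin d) ℝ) : ℝ :=
  sInf {μ : ℝ | Module.End.HasEigenvalue (Matrix.toLin' S) μ}

/-- `κ = √(K d ln T + K (ln T)² / λ)`. -/
def kappa (K d T : ℕ) (lam : ℝ) : ℝ :=
  Real.sqrt (K * d * Real.log T + K * Real.log T ^ 2 / lam)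

/-- `c₁ = √((d + ln T / λ) K ln T / (m ln (K/m)))`. -/
def c₁ (K m d T : ℕ) (lam : ℝ) : ℝ :=
  Real.sqrt ((d + Real.log T / lam) * (K * Real.log T) / (m * Real.log (K / m)))

/-- `c₂ = 8 K / λ`. -/
def c₂ (K : ℕ) (lam : ℝ) : ℝ := 8 * K / lam

/-- `α_t = 4 K ln t / λ`. -/
def alpha (K : ℕ) (lam : ℝ) (t : ℕ) : ℝ := 4 * K * Real.log t / lam

/-- The random quantities that occur in `T` rounds of the interaction. Rounds are numbered
`t = 1, …, T`; other values of `t` play no role.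
* `X t 0`, `A t 0`: context and action of round `t`;
* `X t n`, `A t n` for `n ≥ 1`: the draws `X(n)`, `A(n)` of the precision-matrix subroutine
  in round `t` (the subroutine uses the first `M_t` of them);
* `θ t k`: loss coefficients;  `ε t k`: noise;
* `p t ω x a`: the probability `p_t(a | x)` that the learner computes in round `t`. -/
structure Play (K m d : ℕ) (Ω : Type*) where
  X : ℕ → ℕ → Ω → Ctx d
  A : ℕ → ℕ → Ω → Action K m
  θ : ℕ → Fin K → Ω → Ctx d
  ε : ℕ → Fin K → Ω → ℝ
  p : ℕ → Ω → Ctx d → Action K m → ℝ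

namespace Play

variable {K m d : ℕ} {Ω : Type*} (G : Play K m d Ω)

/-- The realized loss `ℓ_t(X_t, k) = ⟨X_t, θ_{t,k}⟩ + ε_{t,k}`. -/
def loss (t : ℕ) (k : Fin K) (ω : Ω) : ℝ := inner ℝ (G.X t 0 ω) (G.θ t k ω) + G.ε t k ω

/-- The mean action `Ā_t(x) = ∑ a, p_t(a | x) a`. -/
def meanAction (t : ℕ) (ω : Ω) (x : Ctx d) (k : Fin K) : ℝ := ∑ a, G.p t ω x a * a.vec k

/-- `β'_1 = c₁` and `β'_{t+1} = β'_t + c₁ (1 + (m ln (K/m))⁻¹ ∑_{s ≤ t} H(Ā_s(X_s)))^{-1/2}`,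
written as a sum. -/
def betaPrime (T : ℕ) (lam : ℝ) (t : ℕ) (ω : Ω) : ℝ :=
  c₁ K m d T lam + ∑ s ∈ Finset.Ico 1 t, c₁ K m d T lam /
    Real.sqrt (1 + (m * Real.log (K / m))⁻¹ *
      ∑ r ∈ Finset.Icc 1 s, entropy (G.meanAction r ω (G.X r 0 ω)))

/-- `β_t = max {2, c₂ ln T, β'_t}`. -/
def beta (T : ℕ) (lam : ℝ) (t : ℕ) (ω : Ω) : ℝ :=
  max 2 (max (c₂ K lam * Real.log T) (G.betaPrime T lam t ω))

/-- The learning rate `η_t = 1 / β_t`. -/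
def eta (T : ℕ) (lam : ℝ) (t : ℕ) (ω : Ω) : ℝ := 1 / G.beta T lam t ω

/-- The exploration rate `α_t η_t`. -/
def gamma (T : ℕ) (lam : ℝ) (t : ℕ) (ω : Ω) : ℝ := alpha K lam t * G.eta T lam t ω

/-- The number of draws `M_t = ⌈4 K ln t / (α_t η_t λ)⌉`. By the choice of `α_t` the quotient
equals `1 / η_t`; this form also settles the case `t = 1`, where the quotient reads `0 / 0`. -/
def M (T : ℕ) (lam : ℝ) (t : ℕ) (ω : Ω) : ℕ := ⌈1 / G.eta T lam t ω⌉₊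

/-- `C_{n,k} = ∏_{j=1}^n (I - (A(j))_k X(j) X(j)ᵀ / 2)`, factors ordered from left to right. -/
def C (t : ℕ) (k : Fin K) (ω : Ω) : ℕ → Matrix (Fin d) (Fin d) ℝ
  | 0 => 1
  | n + 1 => C t k ω n * (1 - ((G.A t (n + 1) ω).vec k / 2) •
      Matrix.vecMulVec (G.X t (n + 1) ω).ofLp (G.X t (n + 1) ω).ofLp)

/-- The precision-matrix estimate `(I + ∑_{n=1}^{M_t} C_{n,k}) / 2`. -/
def precision (T : ℕ) (lam : ℝ) (t : ℕ) (k : Fin K) (ω : Ω) : Matrix (Fin d) (Fin d) ℝ :=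
  (1 / 2 : ℝ) • (1 + ∑ n ∈ Finset.Icc 1 (G.M T lam t ω), G.C t k ω n)

/-- The loss estimate: the precision estimate applied to `X_t`, times `ℓ_t(X_t,k) (A_t)_k`. -/
def thetaTilde (T : ℕ) (lam : ℝ) (t : ℕ) (k : Fin K) (ω : Ω) : Ctx d :=
  (G.loss t k ω * (G.A t 0 ω).vec k) •
    WithLp.toLp 2 (G.precision T lam t k ω *ᵥ (G.X t 0 ω).ofLp)

/-- The FTRL objective of round `t` at the context `x`, with regularizer `ψ_t = - H / η_t`. -/
def objective (T : ℕ) (lam : ℝ) (t : ℕ) (ω : Ω) (x : Ctx d) (a : Fin K → ℝ) : ℝ :=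
  (∑ s ∈ Finset.Ico 1 t, ∑ k, inner ℝ x (G.thetaTilde T lam s k ω) * a k)
    + -entropy a / G.eta T lam t ω

open Classical in
/-- The policy `π_t(a | x) = (1 - α_t η_t) p_t(a | x) + α_t η_t 1[a ∈ E] / |E|`. -/
def policy (T : ℕ) (lam : ℝ) (t : ℕ) (ω : Ω) (x : Ctx d) (a : Action K m) : ℝ :=
  (1 - G.gamma T lam t ω) * G.p t ω x a +
    G.gamma T lam t ω * (if a ∈ explorationSet K m then 1 else 0) / (explorationSet K m).card

/-- The information generated by the `n`-th context-action draw of round `t`. -/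
@[reducible] def drawInfo (t n : ℕ) : MeasurableSpace Ω :=
  MeasurableSpace.comap (G.X t n) inferInstance ⊔ MeasurableSpace.comap (G.A t n) inferInstance

/-- The information generated by the noise of round `t`. -/
@[reducible] def noiseInfo (t : ℕ) : MeasurableSpace Ω := ⨆ k, MeasurableSpace.comap (G.ε t k) inferInstance

/-- Everything that is fixed before round `t`: all loss coefficients (the environment is
oblivious), and the draws and the noise of the rounds before `t`. -/
@[reducible] def past (T t : ℕ) : MeasurableSpace Ω :=
  (⨆ s ∈ Set.Icc 1 T, ⨆ k, MeasurableSpace.comap (G.θ s k) inferInstance) ⊔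
    ⨆ s ∈ Set.Ico 1 t, ((⨆ n, G.drawInfo s n) ⊔ G.noiseInfo s)

/-- Everything that precedes the `n`-th draw of round `t`. The draw `n = 0` is the actual play,
then the loss is realized, and then come the draws `n ≥ 1` of the subroutine. -/
@[reducible] def beforeDraw (T t n : ℕ) : MeasurableSpace Ω :=
  G.past T t ⊔ (⨆ j ∈ Set.Iio n, G.drawInfo t j) ⊔ ⨆ _ : 1 ≤ n, G.noiseInfo t

/-- `G` is the interaction, over `T` rounds and under the probability measure `P`, of an oblivious
environment with context space `𝒳` and context distribution `D` with the FTRL algorithm. -/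
structure IsRun [MeasurableSpace Ω] (P : Measure Ω) (𝒳 : Set (Ctx d)) (D : Measure (Ctx d))
    (T : ℕ) : Prop where
  /-- Contexts lie in `𝒳` and in the unit ball, and `E[X Xᵀ] ≻ 0`. -/
  isProb_context : IsProbabilityMeasure D
  context_mem : ∀ᵐ x ∂D, x ∈ 𝒳
  context_norm : ∀ᵐ x ∂D, ‖x‖ ≤ 1
  posDef : (secondMoment D).PosDef
  /-- Everything is a random variable. -/
  isProb : IsProbabilityMeasure P
  measurable_X : ∀ t ∈ Set.Icc 1 T, ∀ n, Measurable (G.X t n)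
  measurable_A : ∀ t ∈ Set.Icc 1 T, ∀ n, Measurable (G.A t n)
  measurable_θ : ∀ t ∈ Set.Icc 1 T, ∀ k, Measurable (G.θ t k)
  measurable_ε : ∀ t ∈ Set.Icc 1 T, ∀ k, Measurable (G.ε t k)
  /-- Coefficients and losses are bounded by one. -/
  θ_norm : ∀ t ∈ Set.Icc 1 T, ∀ k, ∀ᵐ ω ∂P, ‖G.θ t k ω‖ ≤ 1
  loss_bound : ∀ t ∈ Set.Icc 1 T, ∀ k, ∀ᵐ ω ∂P, |G.loss t k ω| ≤ 1
  /-- Zero-mean noise, given the past, the context and the action. (This holds for noise that, given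
  the context, is drawn independently of everything else, and for no noise at all.) -/
  noise : ∀ t ∈ Set.Icc 1 T, ∀ k, P[G.ε t k | G.past T t ⊔ G.drawInfo t 0] =ᵐ[P] 0
  /-- `p_t(· | x)` is a distribution on the actions, depends on the past only, and its mean
  minimizes the FTRL objective over the convex hull of the action set. -/
  p_nonneg : ∀ t ∈ Set.Icc 1 T, ∀ ω x a, 0 ≤ G.p t ω x a
  p_sum : ∀ t ∈ Set.Icc 1 T, ∀ ω x, ∑ a, G.p t ω x a = 1
  p_measurable : ∀ t ∈ Set.Icc 1 T, ∀ a,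
    Measurable[(G.past T t).prod inferInstance] (fun z : Ω × Ctx d => G.p t z.1 z.2 a)
  ftrl : ∀ t ∈ Set.Icc 1 T, ∀ ω x, IsMinOn (G.objective T (lambdaMin (secondMoment D)) t ω x)
    (actionHull K m) (G.meanAction t ω x)
  /-- Each context is drawn from `D`, independently of everything before it. -/
  context_law : ∀ t ∈ Set.Icc 1 T, ∀ n, P.map (G.X t n) = D
  context_indep : ∀ t ∈ Set.Icc 1 T, ∀ n,
    Indep (MeasurableSpace.comap (G.X t n) inferInstance) (G.beforeDraw T t n) P
  /-- Each action is drawn from `π_t(· | x)`, given its context `x` and everything before it. -/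
  action_law : ∀ t ∈ Set.Icc 1 T, ∀ n, ∀ a : Action K m,
    P[(G.A t n ⁻¹' {a}).indicator (fun _ => (1 : ℝ)) |
        G.beforeDraw T t n ⊔ MeasurableSpace.comap (G.X t n) inferInstance]
      =ᵐ[P] fun ω => G.policy T (lambdaMin (secondMoment D)) t ω (G.X t n ω) a

variable [MeasurableSpace Ω]

/-- The expected cumulative loss of the action `a` at the fixed context `x`
(the noise has mean zero). -/
def totalLoss (P : Measure Ω) (T : ℕ) (x : Ctx d) (a : Action K m) : ℝ :=
  ∫ ω, ∑ t ∈ Finset.Icc 1 T, ∑ k, inner ℝ x (G.θ t k ω) * a.vec k ∂P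

/-- `u` is an optimal context-dependent action map (a measurable choice of minimizers). -/
def IsOptimal (P : Measure Ω) (𝒳 : Set (Ctx d)) (T : ℕ) (u : Ctx d → Action K m) : Prop :=
  Measurable u ∧ ∀ x ∈ 𝒳, ∀ a, G.totalLoss P T x (u x) ≤ G.totalLoss P T x a

/-- The pseudo-regret against `u`. -/
def regret (P : Measure Ω) (T : ℕ) (u : Ctx d → Action K m) : ℝ :=
  ∫ ω, ∑ t ∈ Finset.Icc 1 T, ∑ k,
    G.loss t k ω * ((G.A t 0 ω).vec k - (u (G.X t 0 ω)).vec k) ∂P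

/-- The stochastic regime with the fixed coefficients `θ₀`. -/
def IsStochastic (P : Measure Ω) (T : ℕ) (θ₀ : Fin K → Ctx d) : Prop :=
  ∀ t ∈ Set.Icc 1 T, ∀ k, ∀ᵐ ω ∂P, G.θ t k ω = θ₀ k

/-- The corrupted stochastic regime: fixed coefficients `θ₀`, corruption level `c`. -/
def IsCorrupted (P : Measure Ω) (T : ℕ) (θ₀ : Fin K → Ctx d) (c : ℝ) : Prop :=
  ∀ᵐ ω ∂P, ∑ t ∈ Finset.Icc 1 T,
    (⨆ a : Action K m, ∑ k, ‖G.θ t k ω - θ₀ k‖ * a.vec k) ≤ c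

end Play

/-- The suboptimality gap `Δ_a(x) = ∑ k, ⟨x, θ_k⟩ (a_k - u(x)_k)`. -/
def gap {K m d : ℕ} (θ₀ : Fin K → Ctx d) (u : Ctx d → Action K m) (x : Ctx d)
    (a : Action K m) : ℝ :=
  ∑ k, inner ℝ x (θ₀ k) * (a.vec k - (u x).vec k)

/-- The minimal gap `Δ_min` over all contexts `x` and all actions other than `u x`. -/
def minGap {K m d : ℕ} (𝒳 : Set (Ctx d)) (θ₀ : Fin K → Ctx d) (u : Ctx d → Action K m) : ℝ :=
  sInf {g : ℝ | ∃ x ∈ 𝒳, ∃ a, a ≠ u x ∧ g = gap θ₀ u x a}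

end CombBandit

end

/-!
The algorithm is follow-the-regularized-leader (FTRL) with the entropy as regularizer, and at every
fixed context `x` it may be analysed as an ordinary FTRL instance with the estimated losses
`⟨x, θ̃⟩`. Three properties of the estimates make this work. They are at most `β_t = 1/η_t`, so that
the stability argument for entropic FTRL applies (`abs_inner_thetaTilde_le`, `ftrl_regret`). They
are nearly unbiased: with `S` the second moment of the contexts in which the arm is played, their
bias is governed by `(I - S/2)^(M+1)`, which is at most `t⁻²` by the choice of `M_t` and the lower
bound `S ≥ (γ/K) Σ` from the exploration (`integral_thetaTilde`, `abs_remainder_le`).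

The third property is a variance of order `d` per arm that does not depend on the rate of
exploration. Expand the second moment at `x` as a double sum over pairs of update products.
Averaging out the later updates of a pair gives a geometric series which cancels a factor `S` and
leaves `∑ i, xᵀ Φⁱ(I) x`, where `Φ(R) = E[(I - aXXᵀ/2) R (I - aXXᵀ/2)]` (`integral_sq_estimate_le`).
Weighted with the probability of playing the arm and averaged over `x`, this becomes
`∑ i, tr(S Φⁱ(I))`. As `Φ` is self-adjoint for the trace form and `Φ(I) ≤ I - 3/4 S`, the sum
telescopes to at most `4d/3` (`sum_trace_updateMean_iterate_le`, `stability_le`).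

Averaging the FTRL bound over an independent context gives the regret of the algorithm up to the
cost of exploration (`IsRun.ftrl_regret_le`, `IsRun.regret_le`). Write `h = m ln (K/m)`, `H_t` for
the entropy of the iterate played in round `t`, and `W = E √(h + ∑ H_t)`. The learning rates are
tuned so that second-order terms and penalty terms are both of order `κ W` (`IsRun.ftrlRegret_le`),
and exploration costs at most `m κ W` up to constants (`regret_le_rootEntropy`).

In the adversarial regime `H_t ≤ h + m` bounds everything by the horizon (`regret_le_adversarial`).
With a gap `Δ`, the loss of a point of the action hull exceeds the minimum by at least a multiple of
`Δ` times its ℓ₁-distance from the optimal action (`mul_mismatch_le`), and its entropy is at most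
`ln N` times that distance plus `K/N` (`entropy_le_mismatch`). Hence `W` is, up to lower-order
terms, at most the square root of `ln T / Δ` times the excess loss of the iterates, which in turn is
at most their regret plus twice the corruption (`totalExcess_le`). This bounds the excess in terms of
its own square root, and solving the inequality gives the logarithmic bound (`self_bounding`,
`regret_le_corrupted`). The stochastic regime is the case without corruption.
-/

noncomputable section

namespace CombBandit

/-! ### First-order conditions for the entropy regularizer -/

lemma mul_log_le_quadratic {a y : ℝ} (ha : 0 < a) (hy : 0 ≤ y) :
    y * Real.log y ≤ a * Real.log a + (y - a) * (Real.log a + 1) + (y - a) ^ 2 / a := by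
  have e : a * Real.log a + (y - a) * (Real.log a + 1) + (y - a) ^ 2 / a
      = y * Real.log a + y * (y / a - 1) := by
    field_simp; ring
  rw [e]
  rcases hy.eq_or_lt with rfl | hy
  · simp
  have h := Real.log_le_sub_one_of_pos (div_pos hy ha)
  rw [Real.log_div hy.ne' ha.ne'] at h
  nlinarith

/-- Along the segment from `a` to `b`, `y log y` is bounded by its first-order expansion plus a
quadratic term; at the boundary `a = 0` a term `ε log ε` of infinite slope appears. -/
lemma mul_log_segment {a b : ℝ} (ha : 0 ≤ a) (hb : 0 ≤ b) :
    ∃ E : ℝ, ∀ ε : ℝ, 0 < ε → ε ≤ 1 →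
      (a + ε * (b - a)) * Real.log (a + ε * (b - a)) ≤ a * Real.log a +
        ε * (if a = 0 then b * Real.log b else (b - a) * (Real.log a + 1)) + ε ^ 2 * E +
        (if a = 0 then b else 0) * (ε * Real.log ε) := by
  rcases ha.eq_or_lt with rfl | ha
  · refine ⟨0, fun ε h0 h1 => ?_⟩
    rcases hb.eq_or_lt with rfl | hb
    · simp
    · simp only [zero_add, sub_zero, if_true, Real.log_zero, mul_zero]
      rw [Real.log_mul h0.ne' hb.ne']
      apply le_of_eq; ring
  · refine ⟨(b - a) ^ 2 / a, fun ε h0 h1 => ?_⟩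
    have h := mul_log_le_quadratic ha (y := a + ε * (b - a)) (by nlinarith)
    rw [if_neg ha.ne', if_neg ha.ne']
    refine h.trans (le_of_eq ?_)
    ring

/-- The FTRL objective `⟨L, a⟩ - β H(a)` as a function of the accumulated loss vector `L`. -/
def regLoss {K : ℕ} (L : Fin K → ℝ) (β : ℝ) (a : Fin K → ℝ) : ℝ :=
  ∑ k, L k * a k - β * entropy a

/-- The Bregman divergence of `-H`. -/
def bregman {K : ℕ} (b a : Fin K → ℝ) : ℝ :=
  ∑ k, (b k * Real.log (b k) - b k * Real.log (a k) - b k + a k)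

lemma regLoss_segment {K : ℕ} {L : Fin K → ℝ} {β : ℝ} (hβ : 0 < β) {a b : Fin K → ℝ}
    {𝒞 : Set (Fin K → ℝ)} (hc : Convex ℝ 𝒞) (ha : a ∈ 𝒞) (hb : b ∈ 𝒞)
    (hnn : ∀ c ∈ 𝒞, ∀ k, 0 ≤ c k) (hmin : IsMinOn (regLoss L β) 𝒞 a) :
    ∃ E : ℝ, ∀ ε : ℝ, 0 < ε → ε ≤ 1 →
      0 ≤ (∑ k, L k * (b k - a k)) + β * (∑ k, if a k = 0 then b k * Real.log (b k)
          else (b k - a k) * (Real.log (a k) + 1)) + ε * E +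
        β * (∑ k, if a k = 0 then b k else 0) * Real.log ε := by
  choose E hE using fun k => mul_log_segment (hnn a ha k) (hnn b hb k)
  refine ⟨β * ∑ k, E k, fun ε h0 h1 => ?_⟩
  have hmem : (fun k => a k + ε * (b k - a k)) ∈ 𝒞 := by
    have := hc ha hb (by linarith : (0 : ℝ) ≤ 1 - ε) h0.le (by ring)
    convert this using 1
    ext k; simp; ring
  have h := hmin hmem
  simp only [Set.mem_ofPred_eq, regLoss, entropy] at h
  have hs : ∑ k, (a k + ε * (b k - a k)) * Real.log (a k + ε * (b k - a k)) ≤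
      ∑ k, (a k * Real.log (a k) +
        ε * (if a k = 0 then b k * Real.log (b k) else (b k - a k) * (Real.log (a k) + 1)) +
        ε ^ 2 * E k + (if a k = 0 then b k else 0) * (ε * Real.log ε)) :=
    Finset.sum_le_sum fun k _ => hE k ε h0 h1
  rw [Finset.sum_add_distrib, Finset.sum_add_distrib, Finset.sum_add_distrib, ← Finset.mul_sum,
    ← Finset.mul_sum, ← Finset.sum_mul] at hs
  have hl : ∑ k, L k * (a k + ε * (b k - a k)) =
      ∑ k, L k * a k + ε * ∑ k, L k * (b k - a k) := by
    rw [Finset.mul_sum, ← Finset.sum_add_distrib]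
    exact Finset.sum_congr rfl fun k _ => by ring
  rw [hl] at h
  have hs' := mul_le_mul_of_nonneg_left hs hβ.le
  have : 0 ≤ ε * ((∑ k, L k * (b k - a k)) + β * (∑ k, if a k = 0 then b k * Real.log (b k)
          else (b k - a k) * (Real.log (a k) + 1)) + ε * (β * ∑ k, E k) +
        β * (∑ k, if a k = 0 then b k else 0) * Real.log ε) := by
    nlinarith
  exact nonneg_of_mul_nonneg_right this h0

/-- The slope of the entropy is infinite at the boundary, so minimizers have positive entries. -/
lemma minimizer_pos {K : ℕ} {L : Fin K → ℝ} {β : ℝ} (hβ : 0 < β) {a b : Fin K → ℝ}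
    {𝒞 : Set (Fin K → ℝ)} (hc : Convex ℝ 𝒞) (ha : a ∈ 𝒞) (hb : b ∈ 𝒞)
    (hnn : ∀ c ∈ 𝒞, ∀ k, 0 ≤ c k) (hmin : IsMinOn (regLoss L β) 𝒞 a) {k : Fin K}
    (hk : 0 < b k) : 0 < a k := by
  by_contra hak
  have hak : a k = 0 := le_antisymm (not_lt.1 hak) (hnn a ha k)
  obtain ⟨E, hE⟩ := regLoss_segment hβ hc ha hb hnn hmin
  set G := (∑ k, L k * (b k - a k)) + β * (∑ k, if a k = 0 then b k * Real.log (b k)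
          else (b k - a k) * (Real.log (a k) + 1))
  set N := β * (∑ k, if a k = 0 then b k else 0) with hN
  have hNpos : 0 < N := by
    refine mul_pos hβ (Finset.sum_pos' (fun j _ => ?_) ⟨k, Finset.mem_univ _, ?_⟩)
    · split_ifs
      exacts [hnn b hb j, le_rfl]
    · rwa [if_pos hak]
  set r := (|G| + |E| + 1) / N with hr
  have hr0 : 0 < r := by positivity
  have h := hE (Real.exp (-r)) (Real.exp_pos _) (Real.exp_le_one_iff.2 (by linarith))
  rw [Real.log_exp] at h
  have h1 : Real.exp (-r) * E ≤ |E| := by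
    calc Real.exp (-r) * E ≤ Real.exp (-r) * |E| := by gcongr; exact le_abs_self E
      _ ≤ 1 * |E| := by gcongr; exact Real.exp_le_one_iff.2 (by linarith)
      _ = |E| := one_mul _
  have h2 : N * -r = -(|G| + |E| + 1) := by rw [hr]; field_simp
  linarith [le_abs_self G]

/-- A minimizer of the regularized loss beats any other point by at least the Bregman divergence. -/
lemma regLoss_add_bregman_le {K : ℕ} {L : Fin K → ℝ} {β : ℝ} (hβ : 0 < β) {a b : Fin K → ℝ}
    {𝒞 : Set (Fin K → ℝ)} (hc : Convex ℝ 𝒞) (ha : a ∈ 𝒞) (hb : b ∈ 𝒞)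
    (hnn : ∀ c ∈ 𝒞, ∀ k, 0 ≤ c k) (hmin : IsMinOn (regLoss L β) 𝒞 a) (hpos : ∀ k, 0 < a k) :
    regLoss L β a + β * bregman b a ≤ regLoss L β b := by
  obtain ⟨E, hE⟩ := regLoss_segment hβ hc ha hb hnn hmin
  have hne : ∀ k, a k ≠ 0 := fun k => (hpos k).ne'
  simp only [hne, if_false, Finset.sum_const_zero, mul_zero, zero_mul, add_zero] at hE
  set G := (∑ k, L k * (b k - a k)) + β * (∑ k, (b k - a k) * (Real.log (a k) + 1)) with hG
  have hG0 : 0 ≤ G := by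
    by_contra hlt
    push Not at hlt
    have h := hE (min 1 (-G / (2 * (|E| + 1)))) (lt_min one_pos (div_pos (by linarith)
      (by positivity))) (min_le_left _ _)
    have h0 : 0 ≤ min 1 (-G / (2 * (|E| + 1))) :=
      le_min zero_le_one (div_nonneg (by linarith) (by positivity))
    have h1 : min 1 (-G / (2 * (|E| + 1))) * E ≤ -G / (2 * (|E| + 1)) * (|E| + 1) :=
      (mul_le_mul_of_nonneg_left (by linarith [le_abs_self E]) h0).trans
        (mul_le_mul_of_nonneg_right (min_le_right _ _) (by positivity))
    have h2 : -G / (2 * (|E| + 1)) * (|E| + 1) = -G / 2 := by field_simp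
    linarith
  have : regLoss L β b - (regLoss L β a + β * bregman b a) = G := by
    simp only [regLoss, entropy, bregman, hG, mul_neg, sub_neg_eq_add, Finset.mul_sum,
      ← Finset.sum_add_distrib, ← Finset.sum_sub_distrib]
    exact Finset.sum_congr rfl fun k _ => by ring
  linarith

/-! ### The regret of follow-the-regularized-leader -/

/-- Fenchel-Young inequality for `y log y`, centred at `a`. -/
lemma fenchel_mul_log {a b s : ℝ} (ha : 0 < a) (hb : 0 ≤ b) :
    b * s - a * Real.exp s ≤ b * Real.log b - b * Real.log a - b := by
  rcases hb.eq_or_lt with rfl | hb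
  · simp only [zero_mul, zero_sub, sub_zero, neg_nonpos]
    positivity
  have h := Real.one_sub_inv_le_log_of_pos (div_pos hb (mul_pos ha (Real.exp_pos s)))
  rw [Real.log_div hb.ne' (mul_pos ha (Real.exp_pos s)).ne', Real.log_mul ha.ne'
    (Real.exp_pos s).ne', Real.log_exp, inv_div] at h
  have h2 := mul_le_mul_of_nonneg_left h hb.le
  have h3 : b * (1 - a * Real.exp s / b) = b - a * Real.exp s := by field_simp
  linarith

/-- The stability term of one coordinate. The loss is bounded by the regularization weight, so that
`e^s ≤ 1 + s + s²` applies to `s = -l / β`. -/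
lemma stability_coordinate {a b β l : ℝ} (ha : 0 < a) (hb : 0 ≤ b) (hβ : 0 < β) (hl : |l| ≤ β) :
    l * (a - b) - β * (b * Real.log b - b * Real.log a - b + a) ≤ a * l ^ 2 / β := by
  have h1 := fenchel_mul_log (s := -l / β) ha hb
  have h2 := Real.abs_exp_sub_one_sub_id_le (x := -l / β) (by
    rwa [abs_div, abs_neg, abs_of_pos hβ, div_le_one hβ])
  have h3 := (abs_le.1 h2).2
  have h4 := mul_le_mul_of_nonneg_left h1 hβ.le
  have h5 := mul_le_mul_of_nonneg_left h3 (mul_pos hβ ha).le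
  have e1 : β * (b * (-l / β) - a * Real.exp (-l / β)) = -b * l - β * a * Real.exp (-l / β) := by
    field_simp
  have e2 : β * a * (Real.exp (-l / β) - 1 - -l / β) =
      β * a * Real.exp (-l / β) - β * a + a * l := by field_simp; ring
  have e3 : β * a * (-l / β) ^ 2 = a * l ^ 2 / β := by field_simp
  rw [e1] at h4
  rw [e2, e3] at h5
  linarith

/-- One round of FTRL: compared with any point `b`, the leader pays no more for the new loss `l` than
the stability term. -/
lemma ftrl_round {K : ℕ} {L l : Fin K → ℝ} {β : ℝ} (hβ : 0 < β) {a b : Fin K → ℝ}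
    {𝒞 : Set (Fin K → ℝ)} (hc : Convex ℝ 𝒞) (ha : a ∈ 𝒞) (hb : b ∈ 𝒞)
    (hnn : ∀ c ∈ 𝒞, ∀ k, 0 ≤ c k) (hpos : ∀ k, ∃ c ∈ 𝒞, 0 < c k)
    (hmin : IsMinOn (regLoss L β) 𝒞 a) (hl : ∀ k, |l k| ≤ β) :
    regLoss L β a + ∑ k, l k * a k ≤ regLoss (fun k => L k + l k) β b + ∑ k, a k * l k ^ 2 / β := by
  have hap : ∀ k, 0 < a k := fun k => by
    obtain ⟨c, hc', hk⟩ := hpos k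
    exact minimizer_pos hβ hc ha hc' hnn hmin hk
  have h1 := regLoss_add_bregman_le hβ hc ha hb hnn hmin hap
  have h2 : ∑ k, (l k * (a k - b k) -
      β * (b k * Real.log (b k) - b k * Real.log (a k) - b k + a k)) ≤
      ∑ k, a k * l k ^ 2 / β :=
    Finset.sum_le_sum fun k _ => stability_coordinate (hap k) (hnn b hb k) hβ (hl k)
  have h3 : regLoss (fun k => L k + l k) β b = regLoss L β b + ∑ k, l k * b k := by
    simp only [regLoss, add_mul, Finset.sum_add_distrib]; ring
  rw [Finset.sum_sub_distrib, ← Finset.mul_sum] at h2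
  simp only [mul_sub, Finset.sum_sub_distrib] at h2
  simp only [bregman] at h1
  linarith

/-- Regret of FTRL with regularizers `-β_t H` of arbitrary positive weights `β_t`, as long as the
losses are bounded by `β_t`. The comparator has zero entropy. -/
theorem ftrl_regret {K : ℕ} {𝒞 : Set (Fin K → ℝ)} (hc : Convex ℝ 𝒞)
    (hnn : ∀ c ∈ 𝒞, ∀ k, 0 ≤ c k) (hpos : ∀ k, ∃ c ∈ 𝒞, 0 < c k)
    {l a : ℕ → Fin K → ℝ} {β : ℕ → ℝ} {T : ℕ} (hT : 1 ≤ T) {u : Fin K → ℝ} (hu : u ∈ 𝒞)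
    (hHu : entropy u = 0) (hβ : ∀ t ∈ Set.Icc 1 T, 0 < β t) (ha : ∀ t ∈ Set.Icc 1 T, a t ∈ 𝒞)
    (hmin : ∀ t ∈ Set.Icc 1 T,
      IsMinOn (regLoss (fun k => ∑ s ∈ Finset.Ico 1 t, l s k) (β t)) 𝒞 (a t))
    (hl : ∀ t ∈ Set.Icc 1 T, ∀ k, |l t k| ≤ β t) :
    ∑ t ∈ Finset.Icc 1 T, ∑ k, l t k * (a t k - u k) ≤
      ∑ t ∈ Finset.Icc 1 T, ∑ k, a t k * l t k ^ 2 / β t + β 1 * entropy (a 1) +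
        ∑ t ∈ Finset.Ico 1 T, (β (t + 1) - β t) * entropy (a (t + 1)) := by
  have key : ∀ n, 1 ≤ n → n ≤ T → ∑ t ∈ Finset.Ico 1 n, ∑ k, l t k * a t k ≤
      regLoss (fun k => ∑ s ∈ Finset.Ico 1 n, l s k) (β n) (a n) +
      ∑ t ∈ Finset.Ico 1 n, ∑ k, a t k * l t k ^ 2 / β t + β 1 * entropy (a 1) +
        ∑ t ∈ Finset.Ico 1 n, (β (t + 1) - β t) * entropy (a (t + 1)) := by
    intro n hn
    induction n, hn using Nat.le_induction with
    | base => intro _; simp [regLoss]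
    | succ n hn ih =>
      intro hnT
      have hm : n ∈ Set.Icc 1 T := ⟨hn, by omega⟩
      have h1 := ih (by omega)
      have h2 := ftrl_round (hβ n hm) hc (ha n hm) (ha (n + 1) ⟨by omega, hnT⟩) hnn hpos
        (hmin n hm) (hl n hm)
      simp only [Finset.sum_Ico_succ_top hn]
      have h3 : regLoss (fun k => ∑ s ∈ Finset.Ico 1 n, l s k + l n k) (β n) (a (n + 1)) =
          regLoss (fun k => ∑ s ∈ Finset.Ico 1 n, l s k + l n k) (β (n + 1)) (a (n + 1)) +
            (β (n + 1) - β n) * entropy (a (n + 1)) := by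
        simp only [regLoss]; ring
      linarith
  have hm : T ∈ Set.Icc 1 T := ⟨hT, le_rfl⟩
  have h1 := key T hT le_rfl
  have h2 := ftrl_round (hβ T hm) hc (ha T hm) hu hnn hpos (hmin T hm) (hl T hm)
  have e : ∀ f : ℕ → ℝ, ∑ t ∈ Finset.Icc 1 T, f t = ∑ t ∈ Finset.Ico 1 T, f t + f T := fun f => by
    rw [← Finset.sum_Ico_succ_top hT]; rfl
  have h3 : regLoss (fun k => ∑ s ∈ Finset.Ico 1 T, l s k + l T k) (β T) u =
      ∑ t ∈ Finset.Icc 1 T, ∑ k, l t k * u k := by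
    rw [regLoss, hHu, Finset.sum_comm]
    simp only [← Finset.sum_mul, e, mul_zero, sub_zero, add_mul]
  simp only [mul_sub, Finset.sum_sub_distrib]
  rw [e (fun t => ∑ k, l t k * a t k), e (fun t => ∑ k, a t k * l t k ^ 2 / β t)]
  linarith

/-! ### The action hull and the entropy on it -/

lemma Action.vec_nonneg {K m : ℕ} (a : Action K m) (k : Fin K) : 0 ≤ a.vec k := by
  unfold Action.vec; split_ifs <;> norm_num

lemma Action.vec_le_one {K m : ℕ} (a : Action K m) (k : Fin K) : a.vec k ≤ 1 := by
  unfold Action.vec; split_ifs <;> norm_num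

lemma Action.sum_vec {K m : ℕ} (a : Action K m) : ∑ k, a.vec k = a.1.card := by
  simp [Action.vec]

lemma Action.sum_vec_le {K m : ℕ} (a : Action K m) : ∑ k, a.vec k ≤ m := by
  rw [a.sum_vec]; exact_mod_cast a.2

lemma entropy_vec {K m : ℕ} (a : Action K m) : entropy a.vec = 0 := by
  unfold entropy
  rw [Finset.sum_eq_zero, neg_zero]
  intro k _
  unfold Action.vec
  split_ifs <;> simp

lemma vec_mem_actionHull {K m : ℕ} (a : Action K m) : a.vec ∈ actionHull K m :=
  subset_convexHull ℝ _ ⟨a, rfl⟩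

lemma actionHull_bounds {K m : ℕ} {a : Fin K → ℝ} (ha : a ∈ actionHull K m) :
    (∀ k, 0 ≤ a k) ∧ (∀ k, a k ≤ 1) ∧ ∑ k, a k ≤ m := by
  have hc : Convex ℝ {a : Fin K → ℝ | (∀ k, 0 ≤ a k) ∧ (∀ k, a k ≤ 1) ∧ ∑ k, a k ≤ m} := by
    intro x hx y hy s t hs ht hst
    refine ⟨fun k => ?_, fun k => ?_, ?_⟩
    · have := hx.1 k; have := hy.1 k
      simp only [Pi.add_apply, Pi.smul_apply, smul_eq_mul]; positivity
    · simp only [Pi.add_apply, Pi.smul_apply, smul_eq_mul]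
      nlinarith [hx.2.1 k, hy.2.1 k]
    · simp only [Pi.add_apply, Pi.smul_apply, smul_eq_mul, Finset.sum_add_distrib,
        ← Finset.mul_sum]
      have h1 := mul_le_mul_of_nonneg_left hx.2.2 hs
      have h2 := mul_le_mul_of_nonneg_left hy.2.2 ht
      have : s * m + t * m = (m : ℝ) := by rw [← add_mul, hst, one_mul]
      linarith
  refine convexHull_min ?_ hc ha
  rintro _ ⟨b, rfl⟩
  exact ⟨b.vec_nonneg, b.vec_le_one, b.sum_vec_le⟩

/-- The action that plays the single arm `k`. -/
def singleArm {K m : ℕ} (hm : 1 ≤ m) (k : Fin K) : Action K m := ⟨{k}, by simpa using hm⟩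

lemma singleArm_vec {K m : ℕ} (hm : 1 ≤ m) (k j : Fin K) :
    (singleArm hm k : Action K m).vec j = if j = k then 1 else 0 := by
  simp [Action.vec, singleArm]

lemma explorationSet_eq_image {K m : ℕ} (hm : 1 ≤ m) [DecidableEq (Action K m)] :
    explorationSet K m = Finset.univ.image (singleArm hm) := by
  ext a
  simp only [explorationSet, Finset.mem_filter, Finset.mem_univ, true_and, Finset.mem_image,
    Finset.card_eq_one]
  constructor
  · rintro ⟨k, hk⟩
    exact ⟨k, Subtype.ext hk.symm⟩
  · rintro ⟨k, rfl⟩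
    exact ⟨k, rfl⟩

lemma singleArm_injective {K m : ℕ} (hm : 1 ≤ m) :
    Function.Injective (singleArm hm : Fin K → Action K m) := by
  intro i j h
  simpa [singleArm] using congrArg Subtype.val h

lemma card_explorationSet {K m : ℕ} (hm : 1 ≤ m) : (explorationSet K m).card = K := by
  classical
  rw [explorationSet_eq_image hm, Finset.card_image_of_injective _ (singleArm_injective hm)]
  simp

lemma sum_explorationSet_vec {K m : ℕ} (hm : 1 ≤ m) (k : Fin K) :
    ∑ a ∈ explorationSet K m, a.vec k = 1 := by
  classical
  rw [explorationSet_eq_image hm, Finset.sum_image fun i _ j _ h => singleArm_injective hm h]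
  simp [singleArm_vec]

lemma neg_mul_log_le {a N : ℝ} (ha : 0 ≤ a) (hN : 0 < N) :
    -(a * Real.log a) ≤ a * Real.log N + 1 / N := by
  rcases ha.eq_or_lt with rfl | ha
  · simp [hN.le]
  have h := Real.one_sub_inv_le_log_of_pos (mul_pos ha hN)
  rw [Real.log_mul ha.ne' hN.ne'] at h
  have h2 := mul_le_mul_of_nonneg_left h ha.le
  have h3 : a * (1 - (a * N)⁻¹) = a - 1 / N := by field_simp
  linarith

lemma neg_mul_log_le_one_sub {a : ℝ} (ha : 0 ≤ a) : -(a * Real.log a) ≤ 1 - a := by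
  rcases ha.eq_or_lt with rfl | ha
  · simp
  have h := Real.one_sub_inv_le_log_of_pos ha
  have h2 := mul_le_mul_of_nonneg_left h ha.le
  have h3 : a * (1 - a⁻¹) = a - 1 := by field_simp
  linarith

lemma entropy_nonneg {K : ℕ} {a : Fin K → ℝ} (h0 : ∀ k, 0 ≤ a k) (h1 : ∀ k, a k ≤ 1) :
    0 ≤ entropy a := by
  unfold entropy
  rw [neg_nonneg]
  exact Finset.sum_nonpos fun k _ => mul_nonpos_of_nonneg_of_nonpos (h0 k)
    (Real.log_nonpos (h0 k) (h1 k))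

/-- The entropy is at most `m ln (K/m) + m`. The second summand is needed when `m` is close to
`K`: then `m ln (K/m)` is bounded while the maximal entropy is of order `K`. -/
lemma entropy_le {K m : ℕ} (hm : 1 ≤ m) (hmK : m ≤ K) {a : Fin K → ℝ}
    (ha : a ∈ actionHull K m) : entropy a ≤ m * Real.log (K / m) + m := by
  obtain ⟨h0, h1, h2⟩ := actionHull_bounds ha
  have hmr : (0 : ℝ) < m := by exact_mod_cast hm
  have hKm : (m : ℝ) ≤ K := by exact_mod_cast hmK
  have hK : (0 : ℝ) < K := hmr.trans_le hKm
  have hlog : 0 ≤ Real.log (K / m) := Real.log_nonneg (by rwa [one_le_div hmr])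
  calc entropy a = ∑ k, -(a k * Real.log (a k)) := by rw [entropy, Finset.sum_neg_distrib]
    _ ≤ ∑ k, (a k * Real.log (K / m) + 1 / (K / m)) :=
      Finset.sum_le_sum fun k _ => neg_mul_log_le (h0 k) (by positivity)
    _ = (∑ k, a k) * Real.log (K / m) + m := by
      rw [Finset.sum_add_distrib, Finset.sum_mul]
      simp; field_simp
    _ ≤ m * Real.log (K / m) + m := by gcongr

/-! ### Weighted second moments and the averaged rank-one update -/

/-- Measurable functions of a context that are bounded on the unit ball. -/
def BallBdd {d : ℕ} (f : Ctx d → ℝ) : Prop :=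
  Measurable f ∧ ∃ C, ∀ x : Ctx d, ‖x‖ ≤ 1 → |f x| ≤ C

namespace BallBdd

variable {d : ℕ} {f g : Ctx d → ℝ}

lemma const (c : ℝ) : BallBdd (fun _ : Ctx d => c) := ⟨measurable_const, |c|, fun _ _ => le_rfl⟩

lemma coord (i : Fin d) : BallBdd (fun x : Ctx d => x i) :=
  ⟨by fun_prop, 1, fun x hx => (PiLp.norm_apply_le x i).trans hx⟩

lemma add (hf : BallBdd f) (hg : BallBdd g) : BallBdd (fun x => f x + g x) := by
  obtain ⟨mf, A, hA⟩ := hf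
  obtain ⟨mg, B, hB⟩ := hg
  exact ⟨mf.add mg, A + B, fun x hx => (abs_add_le _ _).trans (add_le_add (hA x hx) (hB x hx))⟩

lemma mul (hf : BallBdd f) (hg : BallBdd g) : BallBdd (fun x => f x * g x) := by
  obtain ⟨mf, A, hA⟩ := hf
  obtain ⟨mg, B, hB⟩ := hg
  refine ⟨mf.mul mg, A * B, fun x hx => ?_⟩
  rw [abs_mul]
  exact mul_le_mul (hA x hx) (hB x hx) (abs_nonneg _) ((abs_nonneg _).trans (hA x hx))

lemma sum {ι : Type*} (s : Finset ι) {f : ι → Ctx d → ℝ} (hf : ∀ i ∈ s, BallBdd (f i)) :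
    BallBdd (fun x => ∑ i ∈ s, f i x) := by
  classical
  induction s using Finset.induction_on with
  | empty => simpa using const 0
  | insert a s ha ih =>
    simp only [Finset.sum_insert ha]
    exact (hf _ (Finset.mem_insert_self _ _)).add
      (ih fun i hi => hf i (Finset.mem_insert_of_mem hi))

lemma dot (v : Fin d → ℝ) : BallBdd (fun x : Ctx d => v ⬝ᵥ x.ofLp) :=
  sum _ fun i _ => (const _).mul (coord i)

lemma dot' (v : Fin d → ℝ) : BallBdd (fun x : Ctx d => x.ofLp ⬝ᵥ v) :=
  sum _ fun i _ => (coord i).mul (const _)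

lemma quad (R : Matrix (Fin d) (Fin d) ℝ) : BallBdd (fun x : Ctx d => x.ofLp ⬝ᵥ R *ᵥ x.ofLp) :=
  sum _ fun i _ => (coord i).mul 
    (sum (f := fun j (x : Ctx d) => R i j * x j) Finset.univ fun j _ => (const (R i j)).mul (coord j))

lemma integrable {D : Measure (Ctx d)} [IsFiniteMeasure D] (hD : ∀ᵐ x ∂D, ‖x‖ ≤ 1)
    (hf : BallBdd f) : Integrable f D := by
  obtain ⟨mf, A, hA⟩ := hf
  exact Integrable.of_bound mf.aestronglyMeasurable A (hD.mono fun x hx => hA x hx)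

end BallBdd

/-- The weighted second moment `E[w(X) X Xᵀ]`. -/
def wMoment {d : ℕ} (D : Measure (Ctx d)) (w : Ctx d → ℝ) : Matrix (Fin d) (Fin d) ℝ :=
  Matrix.of fun i j => ∫ x, w x * (x i * x j) ∂D

/-- `E[(I - a X Xᵀ / 2) R (I - a X Xᵀ / 2)]`, where `a` is a Bernoulli variable of mean `w(X)`
given `X`. -/
def updateMean {d : ℕ} (D : Measure (Ctx d)) (w : Ctx d → ℝ) (R : Matrix (Fin d) (Fin d) ℝ) :
    Matrix (Fin d) (Fin d) ℝ :=
  R - (1 / 2 : ℝ) • (wMoment D w * R + R * wMoment D w) +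
    (1 / 4 : ℝ) • wMoment D (fun x => w x * (x.ofLp ⬝ᵥ R *ᵥ x.ofLp))

/-- Nonnegativity of the quadratic form of a matrix, which need not be symmetric. -/
def QuadNonneg {d : ℕ} (R : Matrix (Fin d) (Fin d) ℝ) : Prop := ∀ v : Fin d → ℝ, 0 ≤ v ⬝ᵥ R *ᵥ v

section Moments

variable {d : ℕ} {D : Measure (Ctx d)} [IsProbabilityMeasure D] {w : Ctx d → ℝ}

omit [IsProbabilityMeasure D] in
lemma wMoment_transpose : (wMoment D w)ᵀ = wMoment D w := by
  ext i j
  simp only [wMoment, Matrix.transpose_apply, Matrix.of_apply]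
  congr 1; ext x; ring

variable (hD : ∀ᵐ x ∂D, ‖x‖ ≤ 1) (hw : BallBdd w)
include hD hw

lemma dot_wMoment (v c : Fin d → ℝ) :
    v ⬝ᵥ wMoment D w *ᵥ c = ∫ x, w x * ((v ⬝ᵥ x.ofLp) * (x.ofLp ⬝ᵥ c)) ∂D := by
  have e : ∀ x : Ctx d, w x * ((v ⬝ᵥ x.ofLp) * (x.ofLp ⬝ᵥ c)) =
      ∑ i, ∑ j, (v i * c j) * (w x * (x i * x j)) := fun x => by
    rw [dotProduct, dotProduct, Finset.sum_mul_sum, Finset.mul_sum]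
    refine Finset.sum_congr rfl fun i _ => ?_
    rw [Finset.mul_sum]
    exact Finset.sum_congr rfl fun j _ => by ring
  have hi : ∀ i j, Integrable (fun x : Ctx d => (v i * c j) * (w x * (x i * x j))) D := fun i j =>
    ((BallBdd.const _).mul (hw.mul ((BallBdd.coord i).mul (BallBdd.coord j)))).integrable hD
  simp only [e]
  rw [integral_finsetSum _ fun i _ => integrable_finsetSum _ fun j _ => hi i j]
  simp only [dotProduct, Matrix.mulVec, wMoment, Matrix.of_apply, Finset.mul_sum]
  refine Finset.sum_congr rfl fun i _ => ?_
  rw [integral_finsetSum _ fun j _ => hi i j]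
  refine Finset.sum_congr rfl fun j _ => ?_
  rw [integral_const_mul]; ring

lemma trace_wMoment_mul (R : Matrix (Fin d) (Fin d) ℝ) :
    (wMoment D w * R).trace = ∫ x, w x * (x.ofLp ⬝ᵥ R *ᵥ x.ofLp) ∂D := by
  have e : ∀ x : Ctx d, w x * (x.ofLp ⬝ᵥ R *ᵥ x.ofLp) =
      ∑ j, ∑ i, R j i * (w x * (x i * x j)) := fun x => by
    simp only [dotProduct, Matrix.mulVec, Finset.mul_sum]
    exact Finset.sum_congr rfl fun i _ => Finset.sum_congr rfl fun j _ => by ring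
  have hi : ∀ j i, Integrable (fun x : Ctx d => R j i * (w x * (x i * x j))) D := fun j i =>
    ((BallBdd.const _).mul (hw.mul ((BallBdd.coord i).mul (BallBdd.coord j)))).integrable hD
  simp only [e]
  rw [integral_finsetSum _ fun i _ => integrable_finsetSum _ fun j _ => hi i j]
  simp only [Matrix.trace, Matrix.diag, Matrix.mul_apply, wMoment, Matrix.of_apply]
  rw [Finset.sum_comm]
  refine Finset.sum_congr rfl fun j _ => ?_
  rw [integral_finsetSum _ fun i _ => hi j i]
  refine Finset.sum_congr rfl fun i _ => ?_
  rw [integral_const_mul]; ring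

/-- The averaged update is self-adjoint for the trace form. -/
lemma trace_updateMean_mul (R Q : Matrix (Fin d) (Fin d) ℝ) :
    (updateMean D w R * Q).trace = (R * updateMean D w Q).trace := by
  have h1 := trace_wMoment_mul hD (hw.mul (BallBdd.quad R)) Q
  have h2 := trace_wMoment_mul hD (hw.mul (BallBdd.quad Q)) R
  have h3 : (wMoment D (fun x => w x * (x.ofLp ⬝ᵥ R *ᵥ x.ofLp)) * Q).trace =
      (R * wMoment D (fun x => w x * (x.ofLp ⬝ᵥ Q *ᵥ x.ofLp))).trace := by
    rw [Matrix.trace_mul_comm R, h1, h2]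
    congr 1; ext x; ring
  have h4 : (wMoment D w * R * Q).trace = (R * (Q * wMoment D w)).trace := by
    rw [Matrix.mul_assoc, Matrix.trace_mul_comm, Matrix.mul_assoc]
  have h5 : (R * wMoment D w * Q).trace = (R * (wMoment D w * Q)).trace := by
    rw [Matrix.mul_assoc]
  simp only [updateMean, Matrix.add_mul, Matrix.sub_mul, Matrix.mul_add, Matrix.mul_sub,
    Matrix.smul_mul, Matrix.mul_smul, Matrix.trace_add, Matrix.trace_sub, Matrix.trace_smul,
    h3, h4, h5, smul_add]
  ring

lemma trace_updateMean_iterate (i : ℕ) (R Q : Matrix (Fin d) (Fin d) ℝ) :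
    ((updateMean D w)^[i] R * Q).trace = (R * (updateMean D w)^[i] Q).trace := by
  induction i generalizing Q with
  | zero => rfl
  | succ i ih =>
    rw [Function.iterate_succ_apply', trace_updateMean_mul hD hw, ih, ← Function.iterate_succ_apply]

lemma dot_updateMean (R : Matrix (Fin d) (Fin d) ℝ) (v : Fin d → ℝ) :
    v ⬝ᵥ updateMean D w R *ᵥ v = v ⬝ᵥ R *ᵥ v + ∫ x, w x *
      (-(1 / 2) * ((v ⬝ᵥ x.ofLp) * (x.ofLp ⬝ᵥ R *ᵥ v) + (v ⬝ᵥ R *ᵥ x.ofLp) * (x.ofLp ⬝ᵥ v)) +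
      1 / 4 * ((x.ofLp ⬝ᵥ R *ᵥ x.ofLp) * ((v ⬝ᵥ x.ofLp) * (x.ofLp ⬝ᵥ v)))) ∂D := by
  have h1 := dot_wMoment hD hw v (R *ᵥ v)
  have h2 := dot_wMoment hD hw (v ᵥ* R) v
  have h3 := dot_wMoment hD (hw.mul (BallBdd.quad R)) v v
  have i1 := (hw.mul ((BallBdd.dot v).mul (BallBdd.dot' (R *ᵥ v)))).integrable hD
  have i2 := (hw.mul ((BallBdd.dot (v ᵥ* R)).mul (BallBdd.dot' v))).integrable hD
  have i3 := ((hw.mul (BallBdd.quad R)).mul ((BallBdd.dot v).mul (BallBdd.dot' v))).integrable hD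
  have e : ∀ x : Ctx d, w x *
      (-(1 / 2) * ((v ⬝ᵥ x.ofLp) * (x.ofLp ⬝ᵥ R *ᵥ v) + (v ⬝ᵥ R *ᵥ x.ofLp) * (x.ofLp ⬝ᵥ v)) +
      1 / 4 * ((x.ofLp ⬝ᵥ R *ᵥ x.ofLp) * ((v ⬝ᵥ x.ofLp) * (x.ofLp ⬝ᵥ v)))) =
      -(1 / 2) * (w x * ((v ⬝ᵥ x.ofLp) * (x.ofLp ⬝ᵥ R *ᵥ v))) +
      -(1 / 2) * (w x * (((v ᵥ* R) ⬝ᵥ x.ofLp) * (x.ofLp ⬝ᵥ v))) +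
      1 / 4 * (w x * (x.ofLp ⬝ᵥ R *ᵥ x.ofLp) * ((v ⬝ᵥ x.ofLp) * (x.ofLp ⬝ᵥ v))) := fun x => by
    rw [Matrix.dotProduct_mulVec v R]; ring
  simp only [e]
  rw [integral_add (by exact (i1.const_mul _).add (i2.const_mul _)) (i3.const_mul _),
    integral_add (i1.const_mul _) (i2.const_mul _), integral_const_mul, integral_const_mul,
    integral_const_mul, ← h1, ← h2, ← h3]
  simp only [updateMean, Matrix.add_mulVec, Matrix.sub_mulVec, Matrix.smul_mulVec, dotProduct_add,
    dotProduct_sub, dotProduct_smul, smul_eq_mul, ← Matrix.mulVec_mulVec, ← Matrix.dotProduct_mulVec]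
  ring

/-- The inequality `Φ(I) ≤ I - 3/4 S` for the averaged update `Φ`, tested against `Y`. It uses
`|X| ≤ 1`, by which `(X Xᵀ)² ≤ X Xᵀ`. -/
lemma trace_mul_updateMean_one_le {Y : Matrix (Fin d) (Fin d) ℝ} (hY : QuadNonneg Y)
    (hw0 : ∀ x, 0 ≤ w x) :
    (Y * updateMean D w 1).trace ≤ Y.trace - 3 / 4 * (wMoment D w * Y).trace := by
  have h1 : (wMoment D (fun x => w x * (x.ofLp ⬝ᵥ (1 : Matrix (Fin d) (Fin d) ℝ) *ᵥ x.ofLp)) *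
      Y).trace ≤ (wMoment D w * Y).trace := by
    rw [trace_wMoment_mul hD (hw.mul (BallBdd.quad 1)), trace_wMoment_mul hD hw]
    refine integral_mono_ae (((hw.mul (BallBdd.quad 1)).mul (BallBdd.quad Y)).integrable hD)
      ((hw.mul (BallBdd.quad Y)).integrable hD) (hD.mono fun x hx => ?_)
    have h : x.ofLp ⬝ᵥ (1 : Matrix (Fin d) (Fin d) ℝ) *ᵥ x.ofLp ≤ 1 := by
      rw [Matrix.one_mulVec]
      have : x.ofLp ⬝ᵥ x.ofLp = ‖x‖ ^ 2 := by
        rw [EuclideanSpace.real_norm_sq_eq]; simp [dotProduct, sq]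
      rw [this]
      exact pow_le_one₀ (norm_nonneg _) hx
    exact mul_le_mul_of_nonneg_right (mul_le_of_le_one_right (hw0 x) h) (hY _)
  rw [Matrix.trace_mul_comm Y]
  simp only [updateMean, Matrix.mul_one, Matrix.one_mul, Matrix.add_mul, Matrix.sub_mul,
    Matrix.smul_mul, Matrix.trace_add, Matrix.trace_sub, Matrix.trace_smul, smul_eq_mul] at h1 ⊢
  linarith

lemma QuadNonneg.updateMean {R : Matrix (Fin d) (Fin d) ℝ} (hR : QuadNonneg R)
    (hw0 : ∀ x, 0 ≤ w x) (hw1 : ∀ x, w x ≤ 1) : QuadNonneg (updateMean D w R) := by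
  intro v
  have hI := ((hw.mul (((BallBdd.const (-(1 / 2))).mul
    (((BallBdd.dot v).mul (BallBdd.dot' (R *ᵥ v))).add
      ((BallBdd.dot (v ᵥ* R)).mul (BallBdd.dot' v)))).add ((BallBdd.const (1 / 4)).mul
      ((BallBdd.quad R).mul ((BallBdd.dot v).mul (BallBdd.dot' v)))))).integrable hD)
  simp only [← Matrix.dotProduct_mulVec] at hI
  have hc : ∫ _ : Ctx d, v ⬝ᵥ R *ᵥ v ∂D = v ⬝ᵥ R *ᵥ v := by simp
  rw [dot_updateMean hD hw, ← hc, ← integral_add (integrable_const _) hI]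
  refine integral_nonneg fun x => ?_
  set s := v ⬝ᵥ x.ofLp with hs
  have hs' : x.ofLp ⬝ᵥ v = s := dotProduct_comm _ _
  have h := hR (v - (s / 2) • x.ofLp)
  simp only [Matrix.mulVec_sub, Matrix.mulVec_smul, sub_dotProduct, dotProduct_sub, smul_dotProduct,
    dotProduct_smul, smul_eq_mul] at h
  have h0 := hR v
  simp only [Pi.zero_apply, hs']
  nlinarith [mul_nonneg (hw0 x) h, mul_nonneg (sub_nonneg.2 (hw1 x)) h0]

lemma quadNonneg_updateMean_iterate {R : Matrix (Fin d) (Fin d) ℝ} (hR : QuadNonneg R)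
    (hw0 : ∀ x, 0 ≤ w x) (hw1 : ∀ x, w x ≤ 1) (i : ℕ) :
    QuadNonneg ((CombBandit.updateMean D w)^[i] R) := by
  induction i with
  | zero => exact hR
  | succ i ih =>
    rw [Function.iterate_succ_apply']
    exact ih.updateMean hD hw hw0 hw1

omit [IsProbabilityMeasure D] hD hw in
lemma quadNonneg_one : QuadNonneg (1 : Matrix (Fin d) (Fin d) ℝ) := fun v => by
  rw [Matrix.one_mulVec]
  exact Finset.sum_nonneg fun i _ => mul_self_nonneg _

omit [IsProbabilityMeasure D] hD hw in
lemma trace_nonneg_of_quadNonneg {R : Matrix (Fin d) (Fin d) ℝ} (hR : QuadNonneg R) :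
    0 ≤ R.trace := by
  refine Finset.sum_nonneg fun i _ => ?_
  have := hR (Pi.single i 1)
  simpa using this

/-- Telescoping `tr Φⁱ(I)`, where `Φ` is the averaged update: each step loses at least
`3/4 tr (S Φⁱ(I))`, because `Φ` is self-adjoint for the trace form and `Φ(I) ≤ I - 3/4 S`. -/
lemma sum_trace_updateMean_iterate_le (hw0 : ∀ x, 0 ≤ w x) (hw1 : ∀ x, w x ≤ 1) (N : ℕ) :
    ∑ i ∈ Finset.range N, (wMoment D w * (updateMean D w)^[i] 1).trace ≤ 4 / 3 * d := by
  have key : ∀ N, 3 / 4 * ∑ i ∈ Finset.range N, (wMoment D w * (updateMean D w)^[i] 1).trace ≤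
      d - ((updateMean D w)^[N] 1).trace := by
    intro N
    induction N with
    | zero => simp
    | succ N ih =>
      have hq := quadNonneg_updateMean_iterate hD hw quadNonneg_one hw0 hw1 N
      have h := trace_mul_updateMean_one_le hD hw hq hw0
      have h2 := trace_updateMean_mul hD hw ((updateMean D w)^[N] 1) 1
      rw [Matrix.mul_one, ← Function.iterate_succ_apply' (updateMean D w)] at h2
      rw [Finset.sum_range_succ, h2]
      linarith
  have := trace_nonneg_of_quadNonneg
    (quadNonneg_updateMean_iterate hD hw quadNonneg_one hw0 hw1 N)
  have := key N
  linarith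

lemma trace_iterate_vecMulVec (i : ℕ) (R : Matrix (Fin d) (Fin d) ℝ) (x : Fin d → ℝ) :
    (R * (updateMean D w)^[i] (Matrix.vecMulVec x x)).trace =
      x ⬝ᵥ (updateMean D w)^[i] R *ᵥ x := by
  rw [← trace_updateMean_iterate hD hw, Matrix.mul_vecMulVec, Matrix.trace_vecMulVec,
    dotProduct_comm]

omit [IsProbabilityMeasure D] hD hw in
lemma sum_mul_pow_one_sub_half (S : Matrix (Fin d) (Fin d) ℝ) (N : ℕ) :
    ∑ r ∈ Finset.range N, S * (1 - (1 / 2 : ℝ) • S) ^ r =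
      (2 : ℝ) • (1 - (1 - (1 / 2 : ℝ) • S) ^ N) := by
  have h := mul_neg_geom_sum (1 - (1 / 2 : ℝ) • S) N
  rw [sub_sub_cancel, Matrix.smul_mul] at h
  rw [← Finset.mul_sum, ← h, smul_smul]
  norm_num

lemma dot_wMoment_self_bounds (hw0 : ∀ x, 0 ≤ w x) (hw1 : ∀ x, w x ≤ 1) (v : Fin d → ℝ) :
    0 ≤ v ⬝ᵥ wMoment D w *ᵥ v ∧ v ⬝ᵥ wMoment D w *ᵥ v ≤ v ⬝ᵥ v := by
  rw [dot_wMoment hD hw]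
  have hs : ∀ x : Ctx d, (v ⬝ᵥ x.ofLp) * (x.ofLp ⬝ᵥ v) = (v ⬝ᵥ x.ofLp) ^ 2 := fun x => by
    rw [dotProduct_comm x.ofLp, sq]
  constructor
  · exact integral_nonneg fun x => mul_nonneg (hw0 x) (by rw [hs]; positivity)
  · have hc : ∫ _ : Ctx d, v ⬝ᵥ v ∂D = v ⬝ᵥ v := by simp
    rw [← hc]
    refine integral_mono_ae ((hw.mul ((BallBdd.dot v).mul (BallBdd.dot' v))).integrable hD)
      (integrable_const _) (hD.mono fun x hx => ?_)
    have h1 : (v ⬝ᵥ x.ofLp) ^ 2 ≤ v ⬝ᵥ v := by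
      have h := Finset.sum_mul_sq_le_sq_mul_sq Finset.univ v x.ofLp
      have hx2 : ∑ i, x.ofLp i ^ 2 ≤ 1 := by
        rw [← EuclideanSpace.real_norm_sq_eq]
        exact pow_le_one₀ (norm_nonneg _) hx
      calc (v ⬝ᵥ x.ofLp) ^ 2 ≤ (∑ i, v i ^ 2) * ∑ i, x.ofLp i ^ 2 := h
        _ ≤ (∑ i, v i ^ 2) * 1 := by gcongr
        _ = v ⬝ᵥ v := by simp [dotProduct, sq]
    change w x * _ ≤ _
    rw [hs]
    nlinarith [hw0 x, hw1 x, sq_nonneg (v ⬝ᵥ x.ofLp)]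

lemma posSemidef_one_sub_half (hw0 : ∀ x, 0 ≤ w x) (hw1 : ∀ x, w x ≤ 1) :
    (1 - (1 / 2 : ℝ) • wMoment D w).PosSemidef := by
  refine Matrix.PosSemidef.of_dotProduct_mulVec_nonneg ?_ fun v => ?_
  · rw [Matrix.IsHermitian, Matrix.conjTranspose_eq_transpose_of_trivial, Matrix.transpose_sub,
      Matrix.transpose_smul, wMoment_transpose, Matrix.transpose_one]
  · have h := dot_wMoment_self_bounds hD hw hw0 hw1 v
    simp only [star_trivial, Matrix.sub_mulVec, Matrix.one_mulVec, Matrix.smul_mulVec,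
      dotProduct_sub, dotProduct_smul, smul_eq_mul]
    have := Finset.sum_nonneg fun (i : Fin d) (_ : i ∈ Finset.univ) => mul_self_nonneg (v i)
    change 0 ≤ v ⬝ᵥ v at this
    linarith

/-- Powers of a positive semidefinite contraction contract geometrically. -/
lemma abs_dot_pow_mulVec_le (hw0 : ∀ x, 0 ≤ w x) (hw1 : ∀ x, w x ≤ 1) {ρ : ℝ} (hρ : ρ ≤ 1 / 2)
    (hS : ∀ v : Fin d → ℝ, 2 * ρ * (v ⬝ᵥ v) ≤ v ⬝ᵥ wMoment D w *ᵥ v) (n : ℕ)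
    {x θ : Ctx d} (hx : ‖x‖ ≤ 1) (hθ : ‖θ‖ ≤ 1) :
    |x.ofLp ⬝ᵥ ((1 - (1 / 2 : ℝ) • wMoment D w) ^ n) *ᵥ θ.ofLp| ≤ (1 - ρ) ^ n := by
  set B := 1 - (1 / 2 : ℝ) • wMoment D w with hB
  have hpsd : B.PosSemidef := posSemidef_one_sub_half hD hw hw0 hw1
  have hBT : Bᵀ = B := by
    have := hpsd.isHermitian
    rwa [Matrix.IsHermitian, Matrix.conjTranspose_eq_transpose_of_trivial] at this
  have hr : 0 < 1 - ρ := by linarith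
  have hup : ∀ v, v ⬝ᵥ B *ᵥ v ≤ (1 - ρ) * (v ⬝ᵥ v) := fun v => by
    have := hS v
    simp only [hB, Matrix.sub_mulVec, Matrix.one_mulVec, Matrix.smul_mulVec,
      dotProduct_sub, dotProduct_smul, smul_eq_mul]
    linarith
  have hsq : ∀ v, (B *ᵥ v) ⬝ᵥ (B *ᵥ v) ≤ (1 - ρ) ^ 2 * (v ⬝ᵥ v) := fun v => by
    have h := hpsd.dotProduct_mulVec_nonneg (v - (1 - ρ)⁻¹ • B *ᵥ v)
    have e : v ⬝ᵥ B *ᵥ B *ᵥ v = (B *ᵥ v) ⬝ᵥ (B *ᵥ v) := by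
      rw [Matrix.dotProduct_mulVec, ← Matrix.mulVec_transpose, hBT]
    simp only [star_trivial, Matrix.mulVec_sub, Matrix.mulVec_smul, sub_dotProduct, dotProduct_sub,
      smul_dotProduct, dotProduct_smul, smul_eq_mul, e] at h
    have h1 := hup v
    have h2 := hup (B *ᵥ v)
    set p := (B *ᵥ v) ⬝ᵥ (B *ᵥ v)
    have h3 : (1 - ρ)⁻¹ * ((1 - ρ)⁻¹ * (B *ᵥ v ⬝ᵥ B *ᵥ B *ᵥ v)) ≤ (1 - ρ)⁻¹ * p := by
      gcongr
      calc _ ≤ (1 - ρ)⁻¹ * ((1 - ρ) * p) := by gcongr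
        _ = p := by field_simp
    have h4 : (1 - ρ)⁻¹ * p ≤ v ⬝ᵥ B *ᵥ v := by linarith
    have h5 : p = (1 - ρ) * ((1 - ρ)⁻¹ * p) := by field_simp
    calc p = (1 - ρ) * ((1 - ρ)⁻¹ * p) := h5
      _ ≤ (1 - ρ) * ((1 - ρ) * (v ⬝ᵥ v)) :=
        mul_le_mul_of_nonneg_left (h4.trans h1) hr.le
      _ = _ := by ring
  have hpow : ∀ n, ((B ^ n) *ᵥ θ.ofLp) ⬝ᵥ ((B ^ n) *ᵥ θ.ofLp) ≤ ((1 - ρ) ^ n) ^ 2 := by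
    intro n
    induction n with
    | zero =>
      simp only [pow_zero, Matrix.one_mulVec, one_pow]
      have : θ.ofLp ⬝ᵥ θ.ofLp = ‖θ‖ ^ 2 := by
        rw [EuclideanSpace.real_norm_sq_eq]; simp [dotProduct, sq]
      rw [this]
      exact pow_le_one₀ (norm_nonneg _) hθ
    | succ n ih =>
      rw [pow_succ', ← Matrix.mulVec_mulVec]
      refine (hsq _).trans ?_
      calc _ ≤ (1 - ρ) ^ 2 * ((1 - ρ) ^ n) ^ 2 := by gcongr
        _ = _ := by ring
  refine abs_le_of_sq_le_sq ?_ (by positivity)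
  have h := Finset.sum_mul_sq_le_sq_mul_sq Finset.univ x.ofLp ((B ^ n) *ᵥ θ.ofLp)
  have hx2 : ∑ i, x.ofLp i ^ 2 ≤ 1 := by
    rw [← EuclideanSpace.real_norm_sq_eq]
    exact pow_le_one₀ (norm_nonneg _) hx
  have hn := hpow n
  simp only [dotProduct, ← sq] at hn
  calc _ ≤ _ := h
    _ ≤ 1 * ((1 - ρ) ^ n) ^ 2 := by gcongr
    _ = _ := one_mul _

end Moments

/-! ### Bounded measurable functions with respect to sub-σ-algebras -/

/-- `f` is measurable with respect to the σ-algebra `𝓕` and almost surely bounded. -/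
structure BddMeas {Ω : Type*} [MeasurableSpace Ω] (P : Measure Ω) (𝓕 : MeasurableSpace Ω)
    (f : Ω → ℝ) : Prop where
  meas : Measurable[𝓕] f
  bdd : ∃ C, ∀ᵐ ω ∂P, |f ω| ≤ C

/-- `Φ ω x` is jointly measurable with respect to `𝓕` and the context, and almost surely bounded
for all contexts `x` in the unit ball. -/
structure JointBdd {Ω : Type*} {d : ℕ} [MeasurableSpace Ω] (P : Measure Ω) (𝓕 : MeasurableSpace Ω)
    (Φ : Ω → Ctx d → ℝ) : Prop where
  meas : Measurable[𝓕.prod inferInstance] (fun z : Ω × Ctx d => Φ z.1 z.2)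
  bdd : ∃ C, ∀ᵐ ω ∂P, ∀ x, ‖x‖ ≤ 1 → |Φ ω x| ≤ C

namespace BddMeas

variable {Ω : Type*} {𝓕 𝓖 : MeasurableSpace Ω} [mΩ : MeasurableSpace Ω] {P : Measure Ω}
  {f g : Ω → ℝ}

lemma const (c : ℝ) : BddMeas P 𝓕 (fun _ => c) :=
  ⟨measurable_const, |c|, Filter.Eventually.of_forall fun _ => le_rfl⟩

lemma mono (hf : BddMeas P 𝓕 f) (h : 𝓕 ≤ 𝓖) : BddMeas P 𝓖 f := ⟨hf.meas.mono h le_rfl, hf.bdd⟩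

lemma add (hf : BddMeas P 𝓕 f) (hg : BddMeas P 𝓕 g) : BddMeas P 𝓕 (fun ω => f ω + g ω) := by
  obtain ⟨mf, A, hA⟩ := hf
  obtain ⟨mg, B, hB⟩ := hg
  refine ⟨mf.add mg, A + B, ?_⟩
  filter_upwards [hA, hB] with ω h1 h2 using (abs_add_le _ _).trans (add_le_add h1 h2)

lemma mul (hf : BddMeas P 𝓕 f) (hg : BddMeas P 𝓕 g) : BddMeas P 𝓕 (fun ω => f ω * g ω) := by
  obtain ⟨mf, A, hA⟩ := hf
  obtain ⟨mg, B, hB⟩ := hg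
  refine ⟨mf.mul mg, A * B, ?_⟩
  filter_upwards [hA, hB] with ω h1 h2
  rw [abs_mul]
  exact mul_le_mul h1 h2 (abs_nonneg _) ((abs_nonneg _).trans h1)

lemma neg (hf : BddMeas P 𝓕 f) : BddMeas P 𝓕 (fun ω => -f ω) := by
  simpa using (const (-1)).mul hf

lemma sub (hf : BddMeas P 𝓕 f) (hg : BddMeas P 𝓕 g) : BddMeas P 𝓕 (fun ω => f ω - g ω) := by
  simpa [sub_eq_add_neg] using hf.add hg.neg

lemma pow (hf : BddMeas P 𝓕 f) (n : ℕ) : BddMeas P 𝓕 (fun ω => f ω ^ n) := by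
  induction n with
  | zero => simpa using const 1
  | succ n ih => simpa [pow_succ] using ih.mul hf

lemma sum {ι : Type*} (s : Finset ι) {f : ι → Ω → ℝ} (hf : ∀ i ∈ s, BddMeas P 𝓕 (f i)) :
    BddMeas P 𝓕 (fun ω => ∑ i ∈ s, f i ω) := by
  classical
  induction s using Finset.induction_on with
  | empty => simpa using const 0
  | insert a s ha ih =>
    simp only [Finset.sum_insert ha]
    exact (hf _ (Finset.mem_insert_self _ _)).add
      (ih fun i hi => hf i (Finset.mem_insert_of_mem hi))

lemma integrable [IsFiniteMeasure P] (hf : BddMeas P 𝓕 f) (h : 𝓕 ≤ mΩ) : Integrable f P := by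
  obtain ⟨mf, A, hA⟩ := hf
  exact Integrable.of_bound (mf.mono h le_rfl).aestronglyMeasurable A hA

lemma of_le {g : Ω → ℝ} (hg : Measurable[𝓕] g) {C : ℝ} (h : ∀ ω, |g ω| ≤ C) : BddMeas P 𝓕 g :=
  ⟨hg, C, Filter.Eventually.of_forall h⟩

variable {d : ℕ}

lemma dot {v c : Ω → Fin d → ℝ} (hv : ∀ i, BddMeas P 𝓕 (fun ω => v ω i))
    (hc : ∀ i, BddMeas P 𝓕 (fun ω => c ω i)) : BddMeas P 𝓕 (fun ω => v ω ⬝ᵥ c ω) :=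
  sum _ fun i _ => (hv i).mul (hc i)

lemma mulVec {R : Ω → Matrix (Fin d) (Fin d) ℝ} {c : Ω → Fin d → ℝ}
    (hR : ∀ i j, BddMeas P 𝓕 (fun ω => R ω i j))
    (hc : ∀ i, BddMeas P 𝓕 (fun ω => c ω i)) (i : Fin d) :
    BddMeas P 𝓕 (fun ω => (R ω *ᵥ c ω) i) :=
  sum (f := fun j ω => R ω i j * c ω j) Finset.univ fun j _ => (hR i j).mul (hc j)

lemma matMul {R Q : Ω → Matrix (Fin d) (Fin d) ℝ}
    (hR : ∀ i j, BddMeas P 𝓕 (fun ω => R ω i j)) (hQ : ∀ i j, BddMeas P 𝓕 (fun ω => Q ω i j))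
    (i j : Fin d) : BddMeas P 𝓕 (fun ω => (R ω * Q ω) i j) := by
  simp only [Matrix.mul_apply]
  exact sum _ fun k _ => (hR i k).mul (hQ k j)

lemma trace {R : Ω → Matrix (Fin d) (Fin d) ℝ}
    (hR : ∀ i j, BddMeas P 𝓕 (fun ω => R ω i j)) : BddMeas P 𝓕 (fun ω => (R ω).trace) :=
  sum _ fun i _ => hR i i

lemma matPow {R : Ω → Matrix (Fin d) (Fin d) ℝ}
    (hR : ∀ i j, BddMeas P 𝓕 (fun ω => R ω i j)) (n : ℕ) (i j : Fin d) :
    BddMeas P 𝓕 (fun ω => (R ω ^ n) i j) := by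
  induction n generalizing i j with
  | zero => simpa using const _
  | succ n ih => simp only [pow_succ]; exact matMul ih hR i j

/-- The indicator of the event `n ≤ M`. -/
lemma indicator_le {M : Ω → ℕ} (hM : Measurable[𝓕] M) (n : ℕ) :
    BddMeas P 𝓕 (fun ω => if n ≤ M ω then (1 : ℝ) else 0) :=
  of_le (Measurable.ite (hM (measurableSet_Ici (a := n))) measurable_const measurable_const)
    (C := 1) fun ω => by split_ifs <;> simp

end BddMeas

namespace JointBdd

variable {Ω : Type*} {d : ℕ} {𝓕 𝓖 : MeasurableSpace Ω} [mΩ : MeasurableSpace Ω] {P : Measure Ω}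
  {Φ Ψ : Ω → Ctx d → ℝ}

lemma mono (hf : JointBdd P 𝓕 Φ) (h : 𝓕 ≤ 𝓖) : JointBdd P 𝓖 Φ :=
  ⟨hf.meas.mono (sup_le_sup (MeasurableSpace.comap_mono h) le_rfl) le_rfl, hf.bdd⟩

lemma of_fst {f : Ω → ℝ} (hf : BddMeas P 𝓕 f) : JointBdd P 𝓕 (fun ω (_ : Ctx d) => f ω) := by
  obtain ⟨mf, A, hA⟩ := hf
  exact ⟨mf.comp (@measurable_fst _ _ 𝓕 _), A, hA.mono fun ω h x _ => h⟩

lemma of_snd {f : Ctx d → ℝ} (hf : BallBdd f) : JointBdd P 𝓕 (fun _ x => f x) := by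
  obtain ⟨mf, A, hA⟩ := hf
  exact ⟨mf.comp (@measurable_snd _ _ 𝓕 _), A, Filter.Eventually.of_forall fun ω x h => hA x h⟩

lemma add (hf : JointBdd P 𝓕 Φ) (hg : JointBdd P 𝓕 Ψ) : JointBdd P 𝓕 (fun ω x => Φ ω x + Ψ ω x) := by
  obtain ⟨mf, A, hA⟩ := hf
  obtain ⟨mg, B, hB⟩ := hg
  have hm := mf.add mg
  refine ⟨hm, A + B, ?_⟩
  filter_upwards [hA, hB] with ω h1 h2 x hx
    using (abs_add_le _ _).trans (add_le_add (h1 x hx) (h2 x hx))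

lemma mul (hf : JointBdd P 𝓕 Φ) (hg : JointBdd P 𝓕 Ψ) : JointBdd P 𝓕 (fun ω x => Φ ω x * Ψ ω x) := by
  obtain ⟨mf, A, hA⟩ := hf
  obtain ⟨mg, B, hB⟩ := hg
  have hm := mf.mul mg
  refine ⟨hm, A * B, ?_⟩
  filter_upwards [hA, hB] with ω h1 h2 x hx
  rw [abs_mul]
  exact mul_le_mul (h1 x hx) (h2 x hx) (abs_nonneg _) ((abs_nonneg _).trans (h1 x hx))

lemma neg (hf : JointBdd P 𝓕 Φ) : JointBdd P 𝓕 (fun ω x => -Φ ω x) := by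
  simpa using (of_snd (BallBdd.const (-1))).mul hf

lemma sub (hf : JointBdd P 𝓕 Φ) (hg : JointBdd P 𝓕 Ψ) : JointBdd P 𝓕 (fun ω x => Φ ω x - Ψ ω x) := by
  simpa [sub_eq_add_neg] using hf.add hg.neg

lemma sum {ι : Type*} (s : Finset ι) {Φ : ι → Ω → Ctx d → ℝ} (hf : ∀ i ∈ s, JointBdd P 𝓕 (Φ i)) :
    JointBdd P 𝓕 (fun ω x => ∑ i ∈ s, Φ i ω x) := by
  classical
  induction s using Finset.induction_on with
  | empty => simpa using of_snd (BallBdd.const 0)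
  | insert a s ha ih =>
    simp only [Finset.sum_insert ha]
    exact (hf _ (Finset.mem_insert_self _ _)).add
      (ih fun i hi => hf i (Finset.mem_insert_of_mem hi))

lemma coord (i : Fin d) : JointBdd P 𝓕 (fun _ (x : Ctx d) => x.ofLp i) := of_snd (BallBdd.coord i)

lemma dot {v c : Ω → Ctx d → Fin d → ℝ} (hv : ∀ i, JointBdd P 𝓕 (fun ω x => v ω x i))
    (hc : ∀ i, JointBdd P 𝓕 (fun ω x => c ω x i)) : JointBdd P 𝓕 (fun ω x => v ω x ⬝ᵥ c ω x) :=
  sum _ fun i _ => (hv i).mul (hc i)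

lemma mulVec {R : Ω → Matrix (Fin d) (Fin d) ℝ} {c : Ω → Ctx d → Fin d → ℝ}
    (hR : ∀ i j, BddMeas P 𝓕 (fun ω => R ω i j))
    (hc : ∀ i, JointBdd P 𝓕 (fun ω x => c ω x i)) (i : Fin d) :
    JointBdd P 𝓕 (fun ω x => (R ω *ᵥ c ω x) i) :=
  sum (Φ := fun j ω x => R ω i j * c ω x j) Finset.univ fun j _ => (of_fst (hR i j)).mul (hc j)

/-- Evaluation at a random context of norm at most one. -/
lemma eval (hf : JointBdd P 𝓕 Φ) (h : 𝓕 ≤ 𝓖) {X : Ω → Ctx d} (hX : Measurable[𝓖] X)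
    (hX1 : ∀ᵐ ω ∂P, ‖X ω‖ ≤ 1) : BddMeas P 𝓖 (fun ω => Φ ω (X ω)) := by
  obtain ⟨mf, A, hA⟩ := hf
  refine ⟨?_, A, ?_⟩
  · have h1 : Measurable[𝓖, 𝓕.prod inferInstance] (fun ω => (ω, X ω)) :=
      Measurable.prodMk (measurable_id'' h) hX
    exact mf.comp h1
  · filter_upwards [hA, hX1] with ω h1 h2 using h1 _ h2

/-- Integration over the context. -/
lemma integral (hf : JointBdd P 𝓕 Φ) {D : Measure (Ctx d)} [IsProbabilityMeasure D]
    (hD : ∀ᵐ x ∂D, ‖x‖ ≤ 1) : BddMeas P 𝓕 (fun ω => ∫ x, Φ ω x ∂D) := by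
  obtain ⟨mf, A, hA⟩ := hf
  refine ⟨?_, A, ?_⟩
  · have h1 := mf.stronglyMeasurable
    have h2 := @StronglyMeasurable.integral_prod_right' _ _ _ 𝓕 _ D _ _ _ _ h1
    exact h2.measurable
  · filter_upwards [hA] with ω h1
    have := norm_integral_le_of_norm_le_const (f := Φ ω) (C := A) (hD.mono fun x hx => h1 x hx)
    simpa using this

end JointBdd

lemma integral_comp_prodMk_eq {Ω E : Type*} {d : ℕ} [MeasurableSpace Ω] [MeasurableSpace E]
    {P : Measure Ω} [IsProbabilityMeasure P] {Y : Ω → E} (hY : Measurable Y) {X : Ω → Ctx d}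
    (hX : Measurable X) {D : Measure (Ctx d)} [IsProbabilityMeasure D] (hlaw : P.map X = D)
    (hD : ∀ᵐ x ∂D, ‖x‖ ≤ 1) (hind : IndepFun Y X P) {F : E × Ctx d → ℝ} (hF : Measurable F)
    (hb : ∃ C, ∀ᵐ ω ∂P, ∀ x, ‖x‖ ≤ 1 → |F (Y ω, x)| ≤ C) :
    ∫ ω, F (Y ω, X ω) ∂P = ∫ ω, ∫ x, F (Y ω, x) ∂D ∂P := by
  have hmap := hind.map_prod_eq_prod_map_map hY.aemeasurable hX.aemeasurable
  rw [hlaw] at hmap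
  have : IsProbabilityMeasure (P.map Y) := Measure.isProbabilityMeasure_map hY.aemeasurable
  have hint : Integrable F ((P.map Y).prod D) := by
    obtain ⟨C, hC⟩ := hb
    refine Integrable.of_bound hF.aestronglyMeasurable C ?_
    rw [← hmap, ae_map_iff (hY.prodMk hX).aemeasurable
      (measurableSet_le hF.norm measurable_const)]
    have hX1 : ∀ᵐ ω ∂P, ‖X ω‖ ≤ 1 := by
      rw [← hlaw] at hD
      exact ae_of_ae_map hX.aemeasurable hD
    filter_upwards [hC, hX1] with ω h1 h2 using h1 _ h2
  calc ∫ ω, F (Y ω, X ω) ∂P = ∫ z, F z ∂(P.map fun ω => (Y ω, X ω)) :=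
        (integral_map (hY.prodMk hX).aemeasurable hF.aestronglyMeasurable).symm
    _ = ∫ y, ∫ x, F (y, x) ∂D ∂(P.map Y) := by rw [hmap, integral_prod _ hint]
    _ = _ := integral_map hY.aemeasurable
        (hF.stronglyMeasurable.integral_prod_right').aestronglyMeasurable

/-- Integrating out an independent context: `X` is independent of `𝓕` and has law `D`. -/
lemma integral_joint_eq {Ω : Type*} {d : ℕ} {𝓕 : MeasurableSpace Ω}
    [mΩ : MeasurableSpace Ω] {P : Measure Ω} [IsProbabilityMeasure P] (h𝓕 : 𝓕 ≤ mΩ) {X : Ω → Ctx d}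
    (hX : Measurable X) {D : Measure (Ctx d)} [IsProbabilityMeasure D] (hlaw : P.map X = D)
    (hD : ∀ᵐ x ∂D, ‖x‖ ≤ 1)
    (hind : Indep (MeasurableSpace.comap X inferInstance) 𝓕 P) {Φ : Ω → Ctx d → ℝ}
    (hΦ : JointBdd P 𝓕 Φ) :
    ∫ ω, Φ ω (X ω) ∂P = ∫ ω, ∫ x, Φ ω x ∂D ∂P := by
  have hid : @Measurable Ω Ω mΩ 𝓕 id := measurable_id'' h𝓕
  have hi : @IndepFun Ω Ω (Ctx d) mΩ 𝓕 _ id X P := by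
    refine (@IndepFun_iff_Indep Ω Ω (Ctx d) mΩ 𝓕 _ id X P).2 ?_
    rw [MeasurableSpace.comap_id]
    exact hind.symm
  exact @integral_comp_prodMk_eq Ω Ω d mΩ 𝓕 P _ id hid X hX D _ hlaw hD hi
    (fun z => Φ z.1 z.2) hΦ.meas hΦ.bdd

/-! ### Products of random rank-one updates -/

/-- A sequence of context draws `X n` with indicators `a n ∈ {0, 1}`, adapted to the filtration `𝓖`:
given `𝓖 n`, the context `X n` has law `D`, and given also `X n` the indicator `a n` equals one
with probability `q(X n)`, where `q` is known at time `0`. -/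
structure Draws {Ω : Type*} {d : ℕ} [mΩ : MeasurableSpace Ω] (P : Measure Ω) (D : Measure (Ctx d))
    (𝓖 : ℕ → MeasurableSpace Ω) (X : ℕ → Ω → Ctx d) (a : ℕ → Ω → ℝ) (q : Ω → Ctx d → ℝ) :
    Prop where
  le : ∀ n, 𝓖 n ≤ mΩ
  mono : Monotone 𝓖
  context_norm : ∀ᵐ x ∂D, ‖x‖ ≤ 1
  X_meas : ∀ n, Measurable[𝓖 (n + 1)] (X n)
  X_norm : ∀ n, ∀ᵐ ω ∂P, ‖X n ω‖ ≤ 1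
  a_meas : ∀ n, Measurable[𝓖 (n + 1)] (a n)
  a_eq : ∀ n ω, a n ω = 0 ∨ a n ω = 1
  q_meas : Measurable[(𝓖 0).prod inferInstance] (fun z : Ω × Ctx d => q z.1 z.2)
  q_nonneg : ∀ ω x, 0 ≤ q ω x
  q_le_one : ∀ ω x, q ω x ≤ 1
  step : ∀ n (Φ : Ω → Ctx d → ℝ), JointBdd P (𝓖 n) Φ →
    ∫ ω, a n ω * Φ ω (X n ω) ∂P = ∫ ω, ∫ x, q ω x * Φ ω x ∂D ∂P

/-- The product `∏_{j=1}^n (I - a_j X_j X_jᵀ / 2)`, factors ordered from left to right. -/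
def updateProd {Ω : Type*} {d : ℕ} (X : ℕ → Ω → Ctx d) (a : ℕ → Ω → ℝ) (ω : Ω) :
    ℕ → Matrix (Fin d) (Fin d) ℝ
  | 0 => 1
  | n + 1 => updateProd X a ω n * (1 - (a (n + 1) ω / 2) •
      Matrix.vecMulVec (X (n + 1) ω).ofLp (X (n + 1) ω).ofLp)

/-- The row vector `xᵀ C_n` for the update product `C_n`. -/
def walk {Ω : Type*} {d : ℕ} (X : ℕ → Ω → Ctx d) (a : ℕ → Ω → ℝ) (x : Fin d → ℝ) (n : ℕ) (ω : Ω) :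
    Fin d → ℝ := x ᵥ* updateProd X a ω n

/-- The averaged factor `I - S / 2`. -/
def meanFactor {d : ℕ} (D : Measure (Ctx d)) (w : Ctx d → ℝ) : Matrix (Fin d) (Fin d) ℝ :=
  1 - (1 / 2 : ℝ) • wMoment D w

lemma walk_succ {Ω : Type*} {d : ℕ} (X : ℕ → Ω → Ctx d) (a : ℕ → Ω → ℝ) (x : Fin d → ℝ) (n : ℕ)
    (ω : Ω) : walk X a x (n + 1) ω = walk X a x n ω -
      (a (n + 1) ω / 2 * (walk X a x n ω ⬝ᵥ (X (n + 1) ω).ofLp)) • (X (n + 1) ω).ofLp := by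
  rw [walk, updateProd, ← Matrix.vecMul_vecMul, Matrix.vecMul_sub, Matrix.vecMul_one,
    Matrix.vecMul_smul, Matrix.vecMul_vecMulVec, smul_smul]
  rfl

lemma walk_zero {Ω : Type*} {d : ℕ} (X : ℕ → Ω → Ctx d) (a : ℕ → Ω → ℝ) (x : Fin d → ℝ) (ω : Ω) :
    walk X a x 0 ω = x := by
  rw [walk, updateProd, Matrix.vecMul_one]

namespace Draws

variable {Ω : Type*} {d : ℕ} {𝓕 : MeasurableSpace Ω} [mΩ : MeasurableSpace Ω] {P : Measure Ω}
  {D : Measure (Ctx d)}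
  {𝓖 : ℕ → MeasurableSpace Ω} {X : ℕ → Ω → Ctx d} {a : ℕ → Ω → ℝ} {q : Ω → Ctx d → ℝ}

section

variable (h : Draws P D 𝓖 X a q)
include h

lemma q_joint : JointBdd P (𝓖 0) q :=
  ⟨h.q_meas, 1, Filter.Eventually.of_forall fun ω x _ => by
    rw [abs_of_nonneg (h.q_nonneg ω x)]; exact h.q_le_one ω x⟩

lemma q_ball (ω : Ω) : BallBdd (q ω) :=
  ⟨h.q_meas.comp (@measurable_prodMk_left _ _ (𝓖 0) _ ω), 1, fun x _ => by
    rw [abs_of_nonneg (h.q_nonneg ω x)]; exact h.q_le_one ω x⟩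

lemma a_bdd (n : ℕ) : BddMeas P (𝓖 (n + 1)) (a n) :=
  BddMeas.of_le (h.a_meas n) (C := 1) fun ω => by rcases h.a_eq n ω with e | e <;> simp [e]

lemma X_bdd (n : ℕ) (i : Fin d) : BddMeas P (𝓖 (n + 1)) (fun ω => (X n ω).ofLp i) :=
  (JointBdd.coord i).eval le_rfl (h.X_meas n) (h.X_norm n)

lemma walk_bdd (x : Fin d → ℝ) (n : ℕ) (i : Fin d) :
    BddMeas P (𝓖 (n + 1)) (fun ω => walk X a x n ω i) := by
  induction n generalizing i with
  | zero => simpa only [walk_zero] using BddMeas.const (x i)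
  | succ n ih =>
    simp only [walk_succ, Pi.sub_apply, Pi.smul_apply, smul_eq_mul]
    have hm : 𝓖 (n + 1) ≤ 𝓖 (n + 1 + 1) := h.mono (by omega)
    have ha : BddMeas P (𝓖 (n + 1 + 1)) (fun ω => a (n + 1) ω / 2) := by
      simpa [div_eq_mul_inv] using (h.a_bdd (n + 1)).mul (BddMeas.const 2⁻¹)
    exact ((ih i).mono hm).sub ((ha.mul (BddMeas.dot (fun i => (ih i).mono hm)
      fun i => h.X_bdd (n + 1) i)).mul (h.X_bdd (n + 1) i))

variable [IsProbabilityMeasure D]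

lemma wMoment_bdd (i j : Fin d) : BddMeas P (𝓖 0) (fun ω => wMoment D (q ω) i j) :=
  (h.q_joint.mul ((JointBdd.coord i).mul (JointBdd.coord j))).integral h.context_norm

lemma meanFactor_bdd (i j : Fin d) : BddMeas P (𝓖 0) (fun ω => meanFactor D (q ω) i j) :=
  (BddMeas.const ((1 : Matrix (Fin d) (Fin d) ℝ) i j)).sub
    ((BddMeas.const (1 / 2)).mul (h.wMoment_bdd i j))

lemma updateMean_bdd (h𝓕 : 𝓖 0 ≤ 𝓕) {R : Ω → Matrix (Fin d) (Fin d) ℝ}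
    (hR : ∀ i j, BddMeas P 𝓕 (fun ω => R ω i j)) (i j : Fin d) :
    BddMeas P 𝓕 (fun ω => updateMean D (q ω) (R ω) i j) := by
  have hS := fun i j => (h.wMoment_bdd i j).mono h𝓕
  refine ((hR i j).sub ((BddMeas.const (1 / 2)).mul
    ((BddMeas.matMul hS hR i j).add (BddMeas.matMul hR hS i j)))).add
    ((BddMeas.const (1 / 4)).mul (JointBdd.integral (Φ := fun ω x => q ω x *
      (x.ofLp ⬝ᵥ R ω *ᵥ x.ofLp) * (x.ofLp i * x.ofLp j)) ?_ h.context_norm))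
  exact ((h.q_joint.mono h𝓕).mul (JointBdd.dot JointBdd.coord
    (JointBdd.mulVec hR JointBdd.coord))).mul ((JointBdd.coord i).mul (JointBdd.coord j))

lemma updateMean_iterate_bdd (R : Matrix (Fin d) (Fin d) ℝ) (n : ℕ) (i j : Fin d) :
    BddMeas P (𝓖 0) (fun ω => (updateMean D (q ω))^[n] R i j) := by
  induction n generalizing i j with
  | zero => exact BddMeas.const _
  | succ n ih =>
    simp only [Function.iterate_succ_apply']
    exact h.updateMean_bdd le_rfl ih i j

variable [IsProbabilityMeasure P]

/-- One update averages to `I - S / 2` in linear expressions. -/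
lemma integral_step_linear (n : ℕ) {v c : Ω → Fin d → ℝ} (hv : ∀ i, BddMeas P (𝓖 n) (fun ω => v ω i))
    (hc : ∀ i, BddMeas P (𝓖 n) (fun ω => c ω i)) :
    ∫ ω, (v ω - (a n ω / 2 * (v ω ⬝ᵥ (X n ω).ofLp)) • (X n ω).ofLp) ⬝ᵥ c ω ∂P =
      ∫ ω, v ω ⬝ᵥ (meanFactor D (q ω) *ᵥ c ω) ∂P := by
  have hJ : JointBdd P (𝓖 n) (fun ω x => (v ω ⬝ᵥ x.ofLp) * (x.ofLp ⬝ᵥ c ω)) :=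
    (JointBdd.dot (fun i => JointBdd.of_fst (hv i)) JointBdd.coord).mul
      (JointBdd.dot JointBdd.coord (fun i => JointBdd.of_fst (hc i)))
  have hs := h.step n _ hJ
  have hle : 𝓖 n ≤ 𝓖 (n + 1) := h.mono (by omega)
  have i0 := (BddMeas.dot hv hc).integrable (h.le n)
  have i1 := ((h.a_bdd n).mul (hJ.eval hle (h.X_meas n) (h.X_norm n))).integrable (h.le (n + 1))
  have hJq := ((h.q_joint.mono (h.mono (Nat.zero_le n))).mul hJ)
  have i2 := (hJq.integral h.context_norm).integrable (h.le n)
  calc ∫ ω, (v ω - (a n ω / 2 * (v ω ⬝ᵥ (X n ω).ofLp)) • (X n ω).ofLp) ⬝ᵥ c ω ∂P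
      = ∫ ω, v ω ⬝ᵥ c ω - 1 / 2 * (a n ω * ((v ω ⬝ᵥ (X n ω).ofLp) * ((X n ω).ofLp ⬝ᵥ c ω))) ∂P := by
        congr 1; ext ω
        rw [sub_dotProduct, smul_dotProduct, smul_eq_mul]; ring
    _ = ∫ ω, v ω ⬝ᵥ c ω - 1 / 2 * ∫ x, q ω x * ((v ω ⬝ᵥ x.ofLp) * (x.ofLp ⬝ᵥ c ω)) ∂D ∂P := by
        rw [integral_sub i0 (i1.const_mul _), integral_sub i0 (i2.const_mul _), integral_const_mul,
          integral_const_mul, hs]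
    _ = _ := by
        congr 1; ext ω
        rw [← dot_wMoment h.context_norm (h.q_ball ω), meanFactor, Matrix.sub_mulVec,
          Matrix.one_mulVec, Matrix.smul_mulVec, dotProduct_sub, dotProduct_smul, smul_eq_mul]

/-- One update averages to `updateMean` in quadratic expressions. -/
lemma integral_step_quadratic (n : ℕ) {v : Ω → Fin d → ℝ} {R : Ω → Matrix (Fin d) (Fin d) ℝ}
    (hv : ∀ i, BddMeas P (𝓖 n) (fun ω => v ω i))
    (hR : ∀ i j, BddMeas P (𝓖 n) (fun ω => R ω i j)) :
    ∫ ω, (v ω - (a n ω / 2 * (v ω ⬝ᵥ (X n ω).ofLp)) • (X n ω).ofLp) ⬝ᵥ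
        R ω *ᵥ (v ω - (a n ω / 2 * (v ω ⬝ᵥ (X n ω).ofLp)) • (X n ω).ofLp) ∂P =
      ∫ ω, v ω ⬝ᵥ (updateMean D (q ω) (R ω) *ᵥ v ω) ∂P := by
  have jv : ∀ i, JointBdd P (𝓖 n) (fun ω (_ : Ctx d) => v ω i) := fun i => JointBdd.of_fst (hv i)
  have hJ : JointBdd P (𝓖 n) (fun ω x =>
      -(1 / 2) * ((v ω ⬝ᵥ x.ofLp) * (x.ofLp ⬝ᵥ R ω *ᵥ v ω) +
        (v ω ⬝ᵥ R ω *ᵥ x.ofLp) * (x.ofLp ⬝ᵥ v ω)) +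
      1 / 4 * ((x.ofLp ⬝ᵥ R ω *ᵥ x.ofLp) * ((v ω ⬝ᵥ x.ofLp) * (x.ofLp ⬝ᵥ v ω)))) :=
    ((JointBdd.of_fst (BddMeas.const _)).mul
      (((JointBdd.dot jv JointBdd.coord).mul (JointBdd.dot JointBdd.coord
        (JointBdd.mulVec hR jv))).add
      ((JointBdd.dot jv (JointBdd.mulVec hR JointBdd.coord)).mul
        (JointBdd.dot JointBdd.coord jv)))).add
      ((JointBdd.of_fst (BddMeas.const _)).mul
      ((JointBdd.dot JointBdd.coord (JointBdd.mulVec hR JointBdd.coord)).mul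
        ((JointBdd.dot jv JointBdd.coord).mul (JointBdd.dot JointBdd.coord jv))))
  have hs := h.step n _ hJ
  have hle : 𝓖 n ≤ 𝓖 (n + 1) := h.mono (by omega)
  have i0 := (BddMeas.dot hv (BddMeas.mulVec hR hv)).integrable (h.le n)
  have i1 := ((h.a_bdd n).mul (hJ.eval hle (h.X_meas n) (h.X_norm n))).integrable (h.le (n + 1))
  have hJq := ((h.q_joint.mono (h.mono (Nat.zero_le n))).mul hJ)
  have i2 := (hJq.integral h.context_norm).integrable (h.le n)
  simp only [fun ω => dot_updateMean h.context_norm (h.q_ball ω) (R ω) (v ω)]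
  rw [integral_add i0 i2, ← hs, ← integral_add i0 i1]
  congr 1; ext ω
  simp only [Matrix.mulVec_sub, Matrix.mulVec_smul, sub_dotProduct, dotProduct_sub, smul_dotProduct,
    dotProduct_smul, smul_eq_mul, dotProduct_comm (X n ω).ofLp (v ω)]
  rcases h.a_eq n ω with e | e <;> rw [e] <;> ring

/-- The `r` updates that follow the first `i` are averaged out of a linear expression. -/
lemma integral_walk_dot (x : Fin d → ℝ) (i r : ℕ) {c : Ω → Fin d → ℝ}
    (hc : ∀ j, BddMeas P (𝓖 (i + 1)) (fun ω => c ω j)) :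
    ∫ ω, walk X a x (i + r) ω ⬝ᵥ c ω ∂P =
      ∫ ω, walk X a x i ω ⬝ᵥ (meanFactor D (q ω) ^ r *ᵥ c ω) ∂P := by
  induction r generalizing c with
  | zero => simp
  | succ r ih =>
    simp only [← add_assoc, walk_succ]
    rw [h.integral_step_linear (i + r + 1) (fun j => h.walk_bdd x (i + r) j)
      (fun j => (hc j).mono (h.mono (by omega))),
      ih fun j => BddMeas.mulVec (fun k l => (h.meanFactor_bdd k l).mono (h.mono (by omega))) hc j]
    simp only [Matrix.mulVec_mulVec, pow_succ]

/-- All `i` updates are averaged out of a quadratic expression. -/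
lemma integral_walk_quad (x : Fin d → ℝ) (i : ℕ) {R : Ω → Matrix (Fin d) (Fin d) ℝ}
    (hR : ∀ j k, BddMeas P (𝓖 1) (fun ω => R ω j k)) :
    ∫ ω, walk X a x i ω ⬝ᵥ R ω *ᵥ walk X a x i ω ∂P =
      ∫ ω, (R ω * (updateMean D (q ω))^[i] (Matrix.vecMulVec x x)).trace ∂P := by
  induction i generalizing R with
  | zero =>
    simp only [walk_zero, Function.iterate_zero, id, Matrix.mul_vecMulVec, Matrix.trace_vecMulVec]
    congr 1; ext ω; exact dotProduct_comm _ _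
  | succ i ih =>
    simp only [walk_succ]
    rw [h.integral_step_quadratic (i + 1) (fun j => h.walk_bdd x i j)
      (fun j k => (hR j k).mono (h.mono (by omega))),
      ih fun j k => h.updateMean_bdd (h.mono (by omega)) hR j k]
    simp only [Function.iterate_succ_apply',
      fun ω => trace_updateMean_mul h.context_norm (h.q_ball ω)]

end

end Draws

/-- The square of a sum is at most twice the upper triangle of its expansion. -/
lemma sq_sum_range_le (z : ℕ → ℝ) (N : ℕ) :
    (∑ i ∈ Finset.range N, z i) ^ 2 ≤
      2 * ∑ i ∈ Finset.range N, ∑ j ∈ Finset.Ico i N, z i * z j := by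
  induction N with
  | zero => simp
  | succ N ih =>
    have e : ∑ i ∈ Finset.range (N + 1), ∑ j ∈ Finset.Ico i (N + 1), z i * z j =
        ∑ i ∈ Finset.range N, ∑ j ∈ Finset.Ico i N, z i * z j +
          (∑ i ∈ Finset.range N, z i) * z N + z N ^ 2 := by
      rw [Finset.sum_range_succ, Nat.Ico_succ_singleton, Finset.sum_singleton, Finset.sum_mul,
        ← Finset.sum_add_distrib, sq]
      congr 1
      refine Finset.sum_congr rfl fun i hi => ?_
      rw [Finset.sum_Ico_succ_top (Finset.mem_range.1 hi).le]
    rw [e, Finset.sum_range_succ]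
    nlinarith [sq_nonneg (z N)]

lemma sum_range_succ_eq_sum_ite (f : ℕ → ℝ) {M N : ℕ} (h : M ≤ N) :
    ∑ n ∈ Finset.range (M + 1), f n =
      ∑ n ∈ Finset.range (N + 1), (if n ≤ M then (1 : ℝ) else 0) * f n := by
  simp only [ite_mul, one_mul, zero_mul]
  rw [← Finset.sum_filter]
  congr 1
  ext n; simp; omega

lemma sum_Ico_ite_eq (f : ℕ → ℝ) {M N : ℕ} (h : M ≤ N) (i : ℕ) :
    ∑ j ∈ Finset.Ico i (N + 1), (if j ≤ M then (1 : ℝ) else 0) * f (j - i) =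
      ∑ r ∈ Finset.range (M + 1 - i), f r := by
  simp only [ite_mul, one_mul, zero_mul]
  rw [← Finset.sum_filter]
  have : (Finset.Ico i (N + 1)).filter (fun j => j ≤ M) = Finset.Ico i (M + 1) := by
    ext n; simp; omega
  rw [this, Finset.sum_Ico_eq_sum_range]
  simp

namespace Draws

variable {Ω : Type*} {d : ℕ} {𝓗 : MeasurableSpace Ω} [mΩ : MeasurableSpace Ω] {P : Measure Ω}
  {D : Measure (Ctx d)} [IsProbabilityMeasure D] [IsProbabilityMeasure P]
  {𝓖 : ℕ → MeasurableSpace Ω} {X : ℕ → Ω → Ctx d} {a : ℕ → Ω → ℝ} {q : Ω → Ctx d → ℝ}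

omit [IsProbabilityMeasure D] in
lemma meanFactor_commute {w : Ctx d → ℝ} (r : ℕ) :
    meanFactor D w ^ r * wMoment D w = wMoment D w * meanFactor D w ^ r := by
  have : Commute (meanFactor D w) (wMoment D w) :=
    (Commute.one_left _).sub_left ((Commute.refl _).smul_left _)
  exact this.pow_left r

omit [IsProbabilityMeasure P] in
/-- The geometric sum `∑_{r < n} S (I - S/2)^r = 2 (I - (I - S/2)^n)` bounds the cross terms of the
`i`-th update product with all later ones. -/
lemma iterate_meanFactor_sum_le (h : Draws P D 𝓖 X a q) (x : Fin d → ℝ) (i n : ℕ) (ω : Ω) :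
    ∑ r ∈ Finset.range n, (wMoment D (q ω) * ((updateMean D (q ω))^[i] (Matrix.vecMulVec x x) *
      meanFactor D (q ω) ^ r)).trace ≤ 2 * (x ⬝ᵥ (updateMean D (q ω))^[i] 1 *ᵥ x) := by
  set Y := (updateMean D (q ω))^[i] (Matrix.vecMulVec x x) with hY
  have h1 : ∀ r, (wMoment D (q ω) * (Y * meanFactor D (q ω) ^ r)).trace =
      ((wMoment D (q ω) * meanFactor D (q ω) ^ r) * Y).trace := fun r => by
    rw [← Matrix.mul_assoc, Matrix.trace_mul_comm, ← Matrix.mul_assoc, meanFactor_commute]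
  have h2 := sum_mul_pow_one_sub_half (wMoment D (q ω)) n
  simp only [h1]
  rw [← Matrix.trace_sum, ← Finset.sum_mul]
  simp only [meanFactor]
  rw [h2, Matrix.smul_mul, Matrix.trace_smul, Matrix.sub_mul, Matrix.trace_sub, hY,
    trace_iterate_vecMulVec h.context_norm (h.q_ball ω),
    trace_iterate_vecMulVec h.context_norm (h.q_ball ω), smul_eq_mul]
  have hp : QuadNonneg ((1 - (1 / 2 : ℝ) • wMoment D (q ω)) ^ n) := fun v => by
    have := ((posSemidef_one_sub_half h.context_norm (h.q_ball ω) (h.q_nonneg ω)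
      (h.q_le_one ω)).pow n).dotProduct_mulVec_nonneg v
    simpa using this
  have := quadNonneg_updateMean_iterate h.context_norm (h.q_ball ω) hp (h.q_nonneg ω)
    (h.q_le_one ω) i x
  linarith

/-- A cross term of the second moment, in terms of `S`, the averaged update and `I - S / 2`. -/
lemma integral_cross_term (h : Draws P D 𝓖 X a q) (x : Fin d → ℝ) {s : Ω → ℝ}
    (hs : BddMeas P (𝓖 0) s) (i r : ℕ) :
    ∫ ω, s ω * a 0 ω * ((walk X a x i ω ⬝ᵥ (X 0 ω).ofLp) *
        (walk X a x (i + r) ω ⬝ᵥ (X 0 ω).ofLp)) ∂P =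
      ∫ ω, s ω * (wMoment D (q ω) * ((updateMean D (q ω))^[i] (Matrix.vecMulVec x x) *
      meanFactor D (q ω) ^ r)).trace ∂P := by
  set Y : Ω → Matrix (Fin d) (Fin d) ℝ :=
    fun ω => (updateMean D (q ω))^[i] (Matrix.vecMulVec x x) with hY
  have hYb : ∀ j k, BddMeas P (𝓖 0) (fun ω => Y ω j k) := fun j k => h.updateMean_iterate_bdd _ i j k
  have hBb : ∀ j k, BddMeas P (𝓖 0) (fun ω => (meanFactor D (q ω) ^ r) j k) :=
    fun j k => BddMeas.matPow h.meanFactor_bdd r j k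
  have h01 : 𝓖 0 ≤ 𝓖 1 := h.mono (by omega)
  have h1i : 𝓖 1 ≤ 𝓖 (i + 1) := h.mono (by omega)
  have hsa : BddMeas P (𝓖 1) (fun ω => s ω * a 0 ω) := (hs.mono h01).mul (h.a_bdd 0)
  have hc : ∀ j, BddMeas P (𝓖 (i + 1)) (fun ω =>
      ((s ω * a 0 ω * (walk X a x i ω ⬝ᵥ (X 0 ω).ofLp)) • (X 0 ω).ofLp) j) := fun j =>
    ((hsa.mono h1i).mul (BddMeas.dot (h.walk_bdd x i) fun j => (h.X_bdd 0 j).mono h1i)).mul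
      ((h.X_bdd 0 j).mono h1i)
  have hR : ∀ j k, BddMeas P (𝓖 1) (fun ω => ((s ω * a 0 ω) • Matrix.vecMulVec
      (meanFactor D (q ω) ^ r *ᵥ (X 0 ω).ofLp) (X 0 ω).ofLp) j k) := fun j k =>
    hsa.mul ((BddMeas.mulVec (fun j k => (hBb j k).mono h01) (h.X_bdd 0) j).mul (h.X_bdd 0 k))
  have hJ : JointBdd P (𝓖 0) (fun ω y => s ω *
      (y.ofLp ⬝ᵥ (Y ω * meanFactor D (q ω) ^ r) *ᵥ y.ofLp)) :=
    (JointBdd.of_fst hs).mul (JointBdd.dot JointBdd.coord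
      (JointBdd.mulVec (BddMeas.matMul hYb hBb) JointBdd.coord))
  calc _ = ∫ ω, walk X a x (i + r) ω ⬝ᵥ
        ((s ω * a 0 ω * (walk X a x i ω ⬝ᵥ (X 0 ω).ofLp)) • (X 0 ω).ofLp) ∂P := by
        congr 1; ext ω; rw [dotProduct_smul, smul_eq_mul]; ring
    _ = ∫ ω, walk X a x i ω ⬝ᵥ ((s ω * a 0 ω) • Matrix.vecMulVec
      (meanFactor D (q ω) ^ r *ᵥ (X 0 ω).ofLp) (X 0 ω).ofLp) *ᵥ walk X a x i ω ∂P := by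
        rw [h.integral_walk_dot x i r hc]
        congr 1; ext ω
        rw [Matrix.mulVec_smul, dotProduct_smul, Matrix.smul_mulVec, dotProduct_smul,
          Matrix.vecMulVec_mulVec, dotProduct_comm (X 0 ω).ofLp]
        simp only [smul_eq_mul, dotProduct, Pi.smul_apply, MulOpposite.smul_eq_mul_unop,
          MulOpposite.unop_op, Finset.mul_sum, Finset.sum_mul]
        refine Finset.sum_congr rfl fun _ _ => Finset.sum_congr rfl fun _ _ => by ring
    _ = ∫ ω, (((s ω * a 0 ω) • Matrix.vecMulVec
      (meanFactor D (q ω) ^ r *ᵥ (X 0 ω).ofLp) (X 0 ω).ofLp) * Y ω).trace ∂P :=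
        h.integral_walk_quad x i hR
    _ = ∫ ω, a 0 ω * (s ω * ((X 0 ω).ofLp ⬝ᵥ (Y ω * meanFactor D (q ω) ^ r) *ᵥ (X 0 ω).ofLp)) ∂P := by
        congr 1; ext ω
        rw [Matrix.smul_mul, Matrix.trace_smul, Matrix.vecMulVec_mul, Matrix.trace_vecMulVec,
          ← Matrix.mulVec_mulVec, Matrix.dotProduct_mulVec _ (Y ω), dotProduct_comm _ (_ ᵥ* _),
          smul_eq_mul]
        ring
    _ = ∫ ω, ∫ y, q ω y * (s ω * (y.ofLp ⬝ᵥ (Y ω * meanFactor D (q ω) ^ r) *ᵥ y.ofLp)) ∂D ∂P :=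
        h.step 0 _ hJ
    _ = _ := by
        congr 1; ext ω
        rw [trace_wMoment_mul h.context_norm (h.q_ball ω), ← integral_const_mul]
        congr 1; ext y; ring

/-- Second moment of the estimated loss at a fixed point `x`. The double sum over pairs of update
products is at most twice its upper triangle, whose inner sums are geometric. -/
theorem integral_sq_estimate_le (h : Draws P D 𝓖 X a q) (x : Fin d → ℝ) {s : Ω → ℝ}
    (hs : BddMeas P (𝓖 0) s) (hs0 : ∀ ω, 0 ≤ s ω) {M : Ω → ℕ} (hM : Measurable[𝓖 0] M) {N : ℕ}
    (hMN : ∀ ω, M ω ≤ N) :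
    ∫ ω, s ω * (a 0 ω * (1 / 2 * ∑ n ∈ Finset.range (M ω + 1),
        walk X a x n ω ⬝ᵥ (X 0 ω).ofLp) ^ 2) ∂P ≤
      ∫ ω, s ω * ∑ i ∈ Finset.range (N + 1), x ⬝ᵥ (updateMean D (q ω))^[i] 1 *ᵥ x ∂P := by
  have h0 : ∀ n, 𝓖 0 ≤ 𝓖 n := fun n => h.mono (Nat.zero_le n)
  set y : ℕ → Ω → ℝ := fun n ω => walk X a x n ω ⬝ᵥ (X 0 ω).ofLp with hy
  set I : ℕ → Ω → ℝ := fun n ω => if n ≤ M ω then (1 : ℝ) else 0 with hI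
  have hIb : ∀ n, BddMeas P (𝓖 0) (I n) := fun n => BddMeas.indicator_le hM n
  have hyb : ∀ n N, n ≤ N → BddMeas P (𝓖 (N + 1)) (y n) := fun n N hn =>
    BddMeas.dot (fun i => (h.walk_bdd x n i).mono (h.mono (by omega)))
      (fun i => (h.X_bdd 0 i).mono (h.mono (by omega)))
  have hab : ∀ n, BddMeas P (𝓖 (n + 1)) (a 0) := fun n => (h.a_bdd 0).mono (h.mono (by omega))
  have hYb : ∀ i j k, BddMeas P (𝓖 0)
      (fun ω => (updateMean D (q ω))^[i] (Matrix.vecMulVec x x) j k) :=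
    fun i j k => h.updateMean_iterate_bdd _ i j k
  have hterm : ∀ i j, i ∈ Finset.range (N + 1) → j ∈ Finset.Ico i (N + 1) →
      Integrable (fun ω => s ω * a 0 ω * I j ω * (y i ω * y j ω)) P := fun i j hi hj => by
    have hiN := Finset.mem_range.1 hi
    have hjN := Finset.mem_Ico.1 hj
    exact (((((hs.mono (h0 _)).mul (hab N)).mul ((hIb j).mono (h0 _))).mul
      ((hyb i N (by omega)).mul (hyb j N (by omega)))).integrable (h.le _))
  have hterm2 : ∀ i j, BddMeas P (𝓖 0) (fun ω => s ω * I j ω * (wMoment D (q ω) *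
      ((updateMean D (q ω))^[i] (Matrix.vecMulVec x x) * meanFactor D (q ω) ^ (j - i))).trace) :=
    fun i j => (hs.mul (hIb j)).mul (BddMeas.trace (BddMeas.matMul h.wMoment_bdd
      (BddMeas.matMul (hYb i) (BddMeas.matPow h.meanFactor_bdd _))))
  have hone : ∀ i, BddMeas P (𝓖 0) (fun ω => x ⬝ᵥ (updateMean D (q ω))^[i] 1 *ᵥ x) := fun i =>
    BddMeas.dot (fun _ => BddMeas.const _) (BddMeas.mulVec (h.updateMean_iterate_bdd _ i)
      fun _ => BddMeas.const _)
  have hpt : ∀ ω, s ω * (a 0 ω * (1 / 2 * ∑ n ∈ Finset.range (M ω + 1), y n ω) ^ 2) ≤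
      1 / 2 * ∑ i ∈ Finset.range (N + 1), ∑ j ∈ Finset.Ico i (N + 1),
        s ω * a 0 ω * I j ω * (y i ω * y j ω) := fun ω => by
    have h1 := sq_sum_range_le (fun n => I n ω * y n ω) (N + 1)
    rw [← sum_range_succ_eq_sum_ite (fun n => y n ω) (hMN ω)] at h1
    have h2 : ∑ i ∈ Finset.range (N + 1), ∑ j ∈ Finset.Ico i (N + 1),
        I i ω * y i ω * (I j ω * y j ω) = ∑ i ∈ Finset.range (N + 1), ∑ j ∈ Finset.Ico i (N + 1),
        I j ω * (y i ω * y j ω) := by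
      refine Finset.sum_congr rfl fun i _ => Finset.sum_congr rfl fun j hj => ?_
      have hij := (Finset.mem_Ico.1 hj).1
      simp only [hI]
      split_ifs
      · ring
      · ring
      · omega
      · ring
    rw [h2] at h1
    have ha : 0 ≤ a 0 ω := by rcases h.a_eq 0 ω with e | e <;> simp [e]
    have h3 := mul_le_mul_of_nonneg_left h1 (mul_nonneg (hs0 ω) ha)
    have h4 : s ω * a 0 ω * (2 * ∑ i ∈ Finset.range (N + 1), ∑ j ∈ Finset.Ico i (N + 1),
        I j ω * (y i ω * y j ω)) = 2 * ∑ i ∈ Finset.range (N + 1), ∑ j ∈ Finset.Ico i (N + 1),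
        s ω * a 0 ω * I j ω * (y i ω * y j ω) := by
      simp only [Finset.mul_sum]
      refine Finset.sum_congr rfl fun i _ => Finset.sum_congr rfl fun j hj => ?_
      ring
    rw [h4] at h3
    calc _ = 1 / 4 * (s ω * a 0 ω * (∑ n ∈ Finset.range (M ω + 1), y n ω) ^ 2) := by ring
      _ ≤ _ := by linarith
  calc _ ≤ ∫ ω, 1 / 2 * ∑ i ∈ Finset.range (N + 1), ∑ j ∈ Finset.Ico i (N + 1),
        s ω * a 0 ω * I j ω * (y i ω * y j ω) ∂P := by
        refine integral_mono ?_ ((integrable_finsetSum _ fun i hi =>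
          integrable_finsetSum _ fun j hj => hterm i j hi hj).const_mul _) hpt
        have e : (fun ω => s ω * (a 0 ω * (1 / 2 * ∑ n ∈ Finset.range (M ω + 1), y n ω) ^ 2)) =
            fun ω => s ω * (a 0 ω * (1 / 2 * ∑ n ∈ Finset.range (N + 1), I n ω * y n ω) ^ 2) := by
          ext ω; rw [sum_range_succ_eq_sum_ite (fun n => y n ω) (hMN ω)]
        rw [e]
        exact ((hs.mono (h0 _)).mul ((hab N).mul (((BddMeas.const _).mul (BddMeas.sum _
          fun n hn => ((hIb n).mono (h0 _)).mul
            (hyb n N (by have := Finset.mem_range.1 hn; omega)))).pow 2))).integrable (h.le (N + 1))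
    _ = 1 / 2 * ∑ i ∈ Finset.range (N + 1), ∑ j ∈ Finset.Ico i (N + 1),
        ∫ ω, s ω * I j ω * (wMoment D (q ω) *
      ((updateMean D (q ω))^[i] (Matrix.vecMulVec x x) * meanFactor D (q ω) ^ (j - i))).trace ∂P := by
        rw [integral_const_mul, integral_finsetSum _ fun i hi =>
          integrable_finsetSum _ fun j hj => hterm i j hi hj]
        congr 1
        refine Finset.sum_congr rfl fun i hi => ?_
        rw [integral_finsetSum _ fun j hj => hterm i j hi hj]
        refine Finset.sum_congr rfl fun j hj => ?_
        rw [← h.integral_cross_term x (hs.mul (hIb j)) i (j - i),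
          Nat.add_sub_cancel' (Finset.mem_Ico.1 hj).1]
        congr 1; ext ω; ring
    _ = 1 / 2 * ∑ i ∈ Finset.range (N + 1), ∫ ω, s ω * ∑ j ∈ Finset.Ico i (N + 1), I j ω *
        (wMoment D (q ω) * ((updateMean D (q ω))^[i] (Matrix.vecMulVec x x) *
          meanFactor D (q ω) ^ (j - i))).trace ∂P := by
        congr 1
        refine Finset.sum_congr rfl fun i _ => ?_
        rw [← integral_finsetSum _ fun j _ => (hterm2 i j).integrable (h.le 0)]
        congr 1; ext ω; rw [Finset.mul_sum]
        exact Finset.sum_congr rfl fun j _ => by ring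
    _ ≤ 1 / 2 * ∑ i ∈ Finset.range (N + 1),
        ∫ ω, s ω * (2 * (x ⬝ᵥ (updateMean D (q ω))^[i] 1 *ᵥ x)) ∂P := by
        refine mul_le_mul_of_nonneg_left (Finset.sum_le_sum fun i hi => ?_) (by norm_num)
        refine integral_mono ?_ ((hs.mul ((BddMeas.const 2).mul (hone i))).integrable (h.le 0))
          fun ω => ?_
        · simp only [Finset.mul_sum, ← mul_assoc]
          exact integrable_finsetSum _ fun j _ => by
            simpa only [mul_assoc] using (hterm2 i j).integrable (h.le 0)
        · refine mul_le_mul_of_nonneg_left ?_ (hs0 ω)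
          rw [sum_Ico_ite_eq (fun r => (wMoment D (q ω) *
            ((updateMean D (q ω))^[i] (Matrix.vecMulVec x x) *
            meanFactor D (q ω) ^ r)).trace) (hMN ω)]
          exact h.iterate_meanFactor_sum_le x i _ ω
    _ = _ := by
        rw [Finset.mul_sum]
        simp only [Finset.mul_sum (Finset.range (N + 1))]
        rw [integral_finsetSum _ fun i _ => (hs.mul (hone i)).integrable (h.le 0)]
        refine Finset.sum_congr rfl fun i _ => ?_
        rw [← integral_const_mul]
        congr 1; ext ω; ring

/-- Mean of the estimated loss at a fixed point `x`: up to the geometric remainder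
`(I - S / 2)^(M + 1)`, the estimate is unbiased. -/
theorem integral_estimate_eq (h : Draws P D 𝓖 X a q) (x : Fin d → ℝ) {g ε : Ω → ℝ}
    {θ : Ω → Fin d → ℝ} (hg : BddMeas P (𝓖 0) g) (hθ : ∀ i, BddMeas P (𝓖 0) (fun ω => θ ω i))
    (hε : BddMeas P (𝓖 1) ε) (h0H : 𝓖 0 ≤ 𝓗) (hH1 : 𝓗 ≤ 𝓖 1)
    (hXH : Measurable[𝓗] (X 0)) (haH : Measurable[𝓗] (a 0))
    (hnoise : ∀ Z, BddMeas P 𝓗 Z → ∫ ω, Z ω * ε ω ∂P = 0)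
    {M : Ω → ℕ} (hM : Measurable[𝓖 0] M) {N : ℕ} (hMN : ∀ ω, M ω ≤ N) :
    ∫ ω, g ω * (((X 0 ω).ofLp ⬝ᵥ θ ω + ε ω) * a 0 ω * (1 / 2 * ∑ n ∈ Finset.range (M ω + 1),
        walk X a x n ω ⬝ᵥ (X 0 ω).ofLp)) ∂P =
      ∫ ω, g ω * (x ⬝ᵥ (1 - meanFactor D (q ω) ^ (M ω + 1)) *ᵥ θ ω) ∂P := by
  have h0 : ∀ n, 𝓖 0 ≤ 𝓖 n := fun n => h.mono (Nat.zero_le n)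
  have h01 := h0 1
  set I : ℕ → Ω → ℝ := fun n ω => if n ≤ M ω then (1 : ℝ) else 0 with hI
  have hIb : ∀ n, BddMeas P (𝓖 0) (I n) := fun n => BddMeas.indicator_le hM n
  have hl : BddMeas P (𝓖 1) (fun ω => (X 0 ω).ofLp ⬝ᵥ θ ω + ε ω) :=
    (BddMeas.dot (h.X_bdd 0) fun i => (hθ i).mono h01).add hε
  have hBb : ∀ n j k, BddMeas P (𝓖 0) (fun ω => (meanFactor D (q ω) ^ n) j k) :=
    fun n j k => BddMeas.matPow h.meanFactor_bdd n j k
  set c : ℕ → Ω → Fin d → ℝ := fun n ω =>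
    (g ω * I n ω * (((X 0 ω).ofLp ⬝ᵥ θ ω + ε ω) * a 0 ω)) • (X 0 ω).ofLp with hc
  have hcb : ∀ n i, BddMeas P (𝓖 1) (fun ω => c n ω i) := fun n i =>
    ((((hg.mul (hIb n)).mono h01).mul (hl.mul (h.a_bdd 0))).mul (h.X_bdd 0 i))
  have hXHb : ∀ i, BddMeas P 𝓗 (fun ω => (X 0 ω).ofLp i) := fun i =>
    ⟨(by fun_prop : Measurable fun y : Ctx d => y.ofLp i).comp hXH, (h.X_bdd 0 i).bdd⟩
  have haHb : BddMeas P 𝓗 (a 0) := ⟨haH, (h.a_bdd 0).bdd⟩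
  have hterm : ∀ n, ∫ ω, walk X a x n ω ⬝ᵥ c n ω ∂P =
      ∫ ω, g ω * I n ω * (x ⬝ᵥ (wMoment D (q ω) * meanFactor D (q ω) ^ n) *ᵥ θ ω) ∂P := fun n => by
    have e1 := h.integral_walk_dot x 0 n (c := c n) (hcb n)
    simp only [zero_add, walk_zero] at e1
    rw [e1]
    have hZ : BddMeas P 𝓗 (fun ω => g ω * I n ω * a 0 ω *
        (x ⬝ᵥ meanFactor D (q ω) ^ n *ᵥ (X 0 ω).ofLp)) :=
      (((hg.mul (hIb n)).mono h0H).mul haHb).mul (BddMeas.dot (fun _ => BddMeas.const _)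
        (BddMeas.mulVec (fun j k => (hBb n j k).mono h0H) hXHb))
    have hJ : JointBdd P (𝓖 0) (fun ω y => g ω * I n ω *
        (((x ᵥ* meanFactor D (q ω) ^ n) ⬝ᵥ y.ofLp) * (y.ofLp ⬝ᵥ θ ω))) := by
      refine (JointBdd.of_fst (hg.mul (hIb n))).mul (JointBdd.mul ?_ (JointBdd.dot JointBdd.coord
        fun i => JointBdd.of_fst (hθ i)))
      simp only [← Matrix.dotProduct_mulVec]
      exact JointBdd.dot (fun i => JointBdd.of_fst (BddMeas.const _))
        (JointBdd.mulVec (hBb n) JointBdd.coord)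
    have hs := h.step 0 _ hJ
    have i1 := ((h.a_bdd 0).mul (hJ.eval h01 (h.X_meas 0) (h.X_norm 0))).integrable (h.le 1)
    have i2 := ((hZ.mono hH1).mul hε).integrable (h.le 1)
    calc _ = ∫ ω, a 0 ω * (g ω * I n ω * (((x ᵥ* meanFactor D (q ω) ^ n) ⬝ᵥ (X 0 ω).ofLp) *
          ((X 0 ω).ofLp ⬝ᵥ θ ω))) + g ω * I n ω * a 0 ω *
        (x ⬝ᵥ meanFactor D (q ω) ^ n *ᵥ (X 0 ω).ofLp) * ε ω ∂P := by
          congr 1; ext ω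
          rw [hc, Matrix.mulVec_smul, dotProduct_smul, smul_eq_mul, ← Matrix.dotProduct_mulVec]
          ring
      _ = _ := by
          rw [integral_add i1 i2, hnoise _ hZ, add_zero, hs]
          congr 1; ext ω
          rw [← meanFactor_commute, ← Matrix.mulVec_mulVec, Matrix.dotProduct_mulVec x,
            dot_wMoment h.context_norm (h.q_ball ω), ← integral_const_mul]
          congr 1; ext y; ring
  calc _ = ∫ ω, 1 / 2 * ∑ n ∈ Finset.range (N + 1), walk X a x n ω ⬝ᵥ c n ω ∂P := by
        congr 1; ext ω
        rw [sum_range_succ_eq_sum_ite (fun n => walk X a x n ω ⬝ᵥ (X 0 ω).ofLp) (hMN ω)]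
        simp only [Finset.mul_sum, hc, dotProduct_smul, smul_eq_mul]
        exact Finset.sum_congr rfl fun n _ => by ring
    _ = 1 / 2 * ∑ n ∈ Finset.range (N + 1),
        ∫ ω, g ω * I n ω * (x ⬝ᵥ (wMoment D (q ω) * meanFactor D (q ω) ^ n) *ᵥ θ ω) ∂P := by
        rw [integral_const_mul, integral_finsetSum _ fun n _ => (BddMeas.dot
          (fun i => (h.walk_bdd x n i)) fun i => (hcb n i).mono (h.mono (by omega))).integrable
          (h.le (n + 1))]
        simp only [hterm]
    _ = ∫ ω, 1 / 2 * ∑ n ∈ Finset.range (N + 1),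
          g ω * I n ω * (x ⬝ᵥ (wMoment D (q ω) * meanFactor D (q ω) ^ n) *ᵥ θ ω) ∂P := by
        have hint : ∀ n, BddMeas P (𝓖 0) (fun ω => g ω * I n ω *
            (x ⬝ᵥ (wMoment D (q ω) * meanFactor D (q ω) ^ n) *ᵥ θ ω)) := fun n =>
          (hg.mul (hIb n)).mul (BddMeas.dot (fun _ => BddMeas.const _)
            (BddMeas.mulVec (BddMeas.matMul h.wMoment_bdd (hBb n)) hθ))
        rw [integral_const_mul, integral_finsetSum _ fun n _ => (hint n).integrable (h.le 0)]
    _ = _ := by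
        congr 1; ext ω
        have h2 := sum_mul_pow_one_sub_half (wMoment D (q ω)) (M ω + 1)
        have h3 := sum_range_succ_eq_sum_ite
          (fun n => x ⬝ᵥ (wMoment D (q ω) * meanFactor D (q ω) ^ n) *ᵥ θ ω) (hMN ω)
        have h4 : ∑ n ∈ Finset.range (M ω + 1), x ⬝ᵥ (wMoment D (q ω) * meanFactor D (q ω) ^ n) *ᵥ θ ω
            = x ⬝ᵥ ((2 : ℝ) • (1 - meanFactor D (q ω) ^ (M ω + 1))) *ᵥ θ ω := by
          rw [← dotProduct_sum, ← Matrix.sum_mulVec]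
          simp only [meanFactor]
          rw [h2]
        rw [Matrix.smul_mulVec, dotProduct_smul, smul_eq_mul] at h4
        simp only [mul_assoc (g ω)]
        rw [← Finset.mul_sum, ← h3, h4]
        ring

end Draws

/-! ### The information structure of a run -/

/-- A conditional expectation may be used against any bounded measurable weight. -/
lemma integral_mul_eq_of_condExp {Ω : Type*} {𝓗 : MeasurableSpace Ω} [mΩ : MeasurableSpace Ω]
    {P : Measure Ω} [IsProbabilityMeasure P] (h𝓗 : 𝓗 ≤ mΩ) {f g Z : Ω → ℝ} (hf : Integrable f P)
    (hfg : P[f | 𝓗] =ᵐ[P] g) (hZ : BddMeas P 𝓗 Z) : ∫ ω, Z ω * f ω ∂P = ∫ ω, Z ω * g ω ∂P := by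
  obtain ⟨C, hC⟩ := hZ.bdd
  have hZf : Integrable (fun ω => Z ω * f ω) P :=
    hf.bdd_mul (hZ.meas.mono h𝓗 le_rfl).aestronglyMeasurable hC
  have h1 := condExp_mul_of_stronglyMeasurable_left (μ := P) (m := 𝓗)
    (hZ.meas.stronglyMeasurable) hZf hf
  calc ∫ ω, Z ω * f ω ∂P = ∫ ω, (P[Z * f | 𝓗]) ω ∂P := (integral_condExp h𝓗).symm
    _ = ∫ ω, Z ω * g ω ∂P := by
      refine integral_congr_ae ?_
      filter_upwards [h1, hfg] with ω e1 e2
      rw [e1, Pi.mul_apply, e2]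

lemma inner_eq_dotProduct {d : ℕ} (x y : Ctx d) : inner ℝ x y = x.ofLp ⬝ᵥ y.ofLp := by
  rw [EuclideanSpace.inner_eq_star_dotProduct, star_trivial, dotProduct_comm]

namespace Play

variable {K m d : ℕ} {Ω : Type*} (G : Play K m d Ω)

lemma past_mono (T : ℕ) {s t : ℕ} (hst : s ≤ t) : G.past T s ≤ G.past T t := by
  refine sup_le_sup le_rfl (iSup₂_le fun r hr => ?_)
  exact le_iSup₂_of_le r ⟨hr.1, lt_of_lt_of_le hr.2 hst⟩ le_rfl

lemma drawInfo_le_past (T : ℕ) {s t : ℕ} (hs : s ∈ Set.Ico 1 t) (n : ℕ) :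
    G.drawInfo s n ≤ G.past T t :=
  le_trans (le_trans (le_iSup (fun n => G.drawInfo s n) n) le_sup_left)
    (le_trans (le_iSup₂ (f := fun s (_ : s ∈ Set.Ico 1 t) => (⨆ n, G.drawInfo s n) ⊔ G.noiseInfo s)
      s hs) le_sup_right)

lemma measurable_θ_past (T t : ℕ) {s : ℕ} (hs : s ∈ Set.Icc 1 T) (k : Fin K) :
    Measurable[G.past T t] (G.θ s k) := by
  rw [measurable_iff_comap_le]
  refine le_trans (le_trans ?_ (le_iSup₂ (f := fun s (_ : s ∈ Set.Icc 1 T) =>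
    ⨆ k, MeasurableSpace.comap (G.θ s k) inferInstance) s hs)) le_sup_left
  exact le_iSup (fun k => MeasurableSpace.comap (G.θ s k) inferInstance) k

lemma past_le_beforeDraw (T t n : ℕ) : G.past T t ≤ G.beforeDraw T t n :=
  le_trans le_sup_left le_sup_left

lemma beforeDraw_zero (T t : ℕ) : G.beforeDraw T t 0 = G.past T t := by
  simp [beforeDraw]

lemma beforeDraw_mono (T t : ℕ) : Monotone (G.beforeDraw T t) := by
  intro n n' h
  refine sup_le_sup (sup_le_sup le_rfl ?_) ?_
  · exact iSup₂_le fun j hj => le_iSup₂_of_le j (lt_of_lt_of_le hj h) le_rfl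
  · exact iSup_le fun h1 => le_iSup_of_le (h1.trans h) le_rfl

lemma drawInfo_le_beforeDraw (T t : ℕ) {j n : ℕ} (h : j < n) :
    G.drawInfo t j ≤ G.beforeDraw T t n :=
  le_trans (le_trans (le_iSup₂ (f := fun j (_ : j ∈ Set.Iio n) => G.drawInfo t j) j h)
    le_sup_right) le_sup_left

lemma noiseInfo_le_beforeDraw (T t : ℕ) {n : ℕ} (h : 1 ≤ n) :
    G.noiseInfo t ≤ G.beforeDraw T t n :=
  le_trans (le_iSup (fun _ : 1 ≤ n => G.noiseInfo t) h) le_sup_right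

lemma measurable_X_drawInfo (t n : ℕ) : Measurable[G.drawInfo t n] (G.X t n) := by
  rw [measurable_iff_comap_le]; exact le_sup_left

lemma measurable_A_drawInfo (t n : ℕ) : Measurable[G.drawInfo t n] (G.A t n) := by
  rw [measurable_iff_comap_le]; exact le_sup_right

lemma measurable_ε_noiseInfo (t : ℕ) (k : Fin K) : Measurable[G.noiseInfo t] (G.ε t k) := by
  rw [measurable_iff_comap_le]
  exact le_iSup (fun k => MeasurableSpace.comap (G.ε t k) inferInstance) k

lemma measurable_vec (k : Fin K) : Measurable (fun a : Action K m => a.vec k) := fun _ _ => trivial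

/-- The probability `E[(A_t)_k | X_t = x]` that arm `k` is played at the context `x`. -/
def armProb (T : ℕ) (lam : ℝ) (t : ℕ) (k : Fin K) (ω : Ω) (x : Ctx d) : ℝ :=
  (1 - G.gamma T lam t ω) * G.meanAction t ω x k + G.gamma T lam t ω / K

lemma sum_policy_vec (hm : 1 ≤ m) (T : ℕ) (lam : ℝ) (t : ℕ) (k : Fin K) (ω : Ω) (x : Ctx d) :
    ∑ a, G.policy T lam t ω x a * a.vec k = G.armProb T lam t k ω x := by
  classical
  simp only [policy, armProb, meanAction, add_mul, Finset.sum_add_distrib, Finset.mul_sum]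
  congr 1
  · exact Finset.sum_congr rfl fun a _ => by ring
  · have h : ∀ a : Action K m, G.gamma T lam t ω * (if a ∈ explorationSet K m then 1 else 0) /
        (explorationSet K m).card * a.vec k =
        G.gamma T lam t ω / K * (if a ∈ explorationSet K m then a.vec k else 0) := fun a => by
      rw [card_explorationSet hm]; split_ifs <;> ring
    simp only [h]
    rw [← Finset.mul_sum, ← Finset.sum_filter, Finset.filter_mem_eq_inter, Finset.univ_inter,
      sum_explorationSet_vec hm, mul_one]

section Run

variable {G} {T : ℕ}

lemma c₁_nonneg (K m d T : ℕ) (lam : ℝ) : 0 ≤ c₁ K m d T lam := Real.sqrt_nonneg _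

lemma two_le_beta (lam : ℝ) (t : ℕ) (ω : Ω) : 2 ≤ G.beta T lam t ω := le_max_left _ _

lemma eta_pos (lam : ℝ) (t : ℕ) (ω : Ω) : 0 < G.eta T lam t ω := by
  have := two_le_beta (G := G) (T := T) lam t ω
  unfold eta; positivity

lemma log_ratio_nonneg (hm : 1 ≤ m) (hmK : m ≤ K) : 0 ≤ Real.log ((K : ℝ) / m) := by
  have h1 : (0 : ℝ) < m := by exact_mod_cast hm
  have h2 : (m : ℝ) ≤ K := by exact_mod_cast hmK
  exact Real.log_nonneg (by rwa [one_le_div h1])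

lemma eta_le_half (lam : ℝ) (t : ℕ) (ω : Ω) : G.eta T lam t ω ≤ 1 / 2 :=
  one_div_le_one_div_of_le two_pos (two_le_beta lam t ω)

lemma one_div_eta (lam : ℝ) (t : ℕ) (ω : Ω) : 1 / G.eta T lam t ω = G.beta T lam t ω := by
  simp [eta]

lemma gamma_nonneg {lam : ℝ} (hlam : 0 < lam) (t : ℕ) (ω : Ω) : 0 ≤ G.gamma T lam t ω := by
  have h1 := (eta_pos (G := G) (T := T) lam t ω).le
  have h2 : 0 ≤ Real.log t := Real.log_natCast_nonneg t
  unfold gamma alpha; positivity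

/-- The maximum with `c₂ ln T` in `β_t` keeps the exploration rate below one half. -/
lemma gamma_le_half {lam : ℝ} (hlam : 0 < lam) {t : ℕ} (ht : t ∈ Set.Icc 1 T) (ω : Ω) :
    G.gamma T lam t ω ≤ 1 / 2 := by
  have hβ := two_le_beta (G := G) (T := T) lam t ω
  have h1 : c₂ K lam * Real.log T ≤ G.beta T lam t ω :=
    le_trans (le_max_left _ _) (le_max_right _ _)
  have h2 : Real.log t ≤ Real.log T :=
    Real.log_le_log (by exact_mod_cast ht.1) (by exact_mod_cast ht.2)
  have h3 : alpha K lam t ≤ 1 / 2 * (c₂ K lam * Real.log T) := by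
    unfold alpha c₂
    have e : 1 / 2 * (8 * K / lam * Real.log T) = 4 * K * Real.log T / lam := by ring
    rw [e]
    gcongr
  unfold gamma eta
  rw [mul_one_div, div_le_iff₀ (by linarith)]
  linarith

variable [mΩ : MeasurableSpace Ω] {P : Measure Ω} {𝒳 : Set (Ctx d)} {D : Measure (Ctx d)}

lemma IsRun.past_le (h : G.IsRun P 𝒳 D T) {t : ℕ} (ht : t ≤ T + 1) : G.past T t ≤ mΩ := by
  refine sup_le (iSup₂_le fun s hs => iSup_le fun k => (h.measurable_θ s hs k).comap_le)
    (iSup₂_le fun s hs => ?_)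
  have hs' : s ∈ Set.Icc 1 T := ⟨hs.1, by have := hs.2; omega⟩
  exact sup_le (iSup_le fun n => sup_le (h.measurable_X s hs' n).comap_le
    (h.measurable_A s hs' n).comap_le) (iSup_le fun k => (h.measurable_ε s hs' k).comap_le)

lemma IsRun.drawInfo_le (h : G.IsRun P 𝒳 D T) {t : ℕ} (ht : t ∈ Set.Icc 1 T) (n : ℕ) :
    G.drawInfo t n ≤ mΩ :=
  sup_le (h.measurable_X t ht n).comap_le (h.measurable_A t ht n).comap_le

lemma IsRun.beforeDraw_le (h : G.IsRun P 𝒳 D T) {t : ℕ} (ht : t ∈ Set.Icc 1 T) (n : ℕ) :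
    G.beforeDraw T t n ≤ mΩ := by
  refine sup_le (sup_le (h.past_le (by have := ht.2; omega)) (iSup₂_le fun j _ =>
    h.drawInfo_le ht j)) ?_
  exact iSup_le fun _ => iSup_le fun k => (h.measurable_ε t ht k).comap_le

lemma IsRun.X_norm (h : G.IsRun P 𝒳 D T) {t : ℕ} (ht : t ∈ Set.Icc 1 T) (n : ℕ) :
    ∀ᵐ ω ∂P, ‖G.X t n ω‖ ≤ 1 := by
  have := h.context_norm
  rw [← h.context_law t ht n] at this
  exact ae_of_ae_map (h.measurable_X t ht n).aemeasurable this

lemma IsRun.X_mem (h : G.IsRun P 𝒳 D T) {t : ℕ} (ht : t ∈ Set.Icc 1 T) (n : ℕ) :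
    ∀ᵐ ω ∂P, G.X t n ω ∈ 𝒳 := by
  have := h.context_mem
  rw [← h.context_law t ht n] at this
  exact ae_of_ae_map (h.measurable_X t ht n).aemeasurable this

lemma IsRun.meanAction_mem (h : G.IsRun P 𝒳 D T) {t : ℕ} (ht : t ∈ Set.Icc 1 T) (ω : Ω)
    (x : Ctx d) : G.meanAction t ω x ∈ actionHull K m := by
  have h1 := (convex_convexHull ℝ (Set.range (Action.vec : Action K m → Fin K → ℝ))).sum_mem
    (t := Finset.univ) (w := fun a => G.p t ω x a) (z := fun a : Action K m => a.vec)
    (fun a _ => h.p_nonneg t ht ω x a) (h.p_sum t ht ω x) (fun a _ => vec_mem_actionHull a)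
  have e : G.meanAction t ω x = ∑ a : Action K m, G.p t ω x a • a.vec := by
    ext k
    simp only [Play.meanAction, Finset.sum_apply, Pi.smul_apply, smul_eq_mul]
  rwa [e]

lemma IsRun.entropy_nonneg (h : G.IsRun P 𝒳 D T) {t : ℕ} (ht : t ∈ Set.Icc 1 T) (ω : Ω)
    (x : Ctx d) : 0 ≤ entropy (G.meanAction t ω x) :=
  CombBandit.entropy_nonneg (actionHull_bounds (h.meanAction_mem ht ω x)).1
    (actionHull_bounds (h.meanAction_mem ht ω x)).2.1

lemma IsRun.meanAction_joint (h : G.IsRun P 𝒳 D T) {t : ℕ} (ht : t ∈ Set.Icc 1 T) (k : Fin K) :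
    JointBdd P (G.past T t) (fun ω x => G.meanAction t ω x k) := by
  refine JointBdd.sum _ fun a _ => JointBdd.mul ⟨h.p_measurable t ht a, 1, ?_⟩
    (JointBdd.of_snd (BallBdd.const _))
  refine Filter.Eventually.of_forall fun ω x _ => ?_
  rw [abs_of_nonneg (h.p_nonneg t ht ω x a), ← h.p_sum t ht ω x]
  exact Finset.single_le_sum (fun b _ => h.p_nonneg t ht ω x b) (Finset.mem_univ a)

lemma IsRun.entropy_joint (h : G.IsRun P 𝒳 D T) (hm : 1 ≤ m) (hmK : m ≤ K) {t : ℕ}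
    (ht : t ∈ Set.Icc 1 T) :
    JointBdd P (G.past T t) (fun ω x => entropy (G.meanAction t ω x)) := by
  refine ⟨?_, m * Real.log (K / m) + m, Filter.Eventually.of_forall fun ω x _ => ?_⟩
  · unfold entropy
    refine Measurable.neg (Finset.measurable_sum _ fun k _ => ?_)
    have h1 := (h.meanAction_joint ht k).meas
    exact h1.mul (Real.measurable_log.comp h1)
  · rw [abs_of_nonneg (h.entropy_nonneg ht ω x)]
    exact entropy_le hm hmK (h.meanAction_mem ht ω x)

lemma IsRun.playedEntropy_meas (h : G.IsRun P 𝒳 D T) (hm : 1 ≤ m) (hmK : m ≤ K) {s t : ℕ}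
    (hs : s ∈ Set.Ico 1 t) (hsT : s ≤ T) :
    Measurable[G.past T t] (fun ω => entropy (G.meanAction s ω (G.X s 0 ω))) :=
  ((h.entropy_joint hm hmK ⟨hs.1, hsT⟩).eval (G.past_mono T hs.2.le)
    ((G.measurable_X_drawInfo s 0).mono (G.drawInfo_le_past T hs 0) le_rfl)
    (h.X_norm ⟨hs.1, hsT⟩ 0)).meas

lemma IsRun.betaPrime_meas (h : G.IsRun P 𝒳 D T) (hm : 1 ≤ m) (hmK : m ≤ K) (lam : ℝ) {t : ℕ}
    (ht : t ≤ T + 1) : Measurable[G.past T t] (G.betaPrime T lam t) := by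
  unfold betaPrime
  refine Measurable.add measurable_const (Finset.measurable_sum _ fun s hs => ?_)
  rw [Finset.mem_Ico] at hs
  refine Measurable.div measurable_const (Measurable.sqrt (Measurable.add measurable_const
    (Measurable.mul measurable_const (Finset.measurable_sum _ fun r hr => ?_))))
  rw [Finset.mem_Icc] at hr
  exact h.playedEntropy_meas hm hmK ⟨hr.1, by omega⟩ (by omega)

lemma IsRun.beta_meas (h : G.IsRun P 𝒳 D T) (hm : 1 ≤ m) (hmK : m ≤ K) (lam : ℝ) {t : ℕ}
    (ht : t ≤ T + 1) : Measurable[G.past T t] (G.beta T lam t) :=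
  Measurable.max measurable_const (Measurable.max measurable_const (h.betaPrime_meas hm hmK lam ht))

/-- A deterministic bound on all `β_t`, `t ≤ T`. -/
def betaMax (K m d T : ℕ) (lam : ℝ) : ℝ :=
  max 2 (max (c₂ K lam * Real.log T) (c₁ K m d T lam * (T + 1)))

lemma IsRun.beta_le (h : G.IsRun P 𝒳 D T) (hm : 1 ≤ m) (hmK : m ≤ K) (lam : ℝ) {t : ℕ}
    (ht : t ≤ T) (ω : Ω) : G.beta T lam t ω ≤ betaMax K m d T lam := by
  refine max_le_max le_rfl (max_le_max le_rfl ?_)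
  have hc := c₁_nonneg K m d T lam
  have h1 : ∀ s ∈ Finset.Ico 1 t, c₁ K m d T lam /
      Real.sqrt (1 + (m * Real.log (K / m))⁻¹ *
      ∑ r ∈ Finset.Icc 1 s, entropy (G.meanAction r ω (G.X r 0 ω))) ≤ c₁ K m d T lam := by
    intro s hs
    rw [Finset.mem_Ico] at hs
    refine div_le_self hc ?_
    rw [Real.one_le_sqrt, le_add_iff_nonneg_right]
    have := log_ratio_nonneg hm hmK
    refine mul_nonneg (by positivity) (Finset.sum_nonneg fun r hr => ?_)
    rw [Finset.mem_Icc] at hr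
    exact h.entropy_nonneg ⟨hr.1, by omega⟩ ω _
  unfold betaPrime
  have h2 := Finset.sum_le_card_nsmul _ _ _ h1
  rw [Nat.card_Ico, nsmul_eq_mul] at h2
  have h3 : ((t - 1 : ℕ) : ℝ) ≤ T := by exact_mod_cast (by omega)
  nlinarith [mul_le_mul_of_nonneg_right h3 hc]

lemma IsRun.eta_bdd (h : G.IsRun P 𝒳 D T) (hm : 1 ≤ m) (hmK : m ≤ K) (lam : ℝ) {t : ℕ}
    (ht : t ≤ T + 1) : BddMeas P (G.past T t) (G.eta T lam t) :=
  BddMeas.of_le (Measurable.div measurable_const (h.beta_meas hm hmK lam ht)) (C := 1 / 2) fun ω => by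
    rw [abs_of_pos (eta_pos lam t ω)]; exact eta_le_half lam t ω

lemma IsRun.beta_bdd (h : G.IsRun P 𝒳 D T) (hm : 1 ≤ m) (hmK : m ≤ K) (lam : ℝ) {t : ℕ}
    (ht : t ≤ T) : BddMeas P (G.past T t) (G.beta T lam t) :=
  BddMeas.of_le (h.beta_meas hm hmK lam (by omega)) (C := betaMax K m d T lam) fun ω => by
    rw [abs_of_nonneg (by have := two_le_beta (G := G) (T := T) lam t ω; linarith)]
    exact h.beta_le hm hmK lam ht ω

lemma IsRun.M_meas (h : G.IsRun P 𝒳 D T) (hm : 1 ≤ m) (hmK : m ≤ K) (lam : ℝ) {t : ℕ}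
    (ht : t ≤ T + 1) : Measurable[G.past T t] (G.M T lam t) := by
  unfold M
  simp only [one_div_eta]
  exact Nat.measurable_ceil.comp (h.beta_meas hm hmK lam ht)

lemma IsRun.M_le (h : G.IsRun P 𝒳 D T) (hm : 1 ≤ m) (hmK : m ≤ K) (lam : ℝ) {t : ℕ}
    (ht : t ≤ T) (ω : Ω) : G.M T lam t ω ≤ ⌈betaMax K m d T lam⌉₊ := by
  unfold M
  rw [one_div_eta]
  exact Nat.ceil_le_ceil (h.beta_le hm hmK lam ht ω)

lemma IsRun.gamma_bdd (h : G.IsRun P 𝒳 D T) (hm : 1 ≤ m) (hmK : m ≤ K) (lam : ℝ) {t : ℕ}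
    (ht : t ≤ T + 1) : BddMeas P (G.past T t) (G.gamma T lam t) :=
  (BddMeas.const _).mul (h.eta_bdd hm hmK lam ht)

end Run

end Play

/-! ### The smallest eigenvalue -/

lemma dot_self_eq_norm_sq {d : ℕ} (x : Ctx d) : x.ofLp ⬝ᵥ x.ofLp = ‖x‖ ^ 2 := by
  rw [EuclideanSpace.real_norm_sq_eq]; simp [dotProduct, sq]

/-- The smallest eigenvalue of a positive definite matrix is positive and bounds the quadratic form
from below: the minimum of the Rayleigh quotient is an eigenvalue. -/
lemma lambdaMin_spec {d : ℕ} (hd : 1 ≤ d) {S : Matrix (Fin d) (Fin d) ℝ} (hS : S.PosDef) :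
    0 < lambdaMin S ∧ ∀ v : Fin d → ℝ, lambdaMin S * (v ⬝ᵥ v) ≤ v ⬝ᵥ S *ᵥ v := by
  have : Nonempty (Fin d) := ⟨⟨0, hd⟩⟩
  have hsym : (Matrix.toEuclideanLin S).IsSymmetric :=
    Matrix.isSymmetric_toEuclideanLin_iff.2 hS.isHermitian
  have hray := hsym.hasEigenvalue_iInf_of_finiteDimensional
  set e : ℝ := ⨅ x : { x : Ctx d // x ≠ 0 },
    RCLike.re (inner ℝ (Matrix.toEuclideanLin S (x : Ctx d)) (x : Ctx d)) / ‖(x : Ctx d)‖ ^ 2 with he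
  have hq : ∀ x : Ctx d, (RCLike.re (inner ℝ (Matrix.toEuclideanLin S x) x) : ℝ) =
      x.ofLp ⬝ᵥ S *ᵥ x.ofLp := fun x => by
    rw [inner_eq_dotProduct, dotProduct_comm]; rfl
  have hle : ∀ x : Ctx d, e * ‖x‖ ^ 2 ≤ x.ofLp ⬝ᵥ S *ᵥ x.ofLp := by
    intro x
    by_cases hx : x = 0
    · simp [hx]
    have hb : BddBelow (Set.range fun x : { x : Ctx d // x ≠ 0 } =>
      (RCLike.re (inner ℝ (Matrix.toEuclideanLin S (x : Ctx d)) (x : Ctx d)) : ℝ) /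
        ‖(x : Ctx d)‖ ^ 2) := by
      refine ⟨0, ?_⟩
      rintro _ ⟨y, rfl⟩
      have := hS.posSemidef.dotProduct_mulVec_nonneg y.1.ofLp
      rw [star_trivial] at this
      simp only [hq]
      positivity
    have h1 := ciInf_le hb ⟨x, hx⟩
    simp only [hq] at h1 he
    rw [← he, le_div_iff₀ (by positivity)] at h1
    exact h1
  have hev : ∀ μ : ℝ, Module.End.HasEigenvalue (Matrix.toLin' S) μ →
      ∃ v : Fin d → ℝ, v ≠ 0 ∧ S *ᵥ v = μ • v := by
    intro μ hμ
    obtain ⟨v, hv⟩ := hμ.exists_hasEigenvector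
    exact ⟨v, hv.2, by simpa using hv.apply_eq_smul⟩
  have hpos : ∀ v : Fin d → ℝ, v ≠ 0 → 0 < v ⬝ᵥ v := fun v hv => by
    have h0 : 0 ≤ v ⬝ᵥ v := Finset.sum_nonneg fun i _ => mul_self_nonneg _
    exact lt_of_le_of_ne h0 fun h => hv (dotProduct_self_eq_zero.1 h.symm)
  have hmem : e ∈ {μ : ℝ | Module.End.HasEigenvalue (Matrix.toLin' S) μ} := by
    obtain ⟨v, hv⟩ := hray.exists_hasEigenvector
    have h1 := hv.apply_eq_smul
    refine Module.End.hasEigenvalue_of_hasEigenvector (x := v.ofLp)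
      (Module.End.hasEigenvector_iff.2 ⟨Module.End.mem_eigenspace_iff.2 ?_, fun h => hv.2 ?_⟩)
    · have := congrArg WithLp.ofLp h1
      simpa using this
    · ext i; simp [h]
  have hlow : ∀ μ ∈ {μ : ℝ | Module.End.HasEigenvalue (Matrix.toLin' S) μ}, e ≤ μ := by
    intro μ hμ
    obtain ⟨v, hv0, hv⟩ := hev μ hμ
    have h1 := hle (WithLp.toLp 2 v)
    rw [← dot_self_eq_norm_sq] at h1
    simp only [hv, dotProduct_smul, smul_eq_mul] at h1
    exact le_of_mul_le_mul_right h1 (hpos v hv0)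
  have heq : lambdaMin S = e := le_antisymm (csInf_le ⟨e, hlow⟩ hmem) (le_csInf ⟨e, hmem⟩ hlow)
  rw [heq]
  constructor
  · obtain ⟨v, hv0, hv⟩ := hev e hmem
    have h1 := hS.dotProduct_mulVec_pos hv0
    rw [star_trivial, hv, dotProduct_smul, smul_eq_mul] at h1
    exact pos_of_mul_pos_left h1 (hpos v hv0).le
  · intro v
    have := hle (WithLp.toLp 2 v)
    rwa [← dot_self_eq_norm_sq] at this

lemma secondMoment_eq_wMoment {d : ℕ} (D : Measure (Ctx d)) :
    secondMoment D = wMoment D (fun _ => 1) := by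
  ext i j; simp [secondMoment, wMoment]

/-! ### The draws of a round -/

namespace Play

variable {K m d : ℕ} {Ω : Type*} {G : Play K m d Ω} [mΩ : MeasurableSpace Ω]
  {P : Measure Ω} {𝒳 : Set (Ctx d)} {D : Measure (Ctx d)} {T : ℕ}

lemma IsRun.armProb_joint (h : G.IsRun P 𝒳 D T) (hm : 1 ≤ m) (hmK : m ≤ K) (lam : ℝ) {t : ℕ}
    (ht : t ∈ Set.Icc 1 T) (k : Fin K) :
    JointBdd P (G.past T t) (fun ω x => G.armProb T lam t k ω x) := by
  have hg := h.gamma_bdd hm hmK lam (t := t) (by have := ht.2; omega)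
  have h1 := (JointBdd.of_fst (d := d) ((BddMeas.const 1).sub hg)).mul (h.meanAction_joint ht k)
  have h2 := h1.add (JointBdd.of_fst (hg.mul (BddMeas.const ((K : ℝ)⁻¹))))
  simpa only [armProb, div_eq_mul_inv] using h2

lemma IsRun.policy_joint (h : G.IsRun P 𝒳 D T) (hm : 1 ≤ m) (hmK : m ≤ K) (lam : ℝ) {t : ℕ}
    (ht : t ∈ Set.Icc 1 T) (a : Action K m) :
    JointBdd P (G.past T t) (fun ω x => G.policy T lam t ω x a) := by
  classical
  have hg := h.gamma_bdd hm hmK lam (t := t) (by have := ht.2; omega)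
  have hp : JointBdd P (G.past T t) (fun ω x => G.p t ω x a) := by
    refine ⟨h.p_measurable t ht a, 1, Filter.Eventually.of_forall fun ω x _ => ?_⟩
    rw [abs_of_nonneg (h.p_nonneg t ht ω x a), ← h.p_sum t ht ω x]
    exact Finset.single_le_sum (fun b _ => h.p_nonneg t ht ω x b) (Finset.mem_univ a)
  have h1 := (JointBdd.of_fst (d := d) ((BddMeas.const 1).sub hg)).mul hp
  have h2 := h1.add (JointBdd.of_fst (hg.mul (BddMeas.const
    ((if a ∈ explorationSet K m then (1 : ℝ) else 0) * ((explorationSet K m).card : ℝ)⁻¹))))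
  unfold policy
  convert h2 using 4
  rw [mul_div_assoc, div_eq_mul_inv]

lemma IsRun.armProb_bounds (h : G.IsRun P 𝒳 D T) (hm : 1 ≤ m) (hmK : m ≤ K) {lam : ℝ}
    (hlam : 0 < lam) {t : ℕ} (ht : t ∈ Set.Icc 1 T) (k : Fin K) (ω : Ω) (x : Ctx d) :
    G.gamma T lam t ω / K ≤ G.armProb T lam t k ω x ∧
    G.meanAction t ω x k ≤ 2 * G.armProb T lam t k ω x ∧ G.armProb T lam t k ω x ≤ 1 := by
  obtain ⟨a0, a1, _⟩ := actionHull_bounds (h.meanAction_mem ht ω x)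
  have g0 := gamma_nonneg (G := G) (T := T) hlam t ω
  have g1 := gamma_le_half (G := G) hlam ht ω
  have hK : (1 : ℝ) ≤ K := by exact_mod_cast hm.trans hmK
  have h2 : G.gamma T lam t ω / K ≤ G.gamma T lam t ω := div_le_self g0 hK
  have h3 : 0 ≤ G.gamma T lam t ω / K := by positivity
  unfold armProb
  refine ⟨?_, ?_, ?_⟩ <;> nlinarith [a0 k, a1 k]

/-- The context-action draws of a round, seen from one arm. -/
lemma IsRun.draws (h : G.IsRun P 𝒳 D T) (hm : 1 ≤ m) (hmK : m ≤ K) (hd : 1 ≤ d) {t : ℕ}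
    (ht : t ∈ Set.Icc 1 T) (k : Fin K) :
    Draws P D (G.beforeDraw T t) (G.X t) (fun n ω => (G.A t n ω).vec k)
      (G.armProb T (lambdaMin (secondMoment D)) t k) := by
  have := h.isProb
  have := h.isProb_context
  set lam := lambdaMin (secondMoment D) with hl
  have hlam : 0 < lam := (lambdaMin_spec hd h.posDef).1
  have hdraw : ∀ n, G.drawInfo t n ≤ G.beforeDraw T t (n + 1) := fun n =>
    G.drawInfo_le_beforeDraw T t (Nat.lt_succ_self n)
  refine ⟨h.beforeDraw_le ht, G.beforeDraw_mono T t, h.context_norm,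
    fun n => (G.measurable_X_drawInfo t n).mono (hdraw n) le_rfl, h.X_norm ht,
    fun n => (measurable_vec k).comp ((G.measurable_A_drawInfo t n).mono (hdraw n) le_rfl),
    fun n ω => ?_, ?_, fun ω x => ?_, fun ω x => (h.armProb_bounds hm hmK hlam ht k ω x).2.2,
    fun n Φ hΦ => ?_⟩
  · unfold Action.vec; split_ifs <;> simp
  · rw [beforeDraw_zero]; exact (h.armProb_joint hm hmK lam ht k).meas
  · have g0 := gamma_nonneg (G := G) (T := T) hlam t ω
    exact le_trans (by positivity) (h.armProb_bounds hm hmK hlam ht k ω x).1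
  · have hle : G.beforeDraw T t n ⊔ MeasurableSpace.comap (G.X t n) inferInstance ≤ mΩ :=
      sup_le (h.beforeDraw_le ht n) (h.measurable_X t ht n).comap_le
    have hXs : Measurable[G.beforeDraw T t n ⊔ MeasurableSpace.comap (G.X t n) inferInstance]
        (G.X t n) := by rw [measurable_iff_comap_le]; exact le_sup_right
    have hΦX : BddMeas P (G.beforeDraw T t n ⊔ MeasurableSpace.comap (G.X t n) inferInstance)
        (fun ω => Φ ω (G.X t n ω)) := hΦ.eval le_sup_left hXs (h.X_norm ht n)
    have hpX : ∀ a, BddMeas P (G.beforeDraw T t n ⊔ MeasurableSpace.comap (G.X t n) inferInstance)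
        (fun ω => G.policy T lam t ω (G.X t n ω) a) := fun a =>
      (h.policy_joint hm hmK lam ht a).eval ((G.past_le_beforeDraw T t n).trans le_sup_left) hXs
        (h.X_norm ht n)
    have hmA : ∀ a, MeasurableSet (G.A t n ⁻¹' {a}) := fun a =>
      h.measurable_A t ht n (by trivial)
    have hind : ∀ a : Action K m, Integrable ((G.A t n ⁻¹' {a}).indicator (fun _ => (1 : ℝ))) P :=
      fun a => (integrable_const 1).indicator (hmA a)
    have hone : ∀ a, ∫ ω, Φ ω (G.X t n ω) * (G.A t n ⁻¹' {a}).indicator (fun _ => (1 : ℝ)) ω ∂P =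
        ∫ ω, Φ ω (G.X t n ω) * G.policy T lam t ω (G.X t n ω) a ∂P := fun a =>
      integral_mul_eq_of_condExp hle (hind a) (h.action_law t ht n a) hΦX
    have hi1 : ∀ a, Integrable (fun ω => Φ ω (G.X t n ω) *
        (G.A t n ⁻¹' {a}).indicator (fun _ => (1 : ℝ)) ω) P := fun a => by
      obtain ⟨C, hC⟩ := hΦX.bdd
      exact (hind a).bdd_mul (hΦX.meas.mono hle le_rfl).aestronglyMeasurable hC
    have hi2 : ∀ a, Integrable (fun ω => Φ ω (G.X t n ω) * G.policy T lam t ω (G.X t n ω) a) P :=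
      fun a => (hΦX.mul (hpX a)).integrable hle
    calc ∫ ω, (G.A t n ω).vec k * Φ ω (G.X t n ω) ∂P
        = ∫ ω, ∑ a : Action K m, a.vec k * (Φ ω (G.X t n ω) *
          (G.A t n ⁻¹' {a}).indicator (fun _ => (1 : ℝ)) ω) ∂P := by
          congr 1; ext ω
          rw [Finset.sum_eq_single (G.A t n ω)]
          · simp
          · intro b _ hb
            rw [Set.indicator_of_notMem (by simpa using fun e => hb e.symm)]
            ring
          · simp
      _ = ∫ ω, ∑ a : Action K m, a.vec k * (Φ ω (G.X t n ω) *
          G.policy T lam t ω (G.X t n ω) a) ∂P := by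
          rw [integral_finsetSum _ fun a _ => (hi1 a).const_mul _,
            integral_finsetSum _ fun a _ => (hi2 a).const_mul _]
          simp only [integral_const_mul, hone]
      _ = ∫ ω, G.armProb T lam t k ω (G.X t n ω) * Φ ω (G.X t n ω) ∂P := by
          congr 1; ext ω
          rw [← G.sum_policy_vec hm, Finset.sum_mul]
          exact Finset.sum_congr rfl fun a _ => by ring
      _ = ∫ ω, ∫ x, G.armProb T lam t k ω x * Φ ω x ∂D ∂P :=
          integral_joint_eq (h.beforeDraw_le ht n) (h.measurable_X t ht n) (h.context_law t ht n)
            h.context_norm (h.context_indep t ht n)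
            (((h.armProb_joint hm hmK lam ht k).mono (G.past_le_beforeDraw T t n)).mul hΦ)

omit mΩ in
lemma C_eq_updateProd (t : ℕ) (k : Fin K) (ω : Ω) (n : ℕ) :
    G.C t k ω n = updateProd (G.X t) (fun n ω => (G.A t n ω).vec k) ω n := by
  induction n with
  | zero => rfl
  | succ n ih => rw [C, updateProd, ih]

omit mΩ in
/-- The estimated loss of arm `k` at the context `x`, in terms of the walks `xᵀ C_n`. -/
lemma inner_thetaTilde (lam : ℝ) (t : ℕ) (k : Fin K) (ω : Ω) (x : Ctx d) :
    inner ℝ x (G.thetaTilde T lam t k ω) = G.loss t k ω * (G.A t 0 ω).vec k *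
      (1 / 2 * ∑ n ∈ Finset.range (G.M T lam t ω + 1),
        walk (G.X t) (fun n ω => (G.A t n ω).vec k) x.ofLp n ω ⬝ᵥ (G.X t 0 ω).ofLp) := by
  rw [thetaTilde, inner_smul_right, inner_eq_dotProduct]
  congr 1
  have e : G.precision T lam t k ω = (1 / 2 : ℝ) • ∑ n ∈ Finset.range (G.M T lam t ω + 1),
      updateProd (G.X t) (fun n ω => (G.A t n ω).vec k) ω n := by
    rw [precision, Finset.sum_range_succ', add_comm]
    simp only [C_eq_updateProd]
    congr 2
    rw [Finset.range_eq_Ico, Finset.sum_Ico_add' _ 0 _ 1]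
    rfl
  rw [e, Matrix.smul_mulVec, dotProduct_smul, smul_eq_mul, Matrix.sum_mulVec, dotProduct_sum]
  simp only [walk, Matrix.dotProduct_mulVec]

end Play

namespace Play

/-! ### Moments of the loss estimates -/

variable {K m d : ℕ} {Ω : Type*} {G : Play K m d Ω} [mΩ : MeasurableSpace Ω]
  {P : Measure Ω} {𝒳 : Set (Ctx d)} {D : Measure (Ctx d)} {T : ℕ}

lemma IsRun.θ_bdd (h : G.IsRun P 𝒳 D T) {t : ℕ} (ht : t ∈ Set.Icc 1 T) (s : ℕ) (k : Fin K)
    (i : Fin d) : BddMeas P (G.past T s) (fun ω => (G.θ t k ω).ofLp i) := by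
  refine ⟨(by fun_prop : Measurable fun y : Ctx d => y.ofLp i).comp
    (G.measurable_θ_past T s ht k), 1, ?_⟩
  filter_upwards [h.θ_norm t ht k] with ω hω
  exact (PiLp.norm_apply_le (G.θ t k ω) i).trans hω

lemma IsRun.inner_le (h : G.IsRun P 𝒳 D T) {t : ℕ} (ht : t ∈ Set.Icc 1 T) (k : Fin K) :
    ∀ᵐ ω ∂P, ∀ x : Ctx d, ‖x‖ ≤ 1 → |inner ℝ x (G.θ t k ω)| ≤ 1 := by
  filter_upwards [h.θ_norm t ht k] with ω hω x hx
  calc _ ≤ ‖x‖ * ‖G.θ t k ω‖ := abs_real_inner_le_norm _ _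
    _ ≤ 1 * 1 := by gcongr
    _ = 1 := one_mul 1

lemma IsRun.ε_bdd (h : G.IsRun P 𝒳 D T) {t : ℕ} (ht : t ∈ Set.Icc 1 T) (k : Fin K) :
    BddMeas P (G.beforeDraw T t 1) (G.ε t k) := by
  refine ⟨(G.measurable_ε_noiseInfo t k).mono (G.noiseInfo_le_beforeDraw T t le_rfl) le_rfl, 2, ?_⟩
  filter_upwards [h.inner_le ht k, h.X_norm ht 0, h.loss_bound t ht k] with ω h1 h2 h3
  have h4 := h1 _ h2
  unfold loss at h3
  rw [abs_le] at *
  constructor <;> linarith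

lemma IsRun.integral_mul_noise (h : G.IsRun P 𝒳 D T) {t : ℕ} (ht : t ∈ Set.Icc 1 T) (k : Fin K)
    {Z : Ω → ℝ} (hZ : BddMeas P (G.past T t ⊔ G.drawInfo t 0) Z) : ∫ ω, Z ω * G.ε t k ω ∂P = 0 := by
  have := h.isProb
  rw [integral_mul_eq_of_condExp (sup_le (h.past_le (by have := ht.2; omega)) (h.drawInfo_le ht 0))
    ((h.ε_bdd ht k).integrable (h.beforeDraw_le ht 1)) (h.noise t ht k) hZ]
  simp

/-- The estimate is unbiased up to a geometric remainder. -/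
lemma IsRun.integral_thetaTilde (h : G.IsRun P 𝒳 D T) (hm : 1 ≤ m) (hmK : m ≤ K) (hd : 1 ≤ d) {t : ℕ}
    (ht : t ∈ Set.Icc 1 T) (k : Fin K) (x : Ctx d) {g : Ω → ℝ} (hg : BddMeas P (G.past T t) g) :
    ∫ ω, g ω * inner ℝ x (G.thetaTilde T (lambdaMin (secondMoment D)) t k ω) ∂P =
      ∫ ω, g ω * (x.ofLp ⬝ᵥ
        (1 - meanFactor D (G.armProb T (lambdaMin (secondMoment D)) t k ω) ^
          (G.M T (lambdaMin (secondMoment D)) t ω + 1)) *ᵥ (G.θ t k ω).ofLp) ∂P := by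
  have := h.isProb
  have := h.isProb_context
  have hG0 := G.beforeDraw_zero T t
  have hD := h.draws hm hmK hd ht k
  have key := hD.integral_estimate_eq x.ofLp (g := g) (ε := G.ε t k)
    (θ := fun ω => (G.θ t k ω).ofLp) (𝓗 := G.past T t ⊔ G.drawInfo t 0)
    (by rwa [hG0]) (fun i => by rw [hG0]; exact h.θ_bdd ht t k i) (h.ε_bdd ht k)
    (by rw [hG0]; exact le_sup_left)
    (sup_le (G.past_le_beforeDraw T t 1) (G.drawInfo_le_beforeDraw T t one_pos))
    ((G.measurable_X_drawInfo t 0).mono le_sup_right le_rfl)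
    ((measurable_vec k).comp ((G.measurable_A_drawInfo t 0).mono le_sup_right le_rfl))
    (fun Z hZ => h.integral_mul_noise ht k hZ)
    (M := G.M T (lambdaMin (secondMoment D)) t) (by rw [hG0]; exact h.M_meas hm hmK _ (by
      have := ht.2; omega)) (fun ω => h.M_le hm hmK _ ht.2 ω)
  rw [← key]
  congr 1; ext ω
  rw [inner_thetaTilde, loss, inner_eq_dotProduct]

/-- The random variable `⟨x, θ̃⟩` is bounded. -/
lemma IsRun.inner_thetaTilde_bdd (h : G.IsRun P 𝒳 D T) (hm : 1 ≤ m) (hmK : m ≤ K) (hd : 1 ≤ d)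
    {t : ℕ} (ht : t ∈ Set.Icc 1 T) (k : Fin K) (x : Ctx d) :
    BddMeas P mΩ (fun ω => inner ℝ x (G.thetaTilde T (lambdaMin (secondMoment D)) t k ω)) := by
  have := h.isProb_context
  have hD := h.draws hm hmK hd ht k
  set lam := lambdaMin (secondMoment D)
  set N := ⌈betaMax K m d T lam⌉₊
  have htT : t ≤ T + 1 := by have := ht.2; omega
  have e : ∀ ω, inner ℝ x (G.thetaTilde T lam t k ω) = (((G.X t 0 ω).ofLp ⬝ᵥ (G.θ t k ω).ofLp) +
      G.ε t k ω) * (G.A t 0 ω).vec k *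
      (1 / 2 * ∑ n ∈ Finset.range (N + 1), (if n ≤ G.M T lam t ω then (1 : ℝ) else 0) *
        (walk (G.X t) (fun n ω => (G.A t n ω).vec k) x.ofLp n ω ⬝ᵥ (G.X t 0 ω).ofLp)) := fun ω => by
    rw [inner_thetaTilde, loss, inner_eq_dotProduct,
      sum_range_succ_eq_sum_ite (fun n => walk (G.X t) (fun n ω => (G.A t n ω).vec k) x.ofLp n ω ⬝ᵥ
        (G.X t 0 ω).ofLp) (h.M_le hm hmK lam ht.2 ω)]
  simp only [e]
  have hX : ∀ i, BddMeas P mΩ (fun ω => (G.X t 0 ω).ofLp i) := fun i => (hD.X_bdd 0 i).mono (hD.le _)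
  exact (((BddMeas.dot hX fun i => (h.θ_bdd ht t k i).mono (h.past_le htT)).add
    ((h.ε_bdd ht k).mono (h.beforeDraw_le ht 1))).mul ((hD.a_bdd 0).mono (hD.le _))).mul
    ((BddMeas.const _).mul (BddMeas.sum _ fun n _ =>
      (BddMeas.indicator_le ((h.M_meas hm hmK lam htT).mono (h.past_le htT) le_rfl) n).mul
        (BddMeas.dot (fun i => (hD.walk_bdd _ n i).mono (hD.le _)) hX)))

/-- The second moment of the estimated loss at `x` is at most `∑ i, xᵀ Φⁱ(I) x`, where `Φ` is the
averaged update of the arm. -/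
lemma IsRun.integral_sq_thetaTilde_le (h : G.IsRun P 𝒳 D T) (hm : 1 ≤ m) (hmK : m ≤ K) (hd : 1 ≤ d)
    {t : ℕ} (ht : t ∈ Set.Icc 1 T) (k : Fin K) (x : Ctx d) {s : Ω → ℝ}
    (hs : BddMeas P (G.past T t) s) (hs0 : ∀ ω, 0 ≤ s ω) :
    ∫ ω, s ω * inner ℝ x (G.thetaTilde T (lambdaMin (secondMoment D)) t k ω) ^ 2 ∂P ≤
      ∫ ω, s ω * ∑ i ∈ Finset.range (⌈betaMax K m d T (lambdaMin (secondMoment D))⌉₊ + 1),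
        x.ofLp ⬝ᵥ (updateMean D (G.armProb T (lambdaMin (secondMoment D)) t k ω))^[i] 1 *ᵥ
          x.ofLp ∂P := by
  have := h.isProb
  have := h.isProb_context
  have hG0 := G.beforeDraw_zero T t
  have hD := h.draws hm hmK hd ht k
  set lam := lambdaMin (secondMoment D)
  set N := ⌈betaMax K m d T lam⌉₊
  have htT : t ≤ T + 1 := by have := ht.2; omega
  refine le_trans ?_ (hD.integral_sq_estimate_le x.ofLp (s := s) (by rwa [hG0]) hs0
    (M := G.M T lam t) (by rw [hG0]; exact h.M_meas hm hmK _ htT)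
    (fun ω => h.M_le hm hmK _ ht.2 ω))
  have hX : ∀ i, BddMeas P mΩ (fun ω => (G.X t 0 ω).ofLp i) := fun i => (hD.X_bdd 0 i).mono (hD.le _)
  refine integral_mono_ae ?_ ?_ ?_
  · exact ((hs.mono (h.past_le htT)).mul ((h.inner_thetaTilde_bdd hm hmK hd ht k x).pow 2)).integrable
      le_rfl
  · have e : ∀ ω, s ω * ((G.A t 0 ω).vec k * (1 / 2 * ∑ n ∈ Finset.range (G.M T lam t ω + 1),
        walk (G.X t) (fun n ω => (G.A t n ω).vec k) x.ofLp n ω ⬝ᵥ (G.X t 0 ω).ofLp) ^ 2) =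
        s ω * ((G.A t 0 ω).vec k * (1 / 2 * ∑ n ∈ Finset.range (N + 1),
        (if n ≤ G.M T lam t ω then (1 : ℝ) else 0) *
        (walk (G.X t) (fun n ω => (G.A t n ω).vec k) x.ofLp n ω ⬝ᵥ (G.X t 0 ω).ofLp)) ^ 2) :=
      fun ω => by
        rw [sum_range_succ_eq_sum_ite (fun n => walk (G.X t) (fun n ω => (G.A t n ω).vec k)
          x.ofLp n ω ⬝ᵥ (G.X t 0 ω).ofLp) (h.M_le hm hmK lam ht.2 ω)]
    simp only [e]
    exact ((hs.mono (h.past_le htT)).mul (((hD.a_bdd 0).mono (hD.le _)).mul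
      (((BddMeas.const _).mul (BddMeas.sum _ fun n _ =>
      (BddMeas.indicator_le ((h.M_meas hm hmK lam htT).mono (h.past_le htT) le_rfl) n).mul
        (BddMeas.dot (fun i => (hD.walk_bdd _ n i).mono (hD.le _)) hX))).pow 2))).integrable le_rfl
  · filter_upwards [h.loss_bound t ht k] with ω hω
    rw [inner_thetaTilde]
    refine mul_le_mul_of_nonneg_left ?_ (hs0 ω)
    have h1 : G.loss t k ω ^ 2 ≤ 1 := (sq_le_one_iff_abs_le_one _).2 hω
    rw [mul_pow, mul_pow]
    refine mul_le_mul_of_nonneg_right ?_ (sq_nonneg _)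
    rcases hD.a_eq 0 ω with e | e <;> rw [e] <;> linarith

/-- The factors `I - a X Xᵀ / 2` do not increase the Euclidean norm. -/
lemma IsRun.walk_dot_self_le (h : G.IsRun P 𝒳 D T) {t : ℕ} (ht : t ∈ Set.Icc 1 T) (k : Fin K) :
    ∀ᵐ ω ∂P, ∀ x : Ctx d, ‖x‖ ≤ 1 → ∀ n,
      walk (G.X t) (fun n ω => (G.A t n ω).vec k) x.ofLp n ω ⬝ᵥ
        walk (G.X t) (fun n ω => (G.A t n ω).vec k) x.ofLp n ω ≤ 1 := by
  filter_upwards [ae_all_iff.2 (h.X_norm ht)] with ω hX x hx n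
  induction n with
  | zero =>
    rw [walk_zero, dot_self_eq_norm_sq]
    exact pow_le_one₀ (norm_nonneg _) hx
  | succ n ih =>
    rw [walk_succ]
    set v := walk (G.X t) (fun n ω => (G.A t n ω).vec k) x.ofLp n ω
    have h1 : (G.X t (n + 1) ω).ofLp ⬝ᵥ (G.X t (n + 1) ω).ofLp ≤ 1 := by
      rw [dot_self_eq_norm_sq]; exact pow_le_one₀ (norm_nonneg _) (hX _)
    simp only [sub_dotProduct, dotProduct_sub, smul_dotProduct, dotProduct_smul, smul_eq_mul,
      dotProduct_comm (G.X t (n + 1) ω).ofLp v]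
    set p := v ⬝ᵥ (G.X t (n + 1) ω).ofLp
    have ha0 := (G.A t (n + 1) ω).vec_nonneg k
    have ha1 := (G.A t (n + 1) ω).vec_le_one k
    set b := (G.A t (n + 1) ω).vec k
    have h2 : b / 2 * p * (b / 2 * p * ((G.X t (n + 1) ω).ofLp ⬝ᵥ (G.X t (n + 1) ω).ofLp)) ≤
        b / 2 * p * (b / 2 * p) := by
      rw [← mul_assoc]
      exact mul_le_of_le_one_right (mul_self_nonneg _) h1
    nlinarith [mul_nonneg ha0 (sq_nonneg p), mul_nonneg (mul_nonneg ha0 (sub_nonneg.2 ha1)) (sq_nonneg p)]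

/-- The loss estimates are at most `β_t`, which keeps FTRL stable. -/
lemma IsRun.abs_inner_thetaTilde_le (h : G.IsRun P 𝒳 D T) (lam : ℝ) {t : ℕ} (ht : t ∈ Set.Icc 1 T)
    (k : Fin K) : ∀ᵐ ω ∂P, ∀ x : Ctx d, ‖x‖ ≤ 1 →
      |inner ℝ x (G.thetaTilde T lam t k ω)| ≤ G.beta T lam t ω := by
  filter_upwards [h.walk_dot_self_le ht k, h.X_norm ht 0, h.loss_bound t ht k] with ω h1 h2 h3 x hx
  have hβ := two_le_beta (G := G) (T := T) lam t ω
  rw [inner_thetaTilde, abs_mul, abs_mul, abs_mul]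
  have hy : ∀ n, |walk (G.X t) (fun n ω => (G.A t n ω).vec k) x.ofLp n ω ⬝ᵥ (G.X t 0 ω).ofLp| ≤ 1 := by
    intro n
    rw [← sq_le_one_iff_abs_le_one]
    have := Finset.sum_mul_sq_le_sq_mul_sq Finset.univ
      (walk (G.X t) (fun n ω => (G.A t n ω).vec k) x.ofLp n ω) (G.X t 0 ω).ofLp
    have e1 := h1 x hx n
    have e2 : (G.X t 0 ω).ofLp ⬝ᵥ (G.X t 0 ω).ofLp ≤ 1 := by
      rw [dot_self_eq_norm_sq]; exact pow_le_one₀ (norm_nonneg _) h2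
    simp only [dotProduct, ← sq] at e1 e2
    refine this.trans ?_
    calc _ ≤ (1 : ℝ) * 1 := mul_le_mul e1 e2 (Finset.sum_nonneg fun _ _ => sq_nonneg _) zero_le_one
      _ = 1 := one_mul 1
  have hsum : |∑ n ∈ Finset.range (G.M T lam t ω + 1),
      walk (G.X t) (fun n ω => (G.A t n ω).vec k) x.ofLp n ω ⬝ᵥ (G.X t 0 ω).ofLp| ≤
      G.beta T lam t ω + 2 := by
    refine (Finset.abs_sum_le_sum_abs _ _).trans ((Finset.sum_le_card_nsmul _ _ 1
      fun n _ => hy n).trans ?_)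
    rw [Finset.card_range, nsmul_eq_mul, mul_one, M, one_div_eta]
    push_cast
    linarith [Nat.ceil_lt_add_one (by linarith : 0 ≤ G.beta T lam t ω)]
  have ha : |(G.A t 0 ω).vec k| ≤ 1 := by
    rw [abs_of_nonneg ((G.A t 0 ω).vec_nonneg k)]; exact (G.A t 0 ω).vec_le_one k
  calc _ ≤ 1 * 1 * (|1 / 2| * (G.beta T lam t ω + 2)) := by gcongr
    _ ≤ G.beta T lam t ω := by rw [abs_of_pos (by norm_num)]; linarith

/-- The number `M_t` of draws makes the remainder of the estimate at most `t⁻²`. -/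
lemma IsRun.abs_remainder_le (h : G.IsRun P 𝒳 D T) (hm : 1 ≤ m) (hmK : m ≤ K) (hd : 1 ≤ d) {t : ℕ}
    (ht : t ∈ Set.Icc 1 T) (k : Fin K) : ∀ᵐ ω ∂P, ∀ x : Ctx d, ‖x‖ ≤ 1 →
      |x.ofLp ⬝ᵥ (meanFactor D (G.armProb T (lambdaMin (secondMoment D)) t k ω) ^
          (G.M T (lambdaMin (secondMoment D)) t ω + 1)) *ᵥ (G.θ t k ω).ofLp| ≤ 1 / (t : ℝ) ^ 2 := by
  have := h.isProb_context
  have hD := h.draws hm hmK hd ht k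
  obtain ⟨hlam, hray⟩ := lambdaMin_spec hd h.posDef
  set lam := lambdaMin (secondMoment D)
  filter_upwards [h.θ_norm t ht k] with ω hω x hx
  have hK : (1 : ℝ) ≤ K := by exact_mod_cast hm.trans hmK
  have g0 := gamma_nonneg (G := G) (T := T) hlam t ω
  have g1 := gamma_le_half (G := G) hlam ht ω
  have hβ := two_le_beta (G := G) (T := T) lam t ω
  have hone : BallBdd (fun _ : Ctx d => (1 : ℝ)) := BallBdd.const 1
  set ρ := min (1 / 2) (G.gamma T lam t ω * lam / (2 * K)) with hρ
  have hb : ∀ v : Fin d → ℝ, G.gamma T lam t ω / K * (lam * (v ⬝ᵥ v)) ≤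
      v ⬝ᵥ wMoment D (G.armProb T lam t k ω) *ᵥ v := by
    intro v
    have e := hray v
    have hs : ∀ x : Ctx d, (v ⬝ᵥ x.ofLp) * (x.ofLp ⬝ᵥ v) = (v ⬝ᵥ x.ofLp) ^ 2 := fun x => by
      rw [dotProduct_comm x.ofLp, sq]
    calc _ ≤ G.gamma T lam t ω / K * (v ⬝ᵥ secondMoment D *ᵥ v) := by gcongr
      _ = ∫ x, G.gamma T lam t ω / K * (1 * ((v ⬝ᵥ x.ofLp) * (x.ofLp ⬝ᵥ v))) ∂D := by
        rw [secondMoment_eq_wMoment, dot_wMoment h.context_norm hone]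
        simp only [one_mul, integral_const_mul]
      _ ≤ _ := by
        rw [dot_wMoment h.context_norm (hD.q_ball ω)]
        refine integral_mono (((BallBdd.const _).mul (hone.mul ((BallBdd.dot v).mul
          (BallBdd.dot' v)))).integrable h.context_norm) (((hD.q_ball ω).mul ((BallBdd.dot v).mul
          (BallBdd.dot' v))).integrable h.context_norm) fun y => ?_
        rw [one_mul]
        refine mul_le_mul_of_nonneg_right (h.armProb_bounds hm hmK hlam ht k ω y).1 ?_
        rw [hs]; positivity
  have hmain := abs_dot_pow_mulVec_le h.context_norm (hD.q_ball ω) (hD.q_nonneg ω) (hD.q_le_one ω)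
    (ρ := ρ) (min_le_left _ _) (fun v => by
      refine le_trans ?_ (hb v)
      have hv : 0 ≤ v ⬝ᵥ v := Finset.sum_nonneg fun i _ => mul_self_nonneg _
      calc 2 * ρ * (v ⬝ᵥ v) ≤ 2 * (G.gamma T lam t ω * lam / (2 * K)) * (v ⬝ᵥ v) := by
            gcongr; exact min_le_right _ _
        _ = _ := by field_simp) (G.M T lam t ω + 1) hx hω
  refine hmain.trans ?_
  have ht0 : (0 : ℝ) < t := by exact_mod_cast ht.1
  -- the quotient `γ λ / (2 K)` is below `1 / 2` because `λ ≤ 1`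
  have hlam1 : G.gamma T lam t ω * lam / (2 * K) ≤ 1 / 2 := by
    have hv := hb (Pi.single ⟨0, hd⟩ 1)
    have hv2 := (dot_wMoment_self_bounds h.context_norm (hD.q_ball ω) (hD.q_nonneg ω)
      (hD.q_le_one ω) (Pi.single ⟨0, hd⟩ 1)).2
    have e1 : (Pi.single ⟨0, hd⟩ (1 : ℝ) : Fin d → ℝ) ⬝ᵥ Pi.single ⟨0, hd⟩ 1 = 1 := by simp
    rw [e1] at hv2 hv
    have e2 : G.gamma T lam t ω * lam / (2 * K) =
        1 / 2 * (G.gamma T lam t ω / K * (lam * 1)) := by field_simp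
    rw [e2]; linarith
  have hρ' : ρ = G.gamma T lam t ω * lam / (2 * K) := min_eq_right hlam1
  have hρ0 : 0 ≤ ρ := by rw [hρ']; positivity
  have hMβ : G.beta T lam t ω ≤ G.M T lam t ω := by
    rw [M, one_div_eta]; exact Nat.le_ceil _
  have hρM : 2 * Real.log t ≤ ρ * (G.M T lam t ω + 1 : ℕ) := by
    have e : ρ * G.beta T lam t ω = 2 * Real.log t := by
      rw [hρ', gamma, eta, alpha]
      field_simp
      ring
    rw [← e]
    push_cast
    nlinarith
  calc (1 - ρ) ^ (G.M T lam t ω + 1) ≤ Real.exp (-ρ) ^ (G.M T lam t ω + 1) := by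
        have h1 : ρ ≤ 1 / 2 := min_le_left _ _
        gcongr
        · linarith
        · linarith [Real.add_one_le_exp (-ρ)]
    _ = Real.exp (-(ρ * (G.M T lam t ω + 1 : ℕ))) := by
        rw [← Real.exp_nat_mul]; congr 1; ring
    _ ≤ Real.exp (-(2 * Real.log t)) := by gcongr
    _ = 1 / (t : ℝ) ^ 2 := by
        rw [Real.exp_neg, one_div, two_mul, Real.exp_add, Real.exp_log ht0, sq]

end Play

/-! ### The FTRL bound in expectation -/

lemma BddMeas.comp_index {Ω : Type*} {𝓕 : MeasurableSpace Ω} [mΩ : MeasurableSpace Ω]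
    {P : Measure Ω} {f : ℕ → Ω → ℝ} (hf : ∀ n, BddMeas P 𝓕 (f n)) {M : Ω → ℕ}
    (hM : Measurable[𝓕] M) {N : ℕ} (hMN : ∀ ω, M ω ≤ N) : BddMeas P 𝓕 (fun ω => f (M ω) ω) := by
  have e : ∀ ω, f (M ω) ω = ∑ n ∈ Finset.range (N + 1), (if M ω = n then (1 : ℝ) else 0) * f n ω := by
    intro ω
    simp only [ite_mul, one_mul, zero_mul]
    rw [Finset.sum_ite_eq, if_pos (Finset.mem_range.2 (Nat.lt_succ_of_le (hMN ω)))]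
  simp only [e]
  exact BddMeas.sum _ fun n _ => (BddMeas.of_le (Measurable.ite (hM (measurableSet_singleton n))
    measurable_const measurable_const) (C := 1) fun ω => by split_ifs <;> simp).mul (hf n)

namespace JointBdd

variable {Ω : Type*} {d : ℕ} {𝓕 : MeasurableSpace Ω} [mΩ : MeasurableSpace Ω] {P : Measure Ω}
  {Φ : Ω → Ctx d → ℝ}

lemma slice (hΦ : JointBdd P 𝓕 Φ) {x : Ctx d} (hx : ‖x‖ ≤ 1) : BddMeas P 𝓕 (fun ω => Φ ω x) := by
  obtain ⟨mf, A, hA⟩ := hΦ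
  exact ⟨mf.comp (@measurable_prodMk_right _ _ 𝓕 _ x), A, hA.mono fun ω h => h x hx⟩

variable [IsProbabilityMeasure P] {D : Measure (Ctx d)} [IsProbabilityMeasure D]

lemma integrable_prod (hD : ∀ᵐ x ∂D, ‖x‖ ≤ 1) (hΦ : JointBdd P mΩ Φ) :
    Integrable (fun z : Ω × Ctx d => Φ z.1 z.2) (P.prod D) := by
  obtain ⟨mf, A, hA⟩ := hΦ
  refine Integrable.of_bound mf.aestronglyMeasurable A ?_
  rw [Measure.ae_prod_iff_ae_ae (measurableSet_le mf.norm measurable_const)]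
  filter_upwards [hA] with ω h
  exact hD.mono fun x hx => h x hx

end JointBdd

namespace Play

variable {K m d : ℕ} {Ω : Type*} {G : Play K m d Ω} [mΩ : MeasurableSpace Ω]
  {P : Measure Ω} {𝒳 : Set (Ctx d)} {D : Measure (Ctx d)} {T : ℕ}

lemma IsRun.integral_context' (h : G.IsRun P 𝒳 D T) {t : ℕ} (ht : t ∈ Set.Icc 1 T)
    {Φ : Ω → Ctx d → ℝ} (hΦ : JointBdd P (G.past T t) Φ) :
    ∫ ω, ∫ x, Φ ω x ∂D ∂P = ∫ ω, Φ ω (G.X t 0 ω) ∂P := by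
  have := h.isProb
  have := h.isProb_context
  have hind := h.context_indep t ht 0
  rw [beforeDraw_zero] at hind
  exact (integral_joint_eq (h.past_le (by have := ht.2; omega)) (h.measurable_X t ht 0)
    (h.context_law t ht 0) h.context_norm hind hΦ).symm

/-- A context drawn independently may replace the context of round `t` in expressions that depend
on the past of round `t` only. -/
lemma IsRun.integral_context (h : G.IsRun P 𝒳 D T) {t : ℕ} (ht : t ∈ Set.Icc 1 T)
    {Φ : Ω → Ctx d → ℝ} (hΦ : JointBdd P (G.past T t) Φ) :
    ∫ x, ∫ ω, Φ ω x ∂P ∂D = ∫ ω, Φ ω (G.X t 0 ω) ∂P := by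
  have := h.isProb
  have := h.isProb_context
  rw [← h.integral_context' ht hΦ]
  exact (integral_integral_swap ((hΦ.mono (h.past_le (by have := ht.2; omega))).integrable_prod
    h.context_norm)).symm

lemma IsRun.integrable_context (h : G.IsRun P 𝒳 D T) {t : ℕ} (ht : t ∈ Set.Icc 1 T)
    {Φ : Ω → Ctx d → ℝ} (hΦ : JointBdd P (G.past T t) Φ) :
    Integrable (fun x => ∫ ω, Φ ω x ∂P) D := by
  have := h.isProb
  have := h.isProb_context
  exact ((hΦ.mono (h.past_le (by have := ht.2; omega))).integrable_prod
    h.context_norm).integral_prod_right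

lemma IsRun.inner_joint (h : G.IsRun P 𝒳 D T) {t : ℕ} (ht : t ∈ Set.Icc 1 T) (k : Fin K) :
    JointBdd P (G.past T t) (fun ω x => inner ℝ x (G.θ t k ω)) := by
  simp only [inner_eq_dotProduct]
  exact JointBdd.dot JointBdd.coord fun i => JointBdd.of_fst (h.θ_bdd ht t k i)

lemma ballBdd_vec {u : Ctx d → Action K m} (hu : Measurable u) (k : Fin K) :
    BallBdd (fun x => (u x).vec k) :=
  ⟨(measurable_vec k).comp hu, 1, fun x _ => by
    rw [abs_of_nonneg ((u x).vec_nonneg k)]; exact (u x).vec_le_one k⟩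

/-- At a fixed context the estimated regret of a round falls short of the true one by at most
`2 m / t²`, the bias of the estimates. -/
lemma IsRun.true_le_estimated (h : G.IsRun P 𝒳 D T) (hm : 1 ≤ m) (hmK : m ≤ K) (hd : 1 ≤ d)
    {x : Ctx d} (hx : ‖x‖ ≤ 1) (b : Action K m) {t : ℕ} (ht : t ∈ Set.Icc 1 T) :
    ∑ k, ∫ ω, (G.meanAction t ω x k - b.vec k) * inner ℝ x (G.θ t k ω) ∂P ≤
      ∑ k, ∫ ω, (G.meanAction t ω x k - b.vec k) *
        inner ℝ x (G.thetaTilde T (lambdaMin (secondMoment D)) t k ω) ∂P + 2 * m / (t : ℝ) ^ 2 := by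
  have := h.isProb
  have := h.isProb_context
  have htT : t ≤ T + 1 := by have := ht.2; omega
  set lam := lambdaMin (secondMoment D) with hl
  have hg : ∀ k, BddMeas P (G.past T t) (fun ω => G.meanAction t ω x k - b.vec k) := fun k =>
    ((h.meanAction_joint ht k).slice hx).sub (BddMeas.const _)
  have hθ : ∀ k, BddMeas P (G.past T t) (fun ω => x.ofLp ⬝ᵥ (G.θ t k ω).ofLp) := fun k =>
    BddMeas.dot (fun _ => BddMeas.const _) fun i => h.θ_bdd ht t k i
  set r : Fin K → Ω → ℝ := fun k ω => x.ofLp ⬝ᵥ (meanFactor D (G.armProb T lam t k ω) ^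
          (G.M T lam t ω + 1)) *ᵥ (G.θ t k ω).ofLp with hr
  have hrb : ∀ k, BddMeas P (G.past T t) (r k) := fun k => by
    have hD := h.draws hm hmK hd ht k
    have hb := hD.meanFactor_bdd
    rw [beforeDraw_zero] at hb
    exact BddMeas.comp_index (f := fun n ω => x.ofLp ⬝ᵥ (meanFactor D (G.armProb T lam t k ω) ^
          (n + 1)) *ᵥ (G.θ t k ω).ofLp) (fun n => BddMeas.dot (fun _ => BddMeas.const _)
      (BddMeas.mulVec (BddMeas.matPow hb _) fun i => h.θ_bdd ht t k i)) (h.M_meas hm hmK lam htT)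
      (fun ω => h.M_le hm hmK lam ht.2 ω)
  have e : ∀ k, ∫ ω, (G.meanAction t ω x k - b.vec k) * inner ℝ x (G.thetaTilde T lam t k ω) ∂P =
      ∫ ω, (G.meanAction t ω x k - b.vec k) * inner ℝ x (G.θ t k ω) ∂P -
      ∫ ω, (G.meanAction t ω x k - b.vec k) * r k ω ∂P := fun k => by
    rw [h.integral_thetaTilde hm hmK hd ht k x (hg k)]
    simp only [inner_eq_dotProduct]
    rw [← integral_sub (((hg k).mul (hθ k)).integrable (h.past_le htT))
      (((hg k).mul (hrb k)).integrable (h.past_le htT))]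
    congr 1; ext ω
    rw [Matrix.sub_mulVec, Matrix.one_mulVec, dotProduct_sub, mul_sub]
  simp only [e, Finset.sum_sub_distrib]
  rw [sub_add, le_sub_self_iff, sub_nonpos,
    ← integral_finsetSum _ fun k _ => ((hg k).mul (hrb k)).integrable (h.past_le htT)]
  have hc : ∫ _ : Ω, 2 * m / (t : ℝ) ^ 2 ∂P = 2 * m / (t : ℝ) ^ 2 := by simp
  rw [← hc]
  refine integral_mono_ae ((BddMeas.sum _ fun k _ => (hg k).mul (hrb k)).integrable (h.past_le htT))
    (integrable_const _) ?_
  filter_upwards [ae_all_iff.2 fun k => h.abs_remainder_le hm hmK hd ht k] with ω hω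
  obtain ⟨a0, _, a2⟩ := actionHull_bounds (h.meanAction_mem ht ω x)
  calc ∑ k, (G.meanAction t ω x k - b.vec k) * r k ω
      ≤ ∑ k, (G.meanAction t ω x k + b.vec k) * (1 / (t : ℝ) ^ 2) := by
        refine Finset.sum_le_sum fun k _ => ?_
        refine (le_abs_self _).trans ?_
        rw [abs_mul]
        have hb := b.vec_nonneg k
        exact mul_le_mul (abs_le.2 ⟨by linarith [a0 k], by linarith [a0 k]⟩) (hω k x hx)
          (abs_nonneg _) (by linarith [a0 k])
    _ = ((∑ k, G.meanAction t ω x k) + ∑ k, b.vec k) * (1 / (t : ℝ) ^ 2) := by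
        rw [← Finset.sum_mul, Finset.sum_add_distrib]
    _ ≤ (m + m) * (1 / (t : ℝ) ^ 2) := by gcongr; exact b.sum_vec_le
    _ = _ := by ring

/-- The FTRL inequality at a fixed context, integrated over the randomness of the run. -/
lemma IsRun.ftrl_fixed (h : G.IsRun P 𝒳 D T) (hm : 1 ≤ m) (hmK : m ≤ K) (hd : 1 ≤ d) (hT : 1 ≤ T)
    {x : Ctx d} (hx : ‖x‖ ≤ 1) (b : Action K m) :
    ∑ t ∈ Finset.Icc 1 T, ∑ k,
        ∫ ω, (G.meanAction t ω x k - b.vec k) * inner ℝ x (G.θ t k ω) ∂P ≤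
      ∑ t ∈ Finset.Icc 1 T, 2 * m / (t : ℝ) ^ 2 +
      ∑ t ∈ Finset.Icc 1 T, ∑ k, ∫ ω, G.eta T (lambdaMin (secondMoment D)) t ω *
        G.meanAction t ω x k *
        ∑ i ∈ Finset.range (⌈betaMax K m d T (lambdaMin (secondMoment D))⌉₊ + 1),
        x.ofLp ⬝ᵥ (updateMean D (G.armProb T (lambdaMin (secondMoment D)) t k ω))^[i] 1 *ᵥ
          x.ofLp ∂P +
      (∫ ω, G.beta T (lambdaMin (secondMoment D)) 1 ω * entropy (G.meanAction 1 ω x) ∂P +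
      ∑ t ∈ Finset.Ico 1 T, ∫ ω, (G.beta T (lambdaMin (secondMoment D)) (t + 1) ω -
        G.beta T (lambdaMin (secondMoment D)) t ω) * entropy (G.meanAction (t + 1) ω x) ∂P) := by
  have := h.isProb
  have := h.isProb_context
  set lam := lambdaMin (secondMoment D) with hl
  have htt : ∀ t k, t ∈ Finset.Icc 1 T →
      BddMeas P mΩ (fun ω => inner ℝ x (G.thetaTilde T lam t k ω)) := fun t k ht =>
    h.inner_thetaTilde_bdd hm hmK hd (by simpa using ht) k x
  have hA : ∀ t k, t ∈ Finset.Icc 1 T → BddMeas P (G.past T t) (fun ω => G.meanAction t ω x k) :=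
    fun t k ht => (h.meanAction_joint (by simpa using ht) k).slice hx
  have hpast : ∀ t, t ∈ Finset.Icc 1 T → G.past T t ≤ mΩ := fun t ht =>
    h.past_le (by have := (Finset.mem_Icc.1 ht).2; omega)
  have hη : ∀ t, t ∈ Finset.Icc 1 T → BddMeas P (G.past T t) (G.eta T lam t) := fun t ht =>
    h.eta_bdd hm hmK lam (by have := (Finset.mem_Icc.1 ht).2; omega)
  have hH : ∀ t, t ∈ Finset.Icc 1 T → BddMeas P mΩ (fun ω => entropy (G.meanAction t ω x)) :=
    fun t ht => ((h.entropy_joint hm hmK (by simpa using ht)).slice hx).mono (hpast t ht)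
  have hβ : ∀ t, t ∈ Finset.Icc 1 T → BddMeas P mΩ (G.beta T lam t) := fun t ht =>
    (h.beta_bdd hm hmK lam (Finset.mem_Icc.1 ht).2).mono (hpast t ht)
  -- the regret bound of FTRL, applied to almost every trajectory of the estimates
  have hpath : ∀ᵐ ω ∂P, ∑ t ∈ Finset.Icc 1 T, ∑ k,
      (G.meanAction t ω x k - b.vec k) * inner ℝ x (G.thetaTilde T lam t k ω) ≤
      ∑ t ∈ Finset.Icc 1 T, ∑ k, G.eta T lam t ω * G.meanAction t ω x k *
        inner ℝ x (G.thetaTilde T lam t k ω) ^ 2 + (G.beta T lam 1 ω * entropy (G.meanAction 1 ω x) +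
      ∑ t ∈ Finset.Ico 1 T, (G.beta T lam (t + 1) ω - G.beta T lam t ω) *
        entropy (G.meanAction (t + 1) ω x)) := by
    have hall : ∀ᵐ ω ∂P, ∀ t, t ∈ Set.Icc 1 T → ∀ k, ∀ x : Ctx d, ‖x‖ ≤ 1 →
      |inner ℝ x (G.thetaTilde T lam t k ω)| ≤ G.beta T lam t ω := by
      rw [ae_all_iff]; intro t
      rw [Filter.eventually_imp_distrib_left]; intro ht
      rw [ae_all_iff]; intro k
      exact h.abs_inner_thetaTilde_le lam ht k
    filter_upwards [hall] with ω hω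
    have key := ftrl_regret (K := K) (𝒞 := actionHull K m) (convex_convexHull ℝ _)
      (fun c hc k => (actionHull_bounds hc).1 k)
      (fun k => ⟨_, vec_mem_actionHull (singleArm hm k), by rw [singleArm_vec]; simp⟩)
      (l := fun t k => inner ℝ x (G.thetaTilde T lam t k ω)) (a := fun t => G.meanAction t ω x)
      (β := fun t => G.beta T lam t ω) hT (vec_mem_actionHull b) (entropy_vec b)
      (fun t _ => by have := two_le_beta (G := G) (T := T) lam t ω; linarith)
      (fun t ht => h.meanAction_mem ht ω x)
      (fun t ht => by
        have hmin := h.ftrl t ht ω x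
        have e : G.objective T lam t ω x = regLoss (fun k => ∑ s ∈ Finset.Ico 1 t,
            inner ℝ x (G.thetaTilde T lam s k ω)) (G.beta T lam t ω) := by
          ext a
          rw [objective, regLoss, Finset.sum_comm]
          simp only [Finset.sum_mul]
          rw [← one_div_eta]; ring
        rwa [e] at hmin)
      (fun t ht k => hω t ht k x hx)
    have e1 : ∑ t ∈ Finset.Icc 1 T, ∑ k, (G.meanAction t ω x k - b.vec k) *
        inner ℝ x (G.thetaTilde T lam t k ω) = ∑ t ∈ Finset.Icc 1 T, ∑ k,
        inner ℝ x (G.thetaTilde T lam t k ω) * (G.meanAction t ω x k - b.vec k) :=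
      Finset.sum_congr rfl fun t _ => Finset.sum_congr rfl fun k _ => mul_comm _ _
    have e2 : ∑ t ∈ Finset.Icc 1 T, ∑ k, G.eta T lam t ω * G.meanAction t ω x k *
        inner ℝ x (G.thetaTilde T lam t k ω) ^ 2 = ∑ t ∈ Finset.Icc 1 T, ∑ k,
        G.meanAction t ω x k * inner ℝ x (G.thetaTilde T lam t k ω) ^ 2 / G.beta T lam t ω :=
      Finset.sum_congr rfl fun t _ => Finset.sum_congr rfl fun k _ => by rw [eta]; ring
    rw [e1, e2, ← add_assoc]
    exact key
  have i1 : ∀ t ∈ Finset.Icc 1 T, ∀ k, Integrable (fun ω => (G.meanAction t ω x k - b.vec k) *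
      inner ℝ x (G.thetaTilde T lam t k ω)) P := fun t ht k =>
    ((((hA t k ht).mono (hpast t ht)).sub (BddMeas.const _)).mul (htt t k ht)).integrable le_rfl
  have i2 : ∀ t ∈ Finset.Icc 1 T, ∀ k, Integrable (fun ω => G.eta T lam t ω * G.meanAction t ω x k *
        inner ℝ x (G.thetaTilde T lam t k ω) ^ 2) P := fun t ht k =>
    ((((hη t ht).mul (hA t k ht)).mono (hpast t ht)).mul ((htt t k ht).pow 2)).integrable le_rfl
  have i3 : Integrable (fun ω => G.beta T lam 1 ω * entropy (G.meanAction 1 ω x)) P :=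
    ((hβ 1 (by simp [hT])).mul (hH 1 (by simp [hT]))).integrable le_rfl
  have i4 : ∀ t ∈ Finset.Ico 1 T, Integrable (fun ω => (G.beta T lam (t + 1) ω - G.beta T lam t ω) *
        entropy (G.meanAction (t + 1) ω x)) P := fun t ht => by
    rw [Finset.mem_Ico] at ht
    exact (((hβ (t + 1) (by simp; omega)).sub (hβ t (by simp; omega))).mul
      (hH (t + 1) (by simp; omega))).integrable le_rfl
  have hint := integral_mono_ae (integrable_finsetSum _ fun t ht => integrable_finsetSum _
    fun k _ => i1 t ht k) ((integrable_finsetSum _ fun t ht => integrable_finsetSum _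
    fun k _ => i2 t ht k).add (i3.add (integrable_finsetSum _ fun t ht => i4 t ht))) hpath
  rw [integral_finsetSum _ fun t ht => integrable_finsetSum _ fun k _ => i1 t ht k,
    integral_add' (integrable_finsetSum _ fun t ht => integrable_finsetSum _ fun k _ => i2 t ht k)
      (i3.add (integrable_finsetSum _ fun t ht => i4 t ht)),
    integral_add' i3 (integrable_finsetSum _ fun t ht => i4 t ht),
    integral_finsetSum _ fun t ht => integrable_finsetSum _ fun k _ => i2 t ht k,
    integral_finsetSum _ fun t ht => i4 t ht] at hint
  have h1 : ∑ t ∈ Finset.Icc 1 T, ∑ k,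
        ∫ ω, (G.meanAction t ω x k - b.vec k) * inner ℝ x (G.θ t k ω) ∂P ≤
      ∑ t ∈ Finset.Icc 1 T, ∫ ω, ∑ k, (G.meanAction t ω x k - b.vec k) *
        inner ℝ x (G.thetaTilde T lam t k ω) ∂P + ∑ t ∈ Finset.Icc 1 T, 2 * m / (t : ℝ) ^ 2 := by
    rw [← Finset.sum_add_distrib]
    refine Finset.sum_le_sum fun t ht => ?_
    rw [integral_finsetSum _ fun k _ => i1 t ht k]
    exact h.true_le_estimated hm hmK hd hx b (by simpa using ht)
  have h2 : ∑ t ∈ Finset.Icc 1 T, ∫ ω, ∑ k, G.eta T lam t ω * G.meanAction t ω x k *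
        inner ℝ x (G.thetaTilde T lam t k ω) ^ 2 ∂P ≤
      ∑ t ∈ Finset.Icc 1 T, ∑ k, ∫ ω, G.eta T lam t ω * G.meanAction t ω x k *
        ∑ i ∈ Finset.range (⌈betaMax K m d T lam⌉₊ + 1),
        x.ofLp ⬝ᵥ (updateMean D (G.armProb T lam t k ω))^[i] 1 *ᵥ x.ofLp ∂P := by
    refine Finset.sum_le_sum fun t ht => ?_
    rw [integral_finsetSum _ fun k _ => i2 t ht k]
    exact Finset.sum_le_sum fun k _ => h.integral_sq_thetaTilde_le hm hmK hd (by simpa using ht) k x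
      ((hη t ht).mul (hA t k ht)) fun ω => mul_nonneg (eta_pos lam t ω).le
        ((actionHull_bounds (h.meanAction_mem (by simpa using ht) ω x)).1 k)
  linarith

lemma sum_inv_sq_le (T : ℕ) : ∑ t ∈ Finset.Icc 1 T, 1 / (t : ℝ) ^ 2 ≤ 2 := by
  have key : ∀ T : ℕ, 1 ≤ T → ∑ t ∈ Finset.Icc 1 T, 1 / (t : ℝ) ^ 2 ≤ 2 - 1 / (T : ℝ) := by
    intro T hT
    induction T, hT using Nat.le_induction with
    | base => simp; norm_num
    | succ n hn ih =>
      rw [Finset.sum_Icc_succ_top (by omega)]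
      have hn0 : (0 : ℝ) < n := by exact_mod_cast hn
      have : 1 / ((n + 1 : ℕ) : ℝ) ^ 2 ≤ 1 / n - 1 / ((n + 1 : ℕ) : ℝ) := by
        push_cast
        rw [div_sub_div _ _ hn0.ne' (by positivity), div_le_div_iff₀ (by positivity) (by positivity)]
        nlinarith
      linarith
  rcases Nat.eq_zero_or_pos T with rfl | hT
  · simp
  · have := key T hT
    have h0 : (0 : ℝ) ≤ 1 / T := by positivity
    linarith

/-- The second-order term of one arm, averaged over the context, is of order `d`: the iterate is at
most twice the probability of playing the arm, because the exploration rate is at most one half. -/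
lemma IsRun.stability_le (h : G.IsRun P 𝒳 D T) (hm : 1 ≤ m) (hmK : m ≤ K) (hd : 1 ≤ d) {t : ℕ}
    (ht : t ∈ Set.Icc 1 T) (k : Fin K) (N : ℕ) (ω : Ω) :
    ∫ x, G.meanAction t ω x k * ∑ i ∈ Finset.range N,
        x.ofLp ⬝ᵥ (updateMean D (G.armProb T (lambdaMin (secondMoment D)) t k ω))^[i] 1 *ᵥ x.ofLp ∂D ≤
      8 / 3 * d := by
  have := h.isProb_context
  have hD := h.draws hm hmK hd ht k
  obtain ⟨hlam, _⟩ := lambdaMin_spec hd h.posDef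
  set lam := lambdaMin (secondMoment D)
  set q := G.armProb T lam t k ω with hq
  have hqb : BallBdd q := hD.q_ball ω
  have hA : BallBdd (fun x => G.meanAction t ω x k) := by
    refine ⟨(h.meanAction_joint ht k).meas.comp (@measurable_prodMk_left _ _ (G.past T t) _ ω), 1,
      fun x _ => ?_⟩
    obtain ⟨a0, a1, _⟩ := actionHull_bounds (h.meanAction_mem ht ω x)
    rw [abs_of_nonneg (a0 k)]; exact a1 k
  have hqn : ∀ i, QuadNonneg ((updateMean D q)^[i] 1) := fun i =>
    quadNonneg_updateMean_iterate h.context_norm hqb quadNonneg_one (hD.q_nonneg ω)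
      (hD.q_le_one ω) i
  calc _ ≤ ∫ x, 2 * ∑ i ∈ Finset.range N,
        q x * (x.ofLp ⬝ᵥ (updateMean D q)^[i] 1 *ᵥ x.ofLp) ∂D := by
        refine integral_mono ((hA.mul (BallBdd.sum _ fun i _ => BallBdd.quad _)).integrable
          h.context_norm) (((BallBdd.const 2).mul (BallBdd.sum _ fun i _ => hqb.mul
          (BallBdd.quad _))).integrable h.context_norm) fun x => ?_
        rw [← Finset.mul_sum, ← mul_assoc]
        exact mul_le_mul_of_nonneg_right (h.armProb_bounds hm hmK hlam ht k ω x).2.1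
          (Finset.sum_nonneg fun i _ => hqn i _)
    _ = 2 * ∑ i ∈ Finset.range N, (wMoment D q * (updateMean D q)^[i] 1).trace := by
        rw [integral_const_mul, integral_finsetSum _ fun i _ => (hqb.mul
          (BallBdd.quad _)).integrable h.context_norm]
        simp only [trace_wMoment_mul h.context_norm hqb]
    _ ≤ 2 * (4 / 3 * d) := by
        gcongr
        exact sum_trace_updateMean_iterate_le h.context_norm hqb (hD.q_nonneg ω)
          (hD.q_le_one ω) N
    _ = _ := by ring

/-- Regret of the FTRL iterates against any measurable comparator. -/
theorem IsRun.ftrl_regret_le (h : G.IsRun P 𝒳 D T) (hm : 1 ≤ m) (hmK : m ≤ K) (hd : 1 ≤ d)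
    (hT : 1 ≤ T) {u : Ctx d → Action K m} (hu : Measurable u) :
    ∑ t ∈ Finset.Icc 1 T, ∑ k, ∫ ω, (G.meanAction t ω (G.X t 0 ω) k - (u (G.X t 0 ω)).vec k) *
        inner ℝ (G.X t 0 ω) (G.θ t k ω) ∂P ≤
      4 * m + 8 / 3 * d * K * ∑ t ∈ Finset.Icc 1 T,
        ∫ ω, G.eta T (lambdaMin (secondMoment D)) t ω ∂P +
      (∫ ω, G.beta T (lambdaMin (secondMoment D)) 1 ω *
          entropy (G.meanAction 1 ω (G.X 1 0 ω)) ∂P +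
      ∑ t ∈ Finset.Ico 1 T, ∫ ω, (G.beta T (lambdaMin (secondMoment D)) (t + 1) ω -
        G.beta T (lambdaMin (secondMoment D)) t ω) *
          entropy (G.meanAction (t + 1) ω (G.X (t + 1) 0 ω)) ∂P) := by
  have := h.isProb
  have := h.isProb_context
  set lam := lambdaMin (secondMoment D) with hl
  set N := ⌈betaMax K m d T lam⌉₊ + 1
  have hη : ∀ t, t ∈ Finset.Icc 1 T → BddMeas P (G.past T t) (G.eta T lam t) := fun t ht =>
    h.eta_bdd hm hmK lam (by have := (Finset.mem_Icc.1 ht).2; omega)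
  have hS : ∀ t, t ∈ Finset.Icc 1 T → t ∈ Set.Icc 1 T := fun t ht => by simpa using ht
  have hβ : ∀ s t, s ≤ t → t ∈ Finset.Icc 1 T → BddMeas P (G.past T t) (G.beta T lam s) :=
    fun s t hst ht => (h.beta_bdd hm hmK lam (hst.trans (Finset.mem_Icc.1 ht).2)).mono
      (G.past_mono T hst)
  have j1 : ∀ t ∈ Finset.Icc 1 T, ∀ k, JointBdd P (G.past T t) (fun ω x =>
      (G.meanAction t ω x k - (u x).vec k) * inner ℝ x (G.θ t k ω)) := fun t ht k =>
    ((h.meanAction_joint (hS t ht) k).sub (JointBdd.of_snd (ballBdd_vec hu k))).mul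
      (h.inner_joint (hS t ht) k)
  have j2' : ∀ t ∈ Finset.Icc 1 T, ∀ k, JointBdd P (G.past T t) (fun ω x =>
      G.meanAction t ω x k * ∑ i ∈ Finset.range N,
        x.ofLp ⬝ᵥ (updateMean D (G.armProb T lam t k ω))^[i] 1 *ᵥ x.ofLp) := fun t ht k => by
    have hD := h.draws hm hmK hd (hS t ht) k
    have hb := hD.updateMean_iterate_bdd 1
    rw [beforeDraw_zero] at hb
    exact (h.meanAction_joint (hS t ht) k).mul
      (JointBdd.sum _ fun i _ => JointBdd.dot JointBdd.coord
        (JointBdd.mulVec (hb i) JointBdd.coord))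
  have j2 : ∀ t ∈ Finset.Icc 1 T, ∀ k, JointBdd P (G.past T t) (fun ω x =>
      G.eta T lam t ω * G.meanAction t ω x k * ∑ i ∈ Finset.range N,
        x.ofLp ⬝ᵥ (updateMean D (G.armProb T lam t k ω))^[i] 1 *ᵥ x.ofLp) := fun t ht k => by
    simpa only [mul_assoc] using (JointBdd.of_fst (hη t ht)).mul (j2' t ht k)
  have h1T : 1 ∈ Finset.Icc 1 T := by simp [hT]
  have hs : ∀ t ∈ Finset.Ico 1 T, t + 1 ∈ Finset.Icc 1 T := fun t ht => by
    have := Finset.mem_Ico.1 ht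
    simp; omega
  have j3 : JointBdd P (G.past T 1) (fun ω x => G.beta T lam 1 ω * entropy (G.meanAction 1 ω x)) :=
    (JointBdd.of_fst (hβ 1 1 le_rfl h1T)).mul (h.entropy_joint hm hmK (hS 1 h1T))
  have j4 : ∀ t ∈ Finset.Ico 1 T, JointBdd P (G.past T (t + 1)) (fun ω x =>
      (G.beta T lam (t + 1) ω - G.beta T lam t ω) * entropy (G.meanAction (t + 1) ω x)) :=
    fun t ht => (JointBdd.of_fst ((hβ (t + 1) (t + 1) le_rfl (hs t ht)).sub
      (hβ t (t + 1) (by omega) (hs t ht)))).mul (h.entropy_joint hm hmK (hS _ (hs t ht)))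
  have hmono := integral_mono_ae (μ := D)
    (integrable_finsetSum _ fun t ht => integrable_finsetSum _ fun k _ =>
      h.integrable_context (hS t ht) (j1 t ht k))
    (((integrable_const _).add (integrable_finsetSum _ fun t ht => integrable_finsetSum _ fun k _ =>
      h.integrable_context (hS t ht) (j2 t ht k))).add ((h.integrable_context (hS 1 h1T) j3).add
      (integrable_finsetSum _ fun t ht => h.integrable_context (hS _ (hs t ht)) (j4 t ht))))
    (h.context_norm.mono fun x hx => h.ftrl_fixed hm hmK hd hT hx (u x))
  rw [integral_finsetSum _ fun t ht => integrable_finsetSum _ fun k _ =>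
      h.integrable_context (hS t ht) (j1 t ht k),
    integral_add' ((integrable_const _).add (integrable_finsetSum _ fun t ht =>
      integrable_finsetSum _ fun k _ => h.integrable_context (hS t ht) (j2 t ht k)))
      ((h.integrable_context (hS 1 h1T) j3).add
      (integrable_finsetSum _ fun t ht => h.integrable_context (hS _ (hs t ht)) (j4 t ht))),
    integral_add' (integrable_const _) (integrable_finsetSum _ fun t ht =>
      integrable_finsetSum _ fun k _ => h.integrable_context (hS t ht) (j2 t ht k)),
    integral_add' (h.integrable_context (hS 1 h1T) j3)
      (integrable_finsetSum _ fun t ht => h.integrable_context (hS _ (hs t ht)) (j4 t ht)),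
    integral_finsetSum _ fun t ht => integrable_finsetSum _ fun k _ =>
      h.integrable_context (hS t ht) (j2 t ht k),
    integral_finsetSum _ fun t ht => h.integrable_context (hS _ (hs t ht)) (j4 t ht),
    h.integral_context (hS 1 h1T) j3] at hmono
  have e1 : ∑ t ∈ Finset.Icc 1 T, ∫ x, ∑ k, ∫ ω, (G.meanAction t ω x k - (u x).vec k) *
      inner ℝ x (G.θ t k ω) ∂P ∂D = ∑ t ∈ Finset.Icc 1 T, ∑ k,
      ∫ ω, (G.meanAction t ω (G.X t 0 ω) k - (u (G.X t 0 ω)).vec k) *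
        inner ℝ (G.X t 0 ω) (G.θ t k ω) ∂P := by
    refine Finset.sum_congr rfl fun t ht => ?_
    rw [integral_finsetSum _ fun k _ => h.integrable_context (hS t ht) (j1 t ht k)]
    exact Finset.sum_congr rfl fun k _ => h.integral_context (hS t ht) (j1 t ht k)
  have e4 : ∑ t ∈ Finset.Ico 1 T, ∫ x, ∫ ω, (G.beta T lam (t + 1) ω - G.beta T lam t ω) *
      entropy (G.meanAction (t + 1) ω x) ∂P ∂D = ∑ t ∈ Finset.Ico 1 T,
      ∫ ω, (G.beta T lam (t + 1) ω - G.beta T lam t ω) *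
        entropy (G.meanAction (t + 1) ω (G.X (t + 1) 0 ω)) ∂P :=
    Finset.sum_congr rfl fun t ht => h.integral_context (hS _ (hs t ht)) (j4 t ht)
  have e2 : ∑ t ∈ Finset.Icc 1 T, ∫ x, ∑ k, ∫ ω, G.eta T lam t ω * G.meanAction t ω x k *
      ∑ i ∈ Finset.range N, x.ofLp ⬝ᵥ (updateMean D (G.armProb T lam t k ω))^[i] 1 *ᵥ x.ofLp ∂P ∂D ≤
      8 / 3 * d * K * ∑ t ∈ Finset.Icc 1 T, ∫ ω, G.eta T lam t ω ∂P := by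
    rw [Finset.mul_sum]
    refine Finset.sum_le_sum fun t ht => ?_
    have hle := h.past_le (t := t) (by have := (Finset.mem_Icc.1 ht).2; omega)
    rw [integral_finsetSum _ fun k _ => h.integrable_context (hS t ht) (j2 t ht k)]
    calc _ ≤ ∑ _k : Fin K, 8 / 3 * d * ∫ ω, G.eta T lam t ω ∂P := by
          refine Finset.sum_le_sum fun k _ => ?_
          rw [h.integral_context (hS t ht) (j2 t ht k), ← h.integral_context' (hS t ht) (j2 t ht k),
            ← integral_const_mul]
          refine integral_mono (((j2 t ht k).integral h.context_norm).integrable hle)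
            (((BddMeas.const _).mul (hη t ht)).integrable hle) fun ω => ?_
          simp only [mul_assoc (G.eta T lam t ω)]
          rw [integral_const_mul, mul_comm (8 / 3 * (d : ℝ))]
          exact mul_le_mul_of_nonneg_left (h.stability_le hm hmK hd (hS t ht) k N ω)
            (eta_pos lam t ω).le
      _ = _ := by
          rw [Finset.sum_const, Finset.card_univ, Fintype.card_fin, nsmul_eq_mul]; ring
  have e0 : ∫ _ : Ctx d, ∑ t ∈ Finset.Icc 1 T, 2 * m / (t : ℝ) ^ 2 ∂D ≤ 4 * (m : ℝ) := by
    rw [integral_const, probReal_univ, one_smul]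
    have := mul_le_mul_of_nonneg_left (sum_inv_sq_le T) (by positivity : (0 : ℝ) ≤ 2 * m)
    rw [Finset.mul_sum] at this
    simp only [mul_one_div] at this
    linarith
  linarith

end Play

/-! ### Sums of entropy-adapted learning rates -/

section Rates

variable {H : ℕ → ℝ} {h c Hm : ℝ}

/-- The growth factor `1 + h⁻¹ ∑_{r ≤ s} H_r` that drives the adaptive regularization. -/
def growth (h : ℝ) (H : ℕ → ℝ) (s : ℕ) : ℝ := 1 + h⁻¹ * ∑ r ∈ Finset.Icc 1 s, H r

/-- The regularization weight `c + ∑_{s < t} c (growth s)^{-1/2}`. -/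
def adaptiveWeight (c h : ℝ) (H : ℕ → ℝ) (t : ℕ) : ℝ :=
  c + ∑ s ∈ Finset.Ico 1 t, c / Real.sqrt (growth h H s)

lemma growth_succ (n : ℕ) : growth h H (n + 1) = growth h H n + h⁻¹ * H (n + 1) := by
  rw [growth, growth, Finset.sum_Icc_succ_top (by omega)]; ring

lemma growth_mono (hh : 0 < h) (hH : ∀ t, 0 ≤ H t) : Monotone (growth h H) :=
  monotone_nat_of_le_succ fun n => by
    rw [growth_succ]
    have := mul_nonneg (inv_pos.2 hh).le (hH (n + 1))
    linarith

lemma one_le_growth (hh : 0 < h) (hH : ∀ t, 0 ≤ H t) (n : ℕ) : 1 ≤ growth h H n := by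
  have := growth_mono hh hH (Nat.zero_le n)
  simpa [growth] using this

lemma adaptiveWeight_ge (hh : 0 < h) (hc : 0 ≤ c) (hH : ∀ t, 0 ≤ H t) {t T : ℕ} (ht : 1 ≤ t)
    (htT : t ≤ T) : c / Real.sqrt (growth h H T) * t ≤ adaptiveWeight c h H t := by
  have hT := one_le_growth hh hH T
  have h1 : c / Real.sqrt (growth h H T) ≤ c :=
    div_le_self hc (Real.one_le_sqrt.2 hT)
  have h2 : ∑ _s ∈ Finset.Ico 1 t, c / Real.sqrt (growth h H T) ≤
      ∑ s ∈ Finset.Ico 1 t, c / Real.sqrt (growth h H s) := by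
    refine Finset.sum_le_sum fun s hs => ?_
    have := one_le_growth hh hH s
    have hs' := growth_mono hh hH (show s ≤ T by have := Finset.mem_Ico.1 hs; omega)
    gcongr
  rw [Finset.sum_const, Nat.card_Ico, nsmul_eq_mul, Nat.cast_sub ht, Nat.cast_one] at h2
  rw [adaptiveWeight]
  linarith

lemma sqrt_le_adaptiveWeight (hh : 0 < h) (hc : 0 ≤ c) (hH : ∀ t, 0 ≤ H t) (hHm : ∀ t, H t ≤ Hm)
    {t : ℕ} (ht : 1 ≤ t) :
    c / Real.sqrt (1 + Hm / h) * Real.sqrt t ≤ adaptiveWeight c h H t := by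
  have ht0 : (0 : ℝ) < t := by exact_mod_cast ht
  have hHm0 : 0 ≤ Hm / h := div_nonneg ((hH 0).trans (hHm 0)) hh.le
  have hgrow : growth h H t ≤ t * (1 + Hm / h) := by
    have h1 : ∑ r ∈ Finset.Icc 1 t, H r ≤ t * Hm := by
      refine (Finset.sum_le_sum fun r _ => hHm r).trans ?_
      rw [Finset.sum_const, Nat.card_Icc, nsmul_eq_mul]; simp
    have h2 : h⁻¹ * ∑ r ∈ Finset.Icc 1 t, H r ≤ h⁻¹ * (t * Hm) :=
      mul_le_mul_of_nonneg_left h1 (inv_pos.2 hh).le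
    have h3 : (1 : ℝ) ≤ t := by exact_mod_cast ht
    rw [growth]
    calc _ ≤ t + h⁻¹ * (t * Hm) := by linarith
      _ = _ := by ring
  refine le_trans ?_ (adaptiveWeight_ge hh hc hH ht le_rfl)
  have h1 := one_le_growth hh hH t
  calc c / Real.sqrt (1 + Hm / h) * Real.sqrt t
      = c / (Real.sqrt t * Real.sqrt (1 + Hm / h)) * t := by
        have e : (t : ℝ) = Real.sqrt t * Real.sqrt t := (Real.mul_self_sqrt ht0.le).symm
        have hs : Real.sqrt t ≠ 0 := (Real.sqrt_pos.2 ht0).ne'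
        have hs' : Real.sqrt (1 + Hm / h) ≠ 0 := (Real.sqrt_pos.2 (by linarith)).ne'
        rw [div_mul_eq_mul_div, div_mul_eq_mul_div, div_eq_div_iff hs' (mul_ne_zero hs hs')]
        nth_rw 3 [e]
        ring
    _ ≤ _ := by
        rw [← Real.sqrt_mul ht0.le]
        gcongr

lemma sum_one_div_le (T : ℕ) : ∑ t ∈ Finset.Icc 1 T, 1 / (t : ℝ) ≤ 1 + Real.log T := by
  have h := harmonic_le_one_add_log T
  rw [harmonic_eq_sum_Icc] at h
  push_cast at h
  simpa [one_div] using h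

lemma sum_one_div_sqrt_le (T : ℕ) : ∑ t ∈ Finset.Icc 1 T, 1 / Real.sqrt t ≤ 2 * Real.sqrt T := by
  induction T with
  | zero => simp
  | succ n ih =>
    rw [Finset.sum_Icc_succ_top (by omega)]
    have hb : 0 < Real.sqrt ((n + 1 : ℕ) : ℝ) := Real.sqrt_pos.2 (by positivity)
    have e1 := Real.sq_sqrt (show (0 : ℝ) ≤ ((n + 1 : ℕ) : ℝ) by positivity)
    have e2 := Real.sq_sqrt (show (0 : ℝ) ≤ (n : ℝ) by positivity)
    have key : 1 / Real.sqrt ((n + 1 : ℕ) : ℝ) ≤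
        2 * (Real.sqrt ((n + 1 : ℕ) : ℝ) - Real.sqrt n) := by
      rw [div_le_iff₀ hb]
      push_cast at *
      nlinarith [sq_nonneg (Real.sqrt ((n : ℝ) + 1) - Real.sqrt n)]
    linarith

/-- Sum of the learning rates, in terms of the final growth factor. -/
lemma sum_rate_le (hh : 0 < h) (hc : 0 < c) (hH : ∀ t, 0 ≤ H t) {T : ℕ} {β : ℕ → ℝ}
    (hβ : ∀ t ∈ Finset.Icc 1 T, adaptiveWeight c h H t ≤ β t) :
    ∑ t ∈ Finset.Icc 1 T, 1 / β t ≤ Real.sqrt (growth h H T) / c * (1 + Real.log T) := by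
  have hT : 0 < Real.sqrt (growth h H T) :=
    Real.sqrt_pos.2 (by linarith [one_le_growth hh hH T])
  refine le_trans ?_ (mul_le_mul_of_nonneg_left (sum_one_div_le T) (by positivity))
  rw [Finset.mul_sum]
  refine Finset.sum_le_sum fun t ht => ?_
  have hβt := hβ t ht
  rw [Finset.mem_Icc] at ht
  have ht0 : (0 : ℝ) < t := by exact_mod_cast ht.1
  have := (adaptiveWeight_ge hh hc.le hH ht.1 ht.2).trans hβt
  calc 1 / β t ≤ 1 / (c / Real.sqrt (growth h H T) * t) :=
        one_div_le_one_div_of_le (by positivity) this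
    _ = _ := by field_simp

/-- Sum of the learning rates, in terms of the horizon. -/
lemma sum_rate_le_sqrt (hh : 0 < h) (hc : 0 < c) (hH : ∀ t, 0 ≤ H t) (hHm : ∀ t, H t ≤ Hm) {T : ℕ}
    {β : ℕ → ℝ} (hβ : ∀ t ∈ Finset.Icc 1 T, adaptiveWeight c h H t ≤ β t) :
    ∑ t ∈ Finset.Icc 1 T, 1 / β t ≤ Real.sqrt (1 + Hm / h) / c * (2 * Real.sqrt T) := by
  have hHm0 : 0 ≤ Hm / h := div_nonneg ((hH 0).trans (hHm 0)) hh.le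
  have hT : 0 < Real.sqrt (1 + Hm / h) := Real.sqrt_pos.2 (by linarith)
  refine le_trans ?_ (mul_le_mul_of_nonneg_left (sum_one_div_sqrt_le T) (by positivity))
  rw [Finset.mul_sum]
  refine Finset.sum_le_sum fun t ht => ?_
  have hβt := hβ t ht
  rw [Finset.mem_Icc] at ht
  have ht0 : (0 : ℝ) < t := by exact_mod_cast ht.1
  have := (sqrt_le_adaptiveWeight hh hc.le hH hHm ht.1).trans hβt
  calc 1 / β t ≤ 1 / (c / Real.sqrt (1 + Hm / h) * Real.sqrt t) :=
        one_div_le_one_div_of_le (by positivity) this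
    _ = _ := by field_simp

/-- A discrete form of `∫ dy / √y = 2 √y`. The denominators lag one round behind the numerators, which
costs the telescoping term `Hm (1/√(growth t) - 1/√(growth (t+1)))`. -/
lemma sum_div_sqrt_growth_le (hh : 0 < h) (hH : ∀ t, 0 ≤ H t) (hHm : ∀ t, H t ≤ Hm) {T : ℕ}
    (hT : 1 ≤ T) :
    ∑ t ∈ Finset.Ico 1 T, H (t + 1) / Real.sqrt (growth h H t) ≤
      2 * h * Real.sqrt (growth h H T) + Hm * (1 - 1 / Real.sqrt (growth h H T)) := by
  have hHm0 : 0 ≤ Hm := (hH 0).trans (hHm 0)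
  have hs : ∀ n, 1 ≤ Real.sqrt (growth h H n) := fun n =>
    Real.one_le_sqrt.2 (one_le_growth hh hH n)
  induction T, hT using Nat.le_induction with
  | base =>
    have h1 := hs 1
    have : 1 / Real.sqrt (growth h H 1) ≤ 1 := by rw [div_le_one (by linarith)]; exact h1
    rw [Finset.Ico_self, Finset.sum_empty]
    have := mul_nonneg hHm0 (sub_nonneg.2 this)
    positivity
  | succ n hn ih =>
    rw [Finset.sum_Ico_succ_top hn]
    set a := Real.sqrt (growth h H n) with ha
    set b := Real.sqrt (growth h H (n + 1)) with hb
    have ha1 : 1 ≤ a := hs n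
    have hb1 : 1 ≤ b := hs (n + 1)
    have hab : a ≤ b := Real.sqrt_le_sqrt (growth_mono hh hH n.le_succ)
    have e : H (n + 1) = h * (b ^ 2 - a ^ 2) := by
      rw [ha, hb, Real.sq_sqrt (by linarith [one_le_growth hh hH (n + 1)]),
        Real.sq_sqrt (by linarith [one_le_growth hh hH n]), growth_succ]
      field_simp
      ring
    have h1 : H (n + 1) / b ≤ 2 * h * (b - a) := by
      rw [div_le_iff₀ (by linarith), e]
      nlinarith [mul_nonneg hh.le (sq_nonneg (b - a))]
    have h2 : H (n + 1) * (1 / a - 1 / b) ≤ Hm * (1 / a - 1 / b) :=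
      mul_le_mul_of_nonneg_right (hHm _)
        (sub_nonneg.2 (one_div_le_one_div_of_le (by linarith) hab))
    have h3 : H (n + 1) / a = H (n + 1) / b + H (n + 1) * (1 / a - 1 / b) := by ring
    rw [h3]
    linarith

/-- The penalty terms of FTRL with weights `max e (adaptiveWeight t)`. The maximum increases by no
more than the adaptive weight does. -/
lemma penalty_le (hh : 0 < h) (hc : 0 ≤ c) (hH : ∀ t, 0 ≤ H t) (hHm : ∀ t, H t ≤ Hm) {T : ℕ}
    (hT : 1 ≤ T) {e : ℝ} (he : 0 ≤ e) :
    max e (adaptiveWeight c h H 1) * H 1 + ∑ t ∈ Finset.Ico 1 T,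
      (max e (adaptiveWeight c h H (t + 1)) - max e (adaptiveWeight c h H t)) * H (t + 1) ≤
    (e + 2 * c) * Hm + 2 * (c * h) * Real.sqrt (growth h H T) := by
  have hHm0 : 0 ≤ Hm := (hH 0).trans (hHm 0)
  have h1 : max e (adaptiveWeight c h H 1) * H 1 ≤ (e + c) * Hm := by
    have : max e (adaptiveWeight c h H 1) ≤ e + c := by
      simp only [adaptiveWeight, Finset.Ico_self, Finset.sum_empty, add_zero]
      exact max_le (by linarith) (by linarith)
    exact mul_le_mul this (hHm 1) (hH 1) (by linarith)
  have h2 : ∑ t ∈ Finset.Ico 1 T, (max e (adaptiveWeight c h H (t + 1)) -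
      max e (adaptiveWeight c h H t)) * H (t + 1) ≤
      c * ∑ t ∈ Finset.Ico 1 T, H (t + 1) / Real.sqrt (growth h H t) := by
    rw [Finset.mul_sum]
    refine Finset.sum_le_sum fun t ht => ?_
    have hd : 0 ≤ c / Real.sqrt (growth h H t) := by positivity
    have e1 : adaptiveWeight c h H (t + 1) =
        adaptiveWeight c h H t + c / Real.sqrt (growth h H t) := by
      rw [adaptiveWeight, adaptiveWeight, Finset.sum_Ico_succ_top (Finset.mem_Ico.1 ht).1]; ring
    have e2 : max e (adaptiveWeight c h H (t + 1)) - max e (adaptiveWeight c h H t) ≤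
        c / Real.sqrt (growth h H t) := by
      rw [e1, sub_le_iff_le_add]
      refine max_le ?_ ?_
      · have := le_max_left e (adaptiveWeight c h H t); linarith
      · have := le_max_right e (adaptiveWeight c h H t); linarith
    calc _ ≤ c / Real.sqrt (growth h H t) * H (t + 1) := mul_le_mul_of_nonneg_right e2 (hH _)
      _ = _ := by ring
  have h3 := sum_div_sqrt_growth_le hh hH hHm hT
  have h4 : Hm * (1 - 1 / Real.sqrt (growth h H T)) ≤ Hm := by
    have : 0 ≤ 1 / Real.sqrt (growth h H T) := by positivity
    nlinarith
  have h5 := mul_le_mul_of_nonneg_left (h3.trans (add_le_add_right h4 _)) hc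
  nlinarith

end Rates

/-! ### The regret in terms of the accumulated entropy -/

section Constants

variable {K m d T : ℕ} {lam : ℝ}

/-- The entropy scale `m ln (K/m)` is bounded away from zero, since `K ≥ m + 1`. -/
lemma half_le_mul_log (hm : 1 ≤ m) (hmK : m < K) : 1 / 2 ≤ m * Real.log ((K : ℝ) / m) := by
  have h1 : (1 : ℝ) ≤ m := by exact_mod_cast hm
  have h2 : (m : ℝ) + 1 ≤ K := by exact_mod_cast hmK
  have hK0 : (0 : ℝ) < K := by linarith
  have h3 : 1 - ((K : ℝ) / m)⁻¹ ≤ Real.log ((K : ℝ) / m) :=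
    Real.one_sub_inv_le_log_of_pos (by positivity)
  have h4 : 1 / 2 ≤ m * (1 - ((K : ℝ) / m)⁻¹) := by
    have e : (m : ℝ) * (1 - ((K : ℝ) / m)⁻¹) = m * (K - m) / K := by
      rw [inv_div]; field_simp
    rw [e, div_le_div_iff₀ two_pos (by linarith)]
    nlinarith
  exact h4.trans (mul_le_mul_of_nonneg_left h3 (by linarith))

lemma half_le_log (hT : 2 ≤ T) : 1 / 2 ≤ Real.log T := by
  have h1 : Real.log 2 ≤ Real.log T := Real.log_le_log two_pos (by exact_mod_cast hT)
  have := Real.log_two_gt_d9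
  linarith

lemma kappa_sq (hlam : 0 < lam) :
    kappa K d T lam ^ 2 = K * d * Real.log T + K * Real.log T ^ 2 / lam := by
  have := Real.log_natCast_nonneg T
  exact Real.sq_sqrt (by positivity)

lemma mul_log_le_kappa_sq (hlam : 0 < lam) : K * d * Real.log T ≤ kappa K d T lam ^ 2 := by
  rw [kappa_sq hlam]
  have : 0 ≤ K * Real.log T ^ 2 / lam := by positivity
  linarith

lemma log_sq_div_le_kappa_sq (hlam : 0 < lam) :
    K * Real.log T ^ 2 / lam ≤ kappa K d T lam ^ 2 := by
  rw [kappa_sq hlam]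
  have := Real.log_natCast_nonneg T
  have : 0 ≤ K * d * Real.log T := by positivity
  linarith

lemma one_le_kappa (hlam : 0 < lam) (hK : 2 ≤ K) (hd : 1 ≤ d) (hT : 2 ≤ T) :
    1 ≤ kappa K d T lam := by
  have h1 := mul_log_le_kappa_sq (K := K) (d := d) (T := T) hlam
  have h2 := half_le_log hT
  have h3 : (2 : ℝ) * 1 ≤ K * d :=
    mul_le_mul (by exact_mod_cast hK) (by exact_mod_cast hd) zero_le_one (by positivity)
  have h4 : 0 ≤ kappa K d T lam := Real.sqrt_nonneg _
  nlinarith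

lemma c₁_eq (hlam : 0 < lam) :
    c₁ K m d T lam = kappa K d T lam / Real.sqrt (m * Real.log (K / m)) := by
  have h2 := Real.log_natCast_nonneg T
  rw [c₁, kappa, ← Real.sqrt_div (by positivity)]
  congr 2
  ring

end Constants

namespace Play

variable {K m d : ℕ} {Ω : Type*} (G : Play K m d Ω)

/-- The entropy of the FTRL iterate played in round `t ≤ T`; zero for other values of `t`. -/
def playedEntropy (T : ℕ) (ω : Ω) (t : ℕ) : ℝ :=
  if t ∈ Finset.Icc 1 T then entropy (G.meanAction t ω (G.X t 0 ω)) else 0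

/-- The accumulated entropy of the FTRL iterates. -/
def totalEntropy (T : ℕ) (ω : Ω) : ℝ :=
  ∑ t ∈ Finset.Icc 1 T, entropy (G.meanAction t ω (G.X t 0 ω))

variable {G} {T : ℕ}

lemma betaPrime_eq (lam : ℝ) {t : ℕ} (ht : t ≤ T) (ω : Ω) :
    G.betaPrime T lam t ω =
      adaptiveWeight (c₁ K m d T lam) (m * Real.log (K / m)) (G.playedEntropy T ω) t := by
  unfold betaPrime adaptiveWeight growth
  congr 1
  refine Finset.sum_congr rfl fun s hs => ?_
  have e : ∑ r ∈ Finset.Icc 1 s, entropy (G.meanAction r ω (G.X r 0 ω)) =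
      ∑ r ∈ Finset.Icc 1 s, G.playedEntropy T ω r := by
    refine Finset.sum_congr rfl fun r hr => ?_
    rw [playedEntropy, if_pos]
    rw [Finset.mem_Ico] at hs
    rw [Finset.mem_Icc] at hr ⊢
    omega
  rw [e]

lemma growth_eq (h : ℝ) (ω : Ω) :
    growth h (G.playedEntropy T ω) T = 1 + h⁻¹ * G.totalEntropy T ω := by
  unfold growth totalEntropy
  congr 2
  exact Finset.sum_congr rfl fun r hr => by rw [playedEntropy, if_pos hr]

lemma beta_eq (lam : ℝ) {t : ℕ} (ht : t ≤ T) (ω : Ω) :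
    G.beta T lam t ω = max (max 2 (c₂ K lam * Real.log T))
      (adaptiveWeight (c₁ K m d T lam) (m * Real.log (K / m)) (G.playedEntropy T ω) t) := by
  rw [beta, betaPrime_eq lam ht, max_assoc]

variable [mΩ : MeasurableSpace Ω] {P : Measure Ω} {𝒳 : Set (Ctx d)} {D : Measure (Ctx d)}

lemma IsRun.playedEntropy_nonneg (h : G.IsRun P 𝒳 D T) (ω : Ω) (t : ℕ) :
    0 ≤ G.playedEntropy T ω t := by
  unfold playedEntropy
  split_ifs with ht
  · exact h.entropy_nonneg (by simpa using ht) ω _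
  · exact le_rfl

lemma IsRun.playedEntropy_le (h : G.IsRun P 𝒳 D T) (hm : 1 ≤ m) (hmK : m ≤ K) (ω : Ω) (t : ℕ) :
    G.playedEntropy T ω t ≤ m * Real.log (K / m) + m := by
  unfold playedEntropy
  split_ifs with ht
  · exact entropy_le hm hmK (h.meanAction_mem (by simpa using ht) ω _)
  · have := log_ratio_nonneg hm hmK
    positivity

lemma IsRun.totalEntropy_nonneg (h : G.IsRun P 𝒳 D T) (ω : Ω) : 0 ≤ G.totalEntropy T ω :=
  Finset.sum_nonneg fun t ht => h.entropy_nonneg (by simpa using ht) ω _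

lemma IsRun.totalEntropy_le (h : G.IsRun P 𝒳 D T) (hm : 1 ≤ m) (hmK : m ≤ K) (ω : Ω) :
    G.totalEntropy T ω ≤ T * (m * Real.log (K / m) + m) := by
  refine (Finset.sum_le_card_nsmul _ _ (m * Real.log (K / m) + m) fun t ht =>
    entropy_le hm hmK (h.meanAction_mem (by simpa using ht) ω _)).trans ?_
  rw [Nat.card_Icc, nsmul_eq_mul]; simp

lemma IsRun.eval_joint (h : G.IsRun P 𝒳 D T) {t : ℕ} (ht : t ∈ Set.Icc 1 T)
    {Φ : Ω → Ctx d → ℝ} (hΦ : JointBdd P (G.past T t) Φ) :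
    BddMeas P mΩ (fun ω => Φ ω (G.X t 0 ω)) :=
  hΦ.eval (h.past_le (by have := ht.2; omega)) (h.measurable_X t ht 0) (h.X_norm ht 0)

lemma IsRun.entropy_bdd (h : G.IsRun P 𝒳 D T) (hm : 1 ≤ m) (hmK : m ≤ K) {t : ℕ}
    (ht : t ∈ Set.Icc 1 T) : BddMeas P mΩ (fun ω => entropy (G.meanAction t ω (G.X t 0 ω))) :=
  h.eval_joint ht (h.entropy_joint hm hmK ht)

lemma IsRun.totalEntropy_bdd (h : G.IsRun P 𝒳 D T) (hm : 1 ≤ m) (hmK : m ≤ K) :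
    BddMeas P mΩ (G.totalEntropy T) :=
  BddMeas.sum _ fun t ht => h.entropy_bdd hm hmK (by simpa using ht)

/-- The expectation of `√(m ln (K/m) + ∑ H)`, the quantity in which the regret is expressed. -/
def rootEntropy (G : Play K m d Ω) (P : Measure Ω) (T : ℕ) : ℝ :=
  ∫ ω, Real.sqrt (m * Real.log (K / m) + G.totalEntropy T ω) ∂P

lemma IsRun.integrable_rootEntropy (h : G.IsRun P 𝒳 D T) (hm : 1 ≤ m) (hmK : m ≤ K) :
    Integrable (fun ω => Real.sqrt (m * Real.log (K / m) + G.totalEntropy T ω)) P := by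
  have := h.isProb
  have hZ := h.totalEntropy_bdd hm hmK
  refine (BddMeas.of_le (P := P) (𝓕 := mΩ) (Measurable.sqrt (measurable_const.add hZ.meas))
    (C := Real.sqrt (m * Real.log (K / m) + T * (m * Real.log (K / m) + m))) fun ω => ?_).integrable
    le_rfl
  rw [abs_of_nonneg (Real.sqrt_nonneg _)]
  exact Real.sqrt_le_sqrt (add_le_add_right (h.totalEntropy_le hm hmK ω) _)

/-- Jensen's inequality for the square root. -/
lemma IsRun.rootEntropy_le (h : G.IsRun P 𝒳 D T) (hm : 1 ≤ m) (hmK : m < K) :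
    G.rootEntropy P T ≤ Real.sqrt (m * Real.log (K / m) + ∫ ω, G.totalEntropy T ω ∂P) := by
  have := h.isProb
  have hh := half_le_mul_log hm hmK
  set v := (m : ℝ) * Real.log (K / m) with hv
  have hEZ : 0 ≤ ∫ ω, G.totalEntropy T ω ∂P := integral_nonneg fun ω => h.totalEntropy_nonneg ω
  set s := Real.sqrt (v + ∫ ω, G.totalEntropy T ω ∂P) with hs
  have hs0 : 0 < s := Real.sqrt_pos.2 (by linarith)
  have hZ : Integrable (fun ω => v + G.totalEntropy T ω) P :=
    (integrable_const _).add ((h.totalEntropy_bdd hm hmK.le).integrable le_rfl)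
  have h1 : G.rootEntropy P T ≤ ∫ ω, ((v + G.totalEntropy T ω) * (1 / (2 * s)) + s / 2) ∂P := by
    refine integral_mono (h.integrable_rootEntropy hm hmK.le)
      ((hZ.mul_const _).add (integrable_const _)) fun ω => ?_
    have hy : 0 ≤ v + G.totalEntropy T ω := by linarith [h.totalEntropy_nonneg ω]
    have e : (v + G.totalEntropy T ω) * (1 / (2 * s)) + s / 2 =
        (v + G.totalEntropy T ω + s ^ 2) / (2 * s) := by field_simp
    simp only [e]
    rw [le_div_iff₀ (by positivity)]
    nlinarith [sq_nonneg (Real.sqrt (v + G.totalEntropy T ω) - s), Real.sq_sqrt hy]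
  rw [integral_add (hZ.mul_const _) (integrable_const _), integral_mul_const,
    integral_add (integrable_const _) ((h.totalEntropy_bdd hm hmK.le).integrable le_rfl),
    integral_const, integral_const, probReal_univ, one_smul, one_smul] at h1
  have h2 : v + ∫ ω, G.totalEntropy T ω ∂P = s ^ 2 := (Real.sq_sqrt (by linarith)).symm
  rw [h2] at h1
  have h3 : s ^ 2 * (1 / (2 * s)) + s / 2 = s := by field_simp; ring
  linarith

omit mΩ in
lemma sqrt_growth_eq (hm : 1 ≤ m) (hmK : m < K) (ω : Ω) :
    Real.sqrt (growth (m * Real.log (K / m)) (G.playedEntropy T ω) T) =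
      Real.sqrt (m * Real.log (K / m) + G.totalEntropy T ω) /
        Real.sqrt (m * Real.log (K / m)) := by
  have hh := half_le_mul_log hm hmK
  rw [growth_eq, ← Real.sqrt_div' _ (by linarith), add_div, div_self (by linarith),
    div_eq_inv_mul (G.totalEntropy T ω)]

lemma IsRun.integrable_eta (h : G.IsRun P 𝒳 D T) (hm : 1 ≤ m) (hmK : m ≤ K) (lam : ℝ) {t : ℕ}
    (ht : t ∈ Finset.Icc 1 T) : Integrable (G.eta T lam t) P := by
  have := h.isProb
  have h1 := (Finset.mem_Icc.1 ht).2
  exact (h.eta_bdd hm hmK lam (by omega)).integrable (h.past_le (by omega))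

/-- The learning rates in terms of the accumulated entropy, for the stochastic regimes. -/
lemma IsRun.sum_eta_le (h : G.IsRun P 𝒳 D T) (hm : 1 ≤ m) (hmK : m < K) (hd : 1 ≤ d) (hT : 2 ≤ T)
    {lam : ℝ} (hlam : 0 < lam) :
    ∑ t ∈ Finset.Icc 1 T, ∫ ω, G.eta T lam t ω ∂P ≤
      3 * Real.log T * G.rootEntropy P T / kappa K d T lam := by
  have := h.isProb
  have hh := half_le_mul_log hm hmK
  have hκ := one_le_kappa (K := K) hlam (by omega) hd hT
  have hs : 0 < Real.sqrt (m * Real.log (K / m)) := Real.sqrt_pos.2 (by linarith)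
  have hl := half_le_log hT
  have hc : 0 < c₁ K m d T lam := by rw [c₁_eq hlam]; positivity
  rw [← integral_finsetSum _ fun t ht => h.integrable_eta hm hmK.le lam ht]
  calc _ ≤ ∫ ω, Real.sqrt (m * Real.log (K / m) + G.totalEntropy T ω) *
        ((1 + Real.log T) / kappa K d T lam) ∂P := by
        refine integral_mono (integrable_finsetSum _ fun t ht => h.integrable_eta hm hmK.le lam ht)
          ((h.integrable_rootEntropy hm hmK.le).mul_const _) fun ω => ?_
        refine (sum_rate_le (h := m * Real.log (K / m)) (by linarith) hc (h.playedEntropy_nonneg ω) (T := T) fun t ht => ?_).trans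
          (le_of_eq ?_)
        · rw [← betaPrime_eq lam (Finset.mem_Icc.1 ht).2]
          exact (le_max_right _ _).trans (le_max_right _ _)
        · rw [sqrt_growth_eq hm hmK, c₁_eq hlam]
          field_simp
    _ = (1 + Real.log T) * G.rootEntropy P T / kappa K d T lam := by
        rw [integral_mul_const, rootEntropy]; ring
    _ ≤ _ := by
        have : 0 ≤ G.rootEntropy P T := integral_nonneg fun ω => Real.sqrt_nonneg _
        gcongr
        linarith

/-- The learning rates in terms of the horizon, for the adversarial regime. Here no logarithm of `T` is
lost. -/
lemma IsRun.sum_eta_le_sqrt (h : G.IsRun P 𝒳 D T) (hm : 1 ≤ m) (hmK : m < K) (hd : 1 ≤ d)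
    (hT : 2 ≤ T) {lam : ℝ} (hlam : 0 < lam) :
    ∑ t ∈ Finset.Icc 1 T, ∫ ω, G.eta T lam t ω ∂P ≤
      4 * Real.sqrt m * Real.sqrt (m * Real.log (K / m)) * Real.sqrt T / kappa K d T lam := by
  have := h.isProb
  have hh := half_le_mul_log hm hmK
  have hκ := one_le_kappa (K := K) hlam (by omega) hd hT
  have hs : 0 < Real.sqrt (m * Real.log (K / m)) := Real.sqrt_pos.2 (by linarith)
  have hc : 0 < c₁ K m d T lam := by rw [c₁_eq hlam]; positivity
  have hm1 : (1 : ℝ) ≤ m := by exact_mod_cast hm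
  rw [← integral_finsetSum _ fun t ht => h.integrable_eta hm hmK.le lam ht]
  set v := (m : ℝ) * Real.log (K / m) with hv
  have hsq : Real.sqrt (1 + (v + m) / v) ≤ 2 * Real.sqrt m := by
    rw [Real.sqrt_le_left (by positivity), mul_pow, Real.sq_sqrt (by positivity)]
    have : (v + m) / v ≤ 3 * m := by
      rw [div_le_iff₀ (by linarith)]
      nlinarith
    linarith
  calc _ ≤ ∫ _ω : Ω, Real.sqrt (1 + (v + m) / v) / c₁ K m d T lam * (2 * Real.sqrt T) ∂P := by
        refine integral_mono (integrable_finsetSum _ fun t ht => h.integrable_eta hm hmK.le lam ht)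
          (integrable_const _) fun ω => ?_
        refine sum_rate_le_sqrt (h := v) (by linarith) hc (h.playedEntropy_nonneg ω)
          (h.playedEntropy_le hm hmK.le ω) (T := T) fun t ht => ?_
        rw [hv, ← betaPrime_eq lam (Finset.mem_Icc.1 ht).2]
        exact (le_max_right _ _).trans (le_max_right _ _)
    _ = Real.sqrt (1 + (v + m) / v) * Real.sqrt v * 2 * Real.sqrt T / kappa K d T lam := by
        rw [integral_const, probReal_univ, one_smul, c₁_eq hlam, ← hv]
        field_simp
    _ ≤ 2 * Real.sqrt m * Real.sqrt v * 2 * Real.sqrt T / kappa K d T lam := by gcongr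
    _ = _ := by ring

/-- The expected penalty terms of FTRL, in terms of the accumulated entropy. -/
lemma IsRun.penalty_le (h : G.IsRun P 𝒳 D T) (hm : 1 ≤ m) (hmK : m < K) (hT : 2 ≤ T)
    {lam : ℝ} (hlam : 0 < lam) :
    ∫ ω, G.beta T lam 1 ω * entropy (G.meanAction 1 ω (G.X 1 0 ω)) ∂P +
      ∑ t ∈ Finset.Ico 1 T, ∫ ω, (G.beta T lam (t + 1) ω - G.beta T lam t ω) *
        entropy (G.meanAction (t + 1) ω (G.X (t + 1) 0 ω)) ∂P ≤
    (2 + c₂ K lam * Real.log T + 2 * c₁ K m d T lam) * (m * Real.log (K / m) + m) +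
      2 * kappa K d T lam * G.rootEntropy P T := by
  have := h.isProb
  have hh := half_le_mul_log hm hmK
  have hs : 0 < Real.sqrt (m * Real.log (K / m)) := Real.sqrt_pos.2 (by linarith)
  have hc := c₁_nonneg K m d T lam
  have hl := half_le_log hT
  have hc₂ : 0 ≤ c₂ K lam * Real.log T := by unfold c₂; positivity
  have hS : ∀ t, t ∈ Finset.Icc 1 T → t ∈ Set.Icc 1 T := fun t ht => by simpa using ht
  have hβ : ∀ t, t ∈ Finset.Icc 1 T → BddMeas P mΩ (G.beta T lam t) := fun t ht =>
    (h.beta_bdd hm hmK.le lam (Finset.mem_Icc.1 ht).2).mono (h.past_le (by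
      have := (Finset.mem_Icc.1 ht).2; omega))
  have h1T : 1 ∈ Finset.Icc 1 T := by simp; omega
  have hst : ∀ t ∈ Finset.Ico 1 T, t ∈ Finset.Icc 1 T ∧ t + 1 ∈ Finset.Icc 1 T := fun t ht => by
    rw [Finset.mem_Ico] at ht
    simp only [Finset.mem_Icc]; omega
  have i1 : Integrable (fun ω => G.beta T lam 1 ω * entropy (G.meanAction 1 ω (G.X 1 0 ω))) P :=
    ((hβ 1 h1T).mul (h.entropy_bdd hm hmK.le (hS 1 h1T))).integrable le_rfl
  have i2 : ∀ t ∈ Finset.Ico 1 T, Integrable (fun ω => (G.beta T lam (t + 1) ω - G.beta T lam t ω) *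
        entropy (G.meanAction (t + 1) ω (G.X (t + 1) 0 ω))) P := fun t ht =>
    (((hβ _ (hst t ht).2).sub (hβ _ (hst t ht).1)).mul
      (h.entropy_bdd hm hmK.le (hS _ (hst t ht).2))).integrable le_rfl
  rw [← integral_finsetSum _ i2, ← integral_add i1 (integrable_finsetSum _ i2)]
  have i3 := (h.integrable_rootEntropy hm hmK.le).const_mul (2 * kappa K d T lam)
  calc _ ≤ ∫ ω, ((2 + c₂ K lam * Real.log T + 2 * c₁ K m d T lam) * (m * Real.log (K / m) + m) +
        2 * kappa K d T lam * Real.sqrt (m * Real.log (K / m) + G.totalEntropy T ω)) ∂P := by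
        refine integral_mono (i1.add (integrable_finsetSum _ i2)) ((integrable_const _).add i3)
          fun ω => ?_
        have key := CombBandit.penalty_le (h := m * Real.log (K / m)) (by linarith) hc
          (h.playedEntropy_nonneg ω) (h.playedEntropy_le hm hmK.le ω) (T := T) (by omega)
          (e := max 2 (c₂ K lam * Real.log T)) (le_max_of_le_left two_pos.le)
        have e1 : c₁ K m d T lam * (m * Real.log (K / m)) *
            Real.sqrt (growth (m * Real.log (K / m)) (G.playedEntropy T ω) T) =
            kappa K d T lam * Real.sqrt (m * Real.log (K / m) + G.totalEntropy T ω) := by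
          rw [sqrt_growth_eq hm hmK, c₁_eq hlam]
          have := Real.mul_self_sqrt (show 0 ≤ (m : ℝ) * Real.log (K / m) by linarith)
          field_simp
          rw [sq, this]
          ring
        have e2 : G.beta T lam 1 ω * entropy (G.meanAction 1 ω (G.X 1 0 ω)) =
            G.beta T lam 1 ω * G.playedEntropy T ω 1 := by rw [playedEntropy, if_pos h1T]
        have e3 : ∑ t ∈ Finset.Ico 1 T, (G.beta T lam (t + 1) ω - G.beta T lam t ω) *
            entropy (G.meanAction (t + 1) ω (G.X (t + 1) 0 ω)) =
            ∑ t ∈ Finset.Ico 1 T, (max (max 2 (c₂ K lam * Real.log T))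
              (adaptiveWeight (c₁ K m d T lam) (m * Real.log (K / m)) (G.playedEntropy T ω) (t + 1)) -
              max (max 2 (c₂ K lam * Real.log T))
              (adaptiveWeight (c₁ K m d T lam) (m * Real.log (K / m)) (G.playedEntropy T ω) t)) *
            G.playedEntropy T ω (t + 1) := by
          refine Finset.sum_congr rfl fun t ht => ?_
          rw [playedEntropy, if_pos (hst t ht).2, beta_eq lam (Finset.mem_Icc.1 (hst t ht).2).2,
            beta_eq lam (Finset.mem_Icc.1 (hst t ht).1).2]
        have h4 : (max 2 (c₂ K lam * Real.log T) + 2 * c₁ K m d T lam) *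
            (m * Real.log (K / m) + m) ≤
            (2 + c₂ K lam * Real.log T + 2 * c₁ K m d T lam) * (m * Real.log (K / m) + m) := by
          gcongr
          exact max_le (by linarith) (by linarith)
        rw [← beta_eq lam (by omega : 1 ≤ T), mul_assoc 2, e1] at key
        beta_reduce
        rw [e2, e3]
        linarith
    _ = _ := by
        rw [integral_add (integrable_const _) i3, integral_const, probReal_univ, one_smul,
          integral_const_mul, rootEntropy]

/-- The regret of the FTRL iterates, without the exploration. -/
def ftrlRegret (G : Play K m d Ω) (P : Measure Ω) (T : ℕ) (u : Ctx d → Action K m) : ℝ :=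
  ∑ t ∈ Finset.Icc 1 T, ∑ k, ∫ ω, (G.meanAction t ω (G.X t 0 ω) k - (u (G.X t 0 ω)).vec k) *
    inner ℝ (G.X t 0 ω) (G.θ t k ω) ∂P

/-- The part of the regret bound that does not grow with the accumulated entropy. -/
def overhead (K m d T : ℕ) (lam : ℝ) : ℝ :=
  4 * m + (2 + c₂ K lam * Real.log T + 2 * c₁ K m d T lam) * (m * Real.log (K / m) + m)

/-- Regret of the FTRL iterates: `c₁` balances the second-order terms against the penalty terms. -/
theorem IsRun.ftrlRegret_le (h : G.IsRun P 𝒳 D T) (hm : 1 ≤ m) (hmK : m < K) (hd : 1 ≤ d)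
    (hT : 2 ≤ T) {u : Ctx d → Action K m} (hu : Measurable u) :
    G.ftrlRegret P T u ≤ overhead K m d T (lambdaMin (secondMoment D)) +
      10 * kappa K d T (lambdaMin (secondMoment D)) * G.rootEntropy P T := by
  obtain ⟨hlam, -⟩ := lambdaMin_spec hd h.posDef
  have h1 := h.ftrl_regret_le hm hmK.le hd (by omega) hu
  set lam := lambdaMin (secondMoment D)
  have h2 := h.penalty_le hm hmK hT hlam
  have h3 := h.sum_eta_le hm hmK hd hT hlam
  have hκ := one_le_kappa (K := K) hlam (by omega) hd hT
  have hW : 0 ≤ G.rootEntropy P T := integral_nonneg fun ω => Real.sqrt_nonneg _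
  have h4 : 8 / 3 * d * K * ∑ t ∈ Finset.Icc 1 T, ∫ ω, G.eta T lam t ω ∂P ≤
      8 * kappa K d T lam * G.rootEntropy P T := by
    calc _ ≤ 8 / 3 * d * K * (3 * Real.log T * G.rootEntropy P T / kappa K d T lam) := by gcongr
      _ = (K * d * Real.log T) * (8 * G.rootEntropy P T / kappa K d T lam) := by ring
      _ ≤ kappa K d T lam ^ 2 * (8 * G.rootEntropy P T / kappa K d T lam) := by
          gcongr; exact mul_log_le_kappa_sq hlam
      _ = _ := by field_simp
  unfold ftrlRegret overhead
  linarith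

end Play

/-! ### The cost of exploration -/

namespace Play

variable {K m d : ℕ} {Ω : Type*} {G : Play K m d Ω} [mΩ : MeasurableSpace Ω]
  {P : Measure Ω} {𝒳 : Set (Ctx d)} {D : Measure (Ctx d)} {T : ℕ} {u : Ctx d → Action K m}

lemma IsRun.inner_bdd (h : G.IsRun P 𝒳 D T) {t : ℕ} (ht : t ∈ Set.Icc 1 T) (k : Fin K) :
    BddMeas P mΩ (fun ω => inner ℝ (G.X t 0 ω) (G.θ t k ω)) :=
  h.eval_joint ht (h.inner_joint ht k)

lemma IsRun.comparator_bdd (h : G.IsRun P 𝒳 D T) {t : ℕ} (ht : t ∈ Set.Icc 1 T) (k : Fin K)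
    (hu : Measurable u) : BddMeas P mΩ (fun ω => (u (G.X t 0 ω)).vec k) :=
  h.eval_joint ht (JointBdd.of_snd (ballBdd_vec hu k))

lemma IsRun.action_bdd (h : G.IsRun P 𝒳 D T) {t : ℕ} (ht : t ∈ Set.Icc 1 T) (k : Fin K) :
    BddMeas P mΩ (fun ω => (G.A t 0 ω).vec k) :=
  BddMeas.of_le ((measurable_vec k).comp (h.measurable_A t ht 0)) (C := 1) fun ω => by
    rw [abs_of_nonneg (Action.vec_nonneg _ k)]; exact Action.vec_le_one _ k

lemma IsRun.loss_bdd (h : G.IsRun P 𝒳 D T) {t : ℕ} (ht : t ∈ Set.Icc 1 T) (k : Fin K) :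
    BddMeas P mΩ (G.loss t k) :=
  (h.inner_bdd ht k).add ((h.ε_bdd ht k).mono (h.beforeDraw_le ht 1))

lemma IsRun.integrable_regret (h : G.IsRun P 𝒳 D T) (hu : Measurable u) {t : ℕ}
    (ht : t ∈ Finset.Icc 1 T) (k : Fin K) :
    Integrable (fun ω => G.loss t k ω * ((G.A t 0 ω).vec k - (u (G.X t 0 ω)).vec k)) P := by
  have := h.isProb
  have ht' : t ∈ Set.Icc 1 T := by simpa using ht
  exact ((h.loss_bdd ht' k).mul ((h.action_bdd ht' k).sub (h.comparator_bdd ht' k hu))).integrable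
    le_rfl

lemma IsRun.regret_eq_sum (h : G.IsRun P 𝒳 D T) (hu : Measurable u) :
    G.regret P T u = ∑ t ∈ Finset.Icc 1 T, ∑ k,
      ∫ ω, G.loss t k ω * ((G.A t 0 ω).vec k - (u (G.X t 0 ω)).vec k) ∂P := by
  unfold regret
  rw [integral_finsetSum _ fun t ht => integrable_finsetSum _ fun k _ =>
    h.integrable_regret hu ht k]
  exact Finset.sum_congr rfl fun t ht => integral_finsetSum _ fun k _ => h.integrable_regret hu ht k

/-- Averaging over noise, actions and contexts: the action is replaced by its conditional mean. -/
lemma IsRun.integral_loss_mul (h : G.IsRun P 𝒳 D T) (hm : 1 ≤ m) (hmK : m ≤ K) (hd : 1 ≤ d)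
    (hu : Measurable u) {t : ℕ} (ht : t ∈ Set.Icc 1 T) (k : Fin K) :
    ∫ ω, G.loss t k ω * ((G.A t 0 ω).vec k - (u (G.X t 0 ω)).vec k) ∂P =
      ∫ ω, (G.armProb T (lambdaMin (secondMoment D)) t k ω (G.X t 0 ω) -
        (u (G.X t 0 ω)).vec k) * inner ℝ (G.X t 0 ω) (G.θ t k ω) ∂P := by
  have := h.isProb
  have := h.isProb_context
  set lam := lambdaMin (secondMoment D) with hl
  have hXI : Measurable[G.past T t ⊔ G.drawInfo t 0] (G.X t 0) :=
    (G.measurable_X_drawInfo t 0).mono le_sup_right le_rfl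
  have hAk : BddMeas P (G.past T t ⊔ G.drawInfo t 0) (fun ω => (G.A t 0 ω).vec k) :=
    ⟨(measurable_vec k).comp ((G.measurable_A_drawInfo t 0).mono le_sup_right le_rfl),
      (h.action_bdd ht k).bdd⟩
  have hUk : BddMeas P (G.past T t ⊔ G.drawInfo t 0) (fun ω => (u (G.X t 0 ω)).vec k) :=
    JointBdd.eval (JointBdd.of_snd (𝓕 := G.past T t) (ballBdd_vec hu k)) le_sup_left hXI
      (h.X_norm ht 0)
  have hnoise := h.integral_mul_noise ht k (hAk.sub hUk)
  have hstep := (h.draws hm hmK hd ht k).step 0 (fun ω x => inner ℝ x (G.θ t k ω))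
    (by rw [beforeDraw_zero]; exact h.inner_joint ht k)
  rw [h.integral_context' ht ((h.armProb_joint hm hmK lam ht k).mul (h.inner_joint ht k))] at hstep
  have hA := h.action_bdd ht k
  have hU := h.comparator_bdd ht k hu
  have hI := h.inner_bdd ht k
  have hε := (h.ε_bdd ht k).mono (h.beforeDraw_le ht 1)
  have hq := h.eval_joint ht (h.armProb_joint hm hmK lam ht k)
  have e1 : ∀ ω, G.loss t k ω * ((G.A t 0 ω).vec k - (u (G.X t 0 ω)).vec k) =
      ((G.A t 0 ω).vec k * inner ℝ (G.X t 0 ω) (G.θ t k ω) -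
        (u (G.X t 0 ω)).vec k * inner ℝ (G.X t 0 ω) (G.θ t k ω)) +
      ((G.A t 0 ω).vec k - (u (G.X t 0 ω)).vec k) * G.ε t k ω := fun ω => by
    unfold loss; ring
  simp only [e1, sub_mul (G.armProb T lam t k _ _)]
  rw [integral_add (((hA.mul hI).sub (hU.mul hI)).integrable le_rfl)
    (((hA.sub hU).mul hε).integrable le_rfl), hnoise, add_zero,
    integral_sub ((hA.mul hI).integrable le_rfl) ((hU.mul hI).integrable le_rfl),
    integral_sub ((hq.mul hI).integrable le_rfl) ((hU.mul hI).integrable le_rfl), hstep]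

/-- Exploring costs at most `1 + m` in a round in which it happens. -/
theorem IsRun.regret_le (h : G.IsRun P 𝒳 D T) (hm : 1 ≤ m) (hmK : m ≤ K) (hd : 1 ≤ d)
    (hu : Measurable u) :
    G.regret P T u ≤ G.ftrlRegret P T u +
      (1 + m) * ∑ t ∈ Finset.Icc 1 T, ∫ ω, G.gamma T (lambdaMin (secondMoment D)) t ω ∂P := by
  have := h.isProb
  obtain ⟨hlam, -⟩ := lambdaMin_spec hd h.posDef
  have hK : (0 : ℝ) < K := by exact_mod_cast (by omega : 0 < K)
  rw [h.regret_eq_sum hu, ftrlRegret, Finset.mul_sum, ← Finset.sum_add_distrib]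
  refine Finset.sum_le_sum fun t ht => ?_
  have ht' : t ∈ Set.Icc 1 T := by simpa using ht
  have hA : ∀ k, BddMeas P mΩ (fun ω => G.meanAction t ω (G.X t 0 ω) k) := fun k =>
    h.eval_joint ht' (h.meanAction_joint ht' k)
  have hq : ∀ k, BddMeas P mΩ (fun ω => G.armProb T (lambdaMin (secondMoment D)) t k ω (G.X t 0 ω)) :=
    fun k => h.eval_joint ht' (h.armProb_joint hm hmK _ ht' k)
  simp only [h.integral_loss_mul hm hmK hd hu ht']
  set lam := lambdaMin (secondMoment D)
  have hg : BddMeas P mΩ (G.gamma T lam t) :=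
    (h.gamma_bdd hm hmK lam (by have := ht'.2; omega)).mono (h.past_le (by have := ht'.2; omega))
  have i1 : ∀ k, BddMeas P mΩ (fun ω => (G.meanAction t ω (G.X t 0 ω) k - (u (G.X t 0 ω)).vec k) *
      inner ℝ (G.X t 0 ω) (G.θ t k ω)) := fun k =>
    ((hA k).sub (h.comparator_bdd ht' k hu)).mul (h.inner_bdd ht' k)
  have i2 : ∀ k, BddMeas P mΩ (fun ω => (G.armProb T lam t k ω (G.X t 0 ω) -
      (u (G.X t 0 ω)).vec k) * inner ℝ (G.X t 0 ω) (G.θ t k ω)) := fun k =>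
    ((hq k).sub (h.comparator_bdd ht' k hu)).mul (h.inner_bdd ht' k)
  rw [← integral_finsetSum _ fun k _ => (i2 k).integrable le_rfl,
    ← integral_finsetSum _ fun k _ => (i1 k).integrable le_rfl, ← integral_const_mul,
    ← integral_add ((BddMeas.sum _ fun k _ => i1 k).integrable le_rfl)
      (((BddMeas.const _).mul hg).integrable le_rfl)]
  refine integral_mono_ae ((BddMeas.sum _ fun k _ => i2 k).integrable le_rfl)
    (((BddMeas.sum _ fun k _ => i1 k).add ((BddMeas.const _).mul hg)).integrable le_rfl) ?_
  filter_upwards [h.X_norm ht' 0, ae_all_iff.2 fun k => h.inner_le ht' k] with ω hX hθ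
  obtain ⟨a0, _, a2⟩ := actionHull_bounds (h.meanAction_mem ht' ω (G.X t 0 ω))
  have g0 := gamma_nonneg (G := G) (T := T) hlam t ω
  have e : ∑ k, (G.armProb T lam t k ω (G.X t 0 ω) - (u (G.X t 0 ω)).vec k) *
      inner ℝ (G.X t 0 ω) (G.θ t k ω) =
      ∑ k, (G.meanAction t ω (G.X t 0 ω) k - (u (G.X t 0 ω)).vec k) *
        inner ℝ (G.X t 0 ω) (G.θ t k ω) +
      G.gamma T lam t ω * ∑ k, (1 / K - G.meanAction t ω (G.X t 0 ω) k) *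
        inner ℝ (G.X t 0 ω) (G.θ t k ω) := by
    rw [Finset.mul_sum, ← Finset.sum_add_distrib]
    exact Finset.sum_congr rfl fun k _ => by unfold armProb; ring
  rw [e]
  have h1 : ∑ k, (1 / K - G.meanAction t ω (G.X t 0 ω) k) * inner ℝ (G.X t 0 ω) (G.θ t k ω) ≤
      1 + m := by
    calc _ ≤ ∑ k, (1 / K + G.meanAction t ω (G.X t 0 ω) k) * 1 := by
          refine Finset.sum_le_sum fun k _ => (le_abs_self _).trans ?_
          rw [abs_mul]
          have : (0 : ℝ) ≤ 1 / K := by positivity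
          exact mul_le_mul (abs_le.2 ⟨by linarith [a0 k], by linarith [a0 k]⟩) (hθ k _ hX)
            (abs_nonneg _) (by linarith [a0 k])
      _ = 1 + ∑ k, G.meanAction t ω (G.X t 0 ω) k := by
          simp only [mul_one, Finset.sum_add_distrib, Finset.sum_const, Finset.card_univ,
            Fintype.card_fin, nsmul_eq_mul]
          rw [mul_one_div_cancel hK.ne']
      _ ≤ _ := by linarith
  have h2 := mul_le_mul_of_nonneg_left h1 g0
  linarith

lemma IsRun.regret_le_trivial (h : G.IsRun P 𝒳 D T) (hu : Measurable u) :
    G.regret P T u ≤ 2 * m * T := by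
  have := h.isProb
  have hc : ∫ _ : Ω, 2 * (m : ℝ) * T ∂P = 2 * m * T := by simp
  rw [regret, ← hc]
  refine integral_mono_ae (integrable_finsetSum _ fun t ht => integrable_finsetSum _ fun k _ =>
    h.integrable_regret hu ht k) (integrable_const _) ?_
  have hall : ∀ᵐ ω ∂P, ∀ t ∈ Set.Icc 1 T, ∀ k, |G.loss t k ω| ≤ 1 := by
    rw [ae_all_iff]; intro t
    rw [Filter.eventually_imp_distrib_left]; intro ht
    exact ae_all_iff.2 fun k => h.loss_bound t ht k
  filter_upwards [hall] with ω hω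
  calc _ ≤ ∑ _t ∈ Finset.Icc 1 T, (2 * m : ℝ) := by
        refine Finset.sum_le_sum fun t ht => ?_
        calc _ ≤ ∑ k, ((G.A t 0 ω).vec k + (u (G.X t 0 ω)).vec k) := by
              refine Finset.sum_le_sum fun k _ => (le_abs_self _).trans ?_
              have h1 := Action.vec_nonneg (G.A t 0 ω) k
              have h2 := Action.vec_nonneg (u (G.X t 0 ω)) k
              rw [abs_mul]
              calc _ ≤ 1 * |(G.A t 0 ω).vec k - (u (G.X t 0 ω)).vec k| := by
                    gcongr; exact hω t (by simpa using ht) k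
                _ ≤ _ := by
                    rw [one_mul]; exact abs_le.2 ⟨by linarith, by linarith⟩
          _ ≤ _ := by
              rw [Finset.sum_add_distrib]
              linarith [Action.sum_vec_le (G.A t 0 ω), Action.sum_vec_le (u (G.X t 0 ω))]
    _ = _ := by rw [Finset.sum_const, Nat.card_Icc, nsmul_eq_mul]; simp; ring

lemma sum_gamma_le (G : Play K m d Ω) (P : Measure Ω) (T : ℕ) {lam : ℝ} (hlam : 0 < lam) :
    ∑ t ∈ Finset.Icc 1 T, ∫ ω, G.gamma T lam t ω ∂P ≤
      4 * K * Real.log T / lam * ∑ t ∈ Finset.Icc 1 T, ∫ ω, G.eta T lam t ω ∂P := by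
  rw [Finset.mul_sum]
  refine Finset.sum_le_sum fun t ht => ?_
  unfold gamma
  rw [integral_const_mul]
  have h1 : Real.log t ≤ Real.log T := by
    rw [Finset.mem_Icc] at ht
    exact Real.log_le_log (by exact_mod_cast ht.1) (by exact_mod_cast ht.2)
  refine mul_le_mul_of_nonneg_right ?_ (integral_nonneg fun ω => (eta_pos lam t ω).le)
  unfold alpha
  gcongr

/-- Regret bound in terms of the accumulated entropy, for the stochastic regimes. -/
theorem IsRun.regret_le_rootEntropy (h : G.IsRun P 𝒳 D T) (hm : 1 ≤ m) (hmK : m < K) (hd : 1 ≤ d)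
    (hT : 2 ≤ T) (hu : Measurable u) :
    G.regret P T u ≤ overhead K m d T (lambdaMin (secondMoment D)) +
      34 * m * kappa K d T (lambdaMin (secondMoment D)) * G.rootEntropy P T := by
  obtain ⟨hlam, -⟩ := lambdaMin_spec hd h.posDef
  have h1 := h.regret_le hm hmK.le hd hu
  have h2 := h.ftrlRegret_le hm hmK hd hT hu
  set lam := lambdaMin (secondMoment D)
  have h3 := sum_gamma_le G P T hlam
  have h4 := h.sum_eta_le hm hmK hd hT hlam
  have hκ := one_le_kappa (K := K) hlam (by omega) hd hT
  have hl := half_le_log hT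
  have hm1 : (1 : ℝ) ≤ m := by exact_mod_cast hm
  have hW : 0 ≤ G.rootEntropy P T := integral_nonneg fun ω => Real.sqrt_nonneg _
  have h5 : ∑ t ∈ Finset.Icc 1 T, ∫ ω, G.gamma T lam t ω ∂P ≤
      12 * kappa K d T lam * G.rootEntropy P T := by
    refine h3.trans ?_
    calc _ ≤ 4 * K * Real.log T / lam * (3 * Real.log T * G.rootEntropy P T / kappa K d T lam) := by
          gcongr
      _ = (K * Real.log T ^ 2 / lam) * (12 * G.rootEntropy P T / kappa K d T lam) := by ring
      _ ≤ kappa K d T lam ^ 2 * (12 * G.rootEntropy P T / kappa K d T lam) := by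
          gcongr; exact log_sq_div_le_kappa_sq hlam
      _ = _ := by field_simp
  have h6 : 0 ≤ kappa K d T lam * G.rootEntropy P T := by positivity
  have h7 : (1 + (m : ℝ)) * ∑ t ∈ Finset.Icc 1 T, ∫ ω, G.gamma T lam t ω ∂P ≤
      (2 * m) * (12 * kappa K d T lam * G.rootEntropy P T) :=
    mul_le_mul (by linarith) h5 (Finset.sum_nonneg fun t _ => integral_nonneg fun ω =>
      gamma_nonneg hlam t ω) (by positivity)
  have h8 := mul_le_mul_of_nonneg_right hm1 h6
  linarith

/-- Regret bound in terms of the horizon, for the adversarial regime. -/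
theorem IsRun.regret_le_sqrt (h : G.IsRun P 𝒳 D T) (hm : 1 ≤ m) (hmK : m < K) (hd : 1 ≤ d)
    (hT : 2 ≤ T) (hmT : m ≤ Real.log T) (hu : Measurable u) :
    G.regret P T u ≤ overhead K m d T (lambdaMin (secondMoment D)) +
      52 * kappa K d T (lambdaMin (secondMoment D)) *
        (Real.sqrt m * Real.sqrt (m * Real.log (K / m)) * Real.sqrt T) := by
  have := h.isProb
  obtain ⟨hlam, -⟩ := lambdaMin_spec hd h.posDef
  have h1 := h.regret_le hm hmK.le hd hu
  have h2 := h.ftrlRegret_le hm hmK hd hT hu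
  set lam := lambdaMin (secondMoment D)
  have h3 := sum_gamma_le G P T hlam
  have h4 := h.sum_eta_le_sqrt hm hmK hd hT hlam
  have hκ := one_le_kappa (K := K) hlam (by omega) hd hT
  have hl := half_le_log hT
  have hh := half_le_mul_log hm hmK
  have hm1 : (1 : ℝ) ≤ m := by exact_mod_cast hm
  have hT1 : (1 : ℝ) ≤ T := by exact_mod_cast (by omega : 1 ≤ T)
  set v := (m : ℝ) * Real.log (K / m) with hv
  set S := Real.sqrt m * Real.sqrt v * Real.sqrt T with hS
  have hS0 : 0 ≤ S := by positivity
  have hW : G.rootEntropy P T ≤ 2 * S := by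
    refine (h.rootEntropy_le hm hmK).trans ?_
    have hZ : ∫ ω, G.totalEntropy T ω ∂P ≤ T * (v + m) := by
      have hc : ∫ _ : Ω, (T : ℝ) * (v + m) ∂P = T * (v + m) := by simp
      rw [← hc]
      exact integral_mono ((h.totalEntropy_bdd hm hmK.le).integrable le_rfl) (integrable_const _)
        fun ω => h.totalEntropy_le hm hmK.le ω
    have hvm : v + m ≤ 3 * (m * v) := by nlinarith
    have e : 2 * S = Real.sqrt (4 * (m * v * T)) := by
      have hm0 : (0 : ℝ) ≤ m := by linarith
      have hv0 : 0 ≤ v := by linarith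
      rw [hS, Real.sqrt_mul (by norm_num : (0 : ℝ) ≤ 4), Real.sqrt_mul (mul_nonneg hm0 hv0),
        Real.sqrt_mul hm0 v, show (4 : ℝ) = 2 ^ 2 by norm_num, Real.sqrt_sq two_pos.le]
    rw [e]
    refine Real.sqrt_le_sqrt ?_
    have h5 := mul_le_mul_of_nonneg_left hvm (by linarith : (0 : ℝ) ≤ T)
    have h6 : v * 1 * 1 ≤ v * m * T := by gcongr
    rw [← hv]
    linarith
  have h5 : (1 + (m : ℝ)) * ∑ t ∈ Finset.Icc 1 T, ∫ ω, G.gamma T lam t ω ∂P ≤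
      32 * kappa K d T lam * S := by
    calc _ ≤ (2 * Real.log T) * (4 * K * Real.log T / lam *
          (4 * Real.sqrt m * Real.sqrt v * Real.sqrt T / kappa K d T lam)) := by
          refine mul_le_mul (by linarith) (h3.trans ?_) (Finset.sum_nonneg fun t _ =>
            integral_nonneg fun ω => gamma_nonneg hlam t ω) (by linarith)
          gcongr
      _ = (K * Real.log T ^ 2 / lam) * (32 * S / kappa K d T lam) := by rw [hS]; ring
      _ ≤ kappa K d T lam ^ 2 * (32 * S / kappa K d T lam) := by
          gcongr; exact log_sq_div_le_kappa_sq hlam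
      _ = _ := by field_simp
  have h6 := mul_le_mul_of_nonneg_left hW (by positivity : 0 ≤ 10 * kappa K d T lam)
  linarith

end Play

/-! ### Self-bounding: gaps control the entropy -/

section Gap

variable {K m : ℕ} {g : Fin K → ℝ} {v : Action K m} {δ : ℝ}

/-- The `ℓ₁`-distance of `a` from the 0/1-vector of the action `v`. -/
def Action.mismatch (v : Action K m) (a : Fin K → ℝ) : ℝ := ∑ k, |a k - v.vec k|

lemma Action.vec_of_mem {k : Fin K} (hk : k ∈ v.1) : v.vec k = 1 := if_pos hk

lemma Action.vec_of_notMem {k : Fin K} (hk : k ∉ v.1) : v.vec k = 0 := if_neg hk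

lemma sum_mul_vec (g : Fin K → ℝ) (a : Action K m) : ∑ k, g k * a.vec k = ∑ k ∈ a.1, g k := by
  simp only [Action.vec, mul_ite, mul_one, mul_zero]
  rw [← Finset.sum_filter]
  congr 1
  ext k; simp

lemma gap_le_sum_sub (hgap : ∀ a, a ≠ v → δ ≤ ∑ k, g k * (a.vec k - v.vec k))
    {s : Finset (Fin K)} (hs : s.card ≤ m) (hne : s ≠ v.1) :
    δ ≤ ∑ k ∈ s, g k - ∑ k ∈ v.1, g k := by
  set b : Action K m := ⟨s, hs⟩ with hb
  have h1 := hgap b fun h => hne (congrArg Subtype.val h)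
  have h2 : ∑ k, g k * b.vec k = ∑ k ∈ s, g k := sum_mul_vec g b
  rwa [← h2, ← sum_mul_vec g v, ← Finset.sum_sub_distrib, ← Finset.sum_congr rfl fun k _ =>
    mul_sub (g k) (b.vec k) (v.vec k)]

/-- Dropping an arm from the best action costs at least the gap. -/
lemma gap_le_neg (hgap : ∀ a, a ≠ v → δ ≤ ∑ k, g k * (a.vec k - v.vec k)) {k : Fin K}
    (hk : k ∈ v.1) : δ ≤ -g k := by
  have h1 := gap_le_sum_sub hgap (s := v.1.erase k)
    ((Finset.card_le_card (Finset.erase_subset _ _)).trans v.2)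
    fun h => Finset.notMem_erase k v.1 (h.symm ▸ hk)
  have h2 := Finset.add_sum_erase v.1 g hk
  linarith

/-- Adding an arm to the best action, if there is room, costs at least the gap. -/
lemma gap_le_of_card_lt (hgap : ∀ a, a ≠ v → δ ≤ ∑ k, g k * (a.vec k - v.vec k))
    (hv : v.1.card < m) {k : Fin K} (hk : k ∉ v.1) : δ ≤ g k := by
  have h1 := gap_le_sum_sub hgap (s := insert k v.1) ((Finset.card_insert_le _ _).trans hv)
    fun h => hk (h ▸ Finset.mem_insert_self k v.1)
  rw [Finset.sum_insert hk] at h1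
  linarith

/-- Exchanging an arm of the best action for another one costs at least the gap. -/
lemma gap_le_sub (hgap : ∀ a, a ≠ v → δ ≤ ∑ k, g k * (a.vec k - v.vec k)) {k j : Fin K}
    (hk : k ∈ v.1) (hj : j ∉ v.1) : δ ≤ g j - g k := by
  have hj' : j ∉ v.1.erase k := fun h => hj (Finset.mem_of_mem_erase h)
  have h1 := gap_le_sum_sub hgap (s := insert j (v.1.erase k))
    (by rw [Finset.card_insert_of_notMem hj', Finset.card_erase_add_one hk]; exact v.2)
    fun h => hj (h ▸ Finset.mem_insert_self j (v.1.erase k))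
  rw [Finset.sum_insert hj'] at h1
  have h2 := Finset.add_sum_erase v.1 g hk
  linarith

/-- A gap between the best action and all others makes the loss grow linearly with the distance from
the best action, on the whole convex hull. -/
lemma mul_mismatch_le (hm : 1 ≤ m) (hδ : 0 ≤ δ)
    (hgap : ∀ a, a ≠ v → δ ≤ ∑ k, g k * (a.vec k - v.vec k)) {a : Fin K → ℝ}
    (ha : a ∈ actionHull K m) : δ / 2 * v.mismatch a ≤ ∑ k, g k * (a k - v.vec k) := by
  obtain ⟨a0, a1, a2⟩ := actionHull_bounds ha
  have habs_in : ∀ k ∈ v.1, |a k - v.vec k| = 1 - a k := fun k hk => by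
    rw [Action.vec_of_mem hk, abs_sub_comm, abs_of_nonneg (by linarith [a1 k])]
  have habs_out : ∀ k, k ∉ v.1 → |a k - v.vec k| = a k := fun k hk => by
    rw [Action.vec_of_notMem hk, sub_zero, abs_of_nonneg (a0 k)]
  rcases v.2.lt_or_eq with hlt | heq
  · rw [Action.mismatch, Finset.mul_sum]
    refine Finset.sum_le_sum fun k _ => ?_
    by_cases hk : k ∈ v.1
    · rw [habs_in k hk, Action.vec_of_mem hk]
      nlinarith [gap_le_neg hgap hk, a1 k]
    · rw [habs_out k hk, Action.vec_of_notMem hk]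
      nlinarith [gap_le_of_card_lt hgap hlt hk, a0 k]
  · -- The worst arm of `v` is a threshold: with `t = -g i - δ ≥ 0`, the arms of `v` have losses at
    -- most `-(δ + t)`, the others at least `-t`, and no point of the hull has more mass than `v`.
    obtain ⟨i, hi, hmax⟩ := Finset.exists_max_image v.1 g
      (Finset.card_pos.1 (by omega))
    have ht := gap_le_neg hgap hi
    have hterm : ∀ k, δ / 2 * |a k - v.vec k| + (δ / 2 + (-g i - δ)) * (v.vec k - a k) ≤
        g k * (a k - v.vec k) := fun k => by
      by_cases hk : k ∈ v.1
      · rw [habs_in k hk, Action.vec_of_mem hk]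
        nlinarith [hmax k hk, a1 k]
      · rw [habs_out k hk, Action.vec_of_notMem hk]
        nlinarith [gap_le_sub hgap hi hk, a0 k]
    have h1 := Finset.sum_le_sum fun k (_ : k ∈ Finset.univ) => hterm k
    rw [Finset.sum_add_distrib, ← Finset.mul_sum, ← Finset.mul_sum, Finset.sum_sub_distrib,
      Action.sum_vec, heq] at h1
    have h2 : 0 ≤ (δ / 2 + (-g i - δ)) * ((m : ℝ) - ∑ k, a k) :=
      mul_nonneg (by linarith) (by linarith)
    rw [Action.mismatch]
    linarith

/-- Entries on which `v` vanishes contribute `a log N + 1/N` at most, entries on which it is one at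
most `1 - a`. -/
lemma entropy_le_mismatch (v : Action K m) {a : Fin K → ℝ} (ha : a ∈ actionHull K m) {N : ℝ}
    (hN : 0 < N) (hN1 : 1 ≤ Real.log N) : entropy a ≤ Real.log N * v.mismatch a + K / N := by
  obtain ⟨a0, a1, a2⟩ := actionHull_bounds ha
  rw [entropy, Action.mismatch, Finset.mul_sum, ← Finset.sum_neg_distrib]
  have e : (K : ℝ) / N = ∑ _k : Fin K, 1 / N := by
    rw [Finset.sum_const, Finset.card_univ, Fintype.card_fin, nsmul_eq_mul, mul_one_div]
  rw [e, ← Finset.sum_add_distrib]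
  refine Finset.sum_le_sum fun k _ => ?_
  have hN0 : 0 < 1 / N := by positivity
  by_cases hk : k ∈ v.1
  · rw [Action.vec_of_mem hk, abs_sub_comm, abs_of_nonneg (by linarith [a1 k])]
    have := neg_mul_log_le_one_sub (a0 k)
    nlinarith [a1 k]
  · rw [Action.vec_of_notMem hk, sub_zero, abs_of_nonneg (a0 k)]
    have := neg_mul_log_le (a0 k) hN
    linarith

/-- A gap forces `m` arms with losses of size at least `δ`: those of `v` if it plays `m` arms, and any
`m` arms otherwise. -/
lemma exists_card_eq_of_gap (hmK : m ≤ K) (hgap : ∀ a, a ≠ v → δ ≤ ∑ k, g k * (a.vec k - v.vec k)) :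
    ∃ b : Action K m, b.1.card = m ∧ ∀ k ∈ b.1, δ ≤ |g k| := by
  rcases v.2.lt_or_eq with hlt | heq
  · obtain ⟨s, -, hs⟩ := Finset.exists_subset_card_eq (s := (Finset.univ : Finset (Fin K)))
      (n := m) (by simpa using hmK)
    refine ⟨⟨s, hs.le⟩, hs, fun k _ => ?_⟩
    by_cases hk : k ∈ v.1
    · exact (gap_le_neg hgap hk).trans (neg_le_abs _)
    · exact (gap_le_of_card_lt hgap hlt hk).trans (le_abs_self _)
  · exact ⟨v, heq, fun k hk => (gap_le_neg hgap hk).trans (neg_le_abs _)⟩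

end Gap

section Best

variable {K m d : ℕ} (θ₀ : Fin K → Ctx d)

instance (K m : ℕ) : Nonempty (Action K m) := ⟨⟨∅, by simp⟩⟩

/-- The least loss `min_a ∑ k, ⟨x, θ_k⟩ a_k` at the context `x`. The value of the minimum is measurable
in `x`, while a given minimizer need not be. -/
def bestLoss (m : ℕ) (x : Ctx d) : ℝ := ⨅ a : Action K m, ∑ k, inner ℝ x (θ₀ k) * a.vec k

lemma bestLoss_le (x : Ctx d) (a : Action K m) :
    bestLoss θ₀ m x ≤ ∑ k, inner ℝ x (θ₀ k) * a.vec k :=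
  ciInf_le (Set.finite_range _).bddBelow a

lemma bestLoss_eq {x : Ctx d} {u : Ctx d → Action K m} (hu : ∀ a, 0 ≤ gap θ₀ u x a) :
    bestLoss θ₀ m x = ∑ k, inner ℝ x (θ₀ k) * (u x).vec k := by
  refine le_antisymm (bestLoss_le θ₀ x _) (le_ciInf fun a => ?_)
  have := hu a
  simp only [gap, mul_sub, Finset.sum_sub_distrib] at this
  linarith

lemma ballBdd_inner (v : Ctx d) : BallBdd (fun x : Ctx d => inner ℝ x v) := by
  simp only [inner_eq_dotProduct]
  exact BallBdd.dot' _

lemma ballBdd_bestLoss : BallBdd (bestLoss θ₀ m) := by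
  have hb : ∀ a : Action K m, BallBdd (fun x => ∑ k, inner ℝ x (θ₀ k) * a.vec k) := fun a =>
    BallBdd.sum _ fun k _ => (ballBdd_inner (θ₀ k)).mul (BallBdd.const _)
  refine ⟨Measurable.iInf fun a => (hb a).1, ∑ k, ‖θ₀ k‖, fun x hx => ?_⟩
  obtain ⟨a, ha⟩ := exists_eq_ciInf_of_finite
    (f := fun a : Action K m => ∑ k, inner ℝ x (θ₀ k) * a.vec k)
  rw [bestLoss, ← ha]
  refine (Finset.abs_sum_le_sum_abs _ _).trans (Finset.sum_le_sum fun k _ => ?_)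
  rw [abs_mul, abs_of_nonneg (a.vec_nonneg k)]
  calc _ ≤ (‖x‖ * ‖θ₀ k‖) * 1 :=
        mul_le_mul (abs_real_inner_le_norm _ _) (a.vec_le_one k) (a.vec_nonneg k) (by positivity)
    _ ≤ 1 * ‖θ₀ k‖ * 1 := by gcongr
    _ = _ := by ring

lemma minGap_le {𝒳 : Set (Ctx d)} {u : Ctx d → Action K m} (hu : ∀ x ∈ 𝒳, ∀ a, 0 ≤ gap θ₀ u x a)
    {x : Ctx d} (hx : x ∈ 𝒳) {a : Action K m} (ha : a ≠ u x) : minGap 𝒳 θ₀ u ≤ gap θ₀ u x a :=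
  csInf_le ⟨0, by rintro _ ⟨y, hy, b, -, rfl⟩; exact hu y hy b⟩ ⟨x, hx, a, ha, rfl⟩

/-- A set of reals with positive infimum is bounded below, since otherwise its `sInf` is zero. -/
lemma gap_nonneg_of_minGap_pos {𝒳 : Set (Ctx d)} {u : Ctx d → Action K m} (h : 0 < minGap 𝒳 θ₀ u) :
    ∀ x ∈ 𝒳, ∀ a, 0 ≤ gap θ₀ u x a := by
  have hbdd : BddBelow {g : ℝ | ∃ x ∈ 𝒳, ∃ a, a ≠ u x ∧ g = gap θ₀ u x a} := by
    by_contra hn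
    rw [minGap, Real.sInf_of_not_bddBelow hn] at h
    exact lt_irrefl _ h
  intro x hx a
  by_cases ha : a = u x
  · simp [gap, ha]
  · exact h.le.trans (csInf_le hbdd ⟨x, hx, a, ha, rfl⟩)

/-- A linear function on the hull is at most its largest value on the actions. -/
lemma sum_mul_le_ciSup {a : Fin K → ℝ} (ha : a ∈ actionHull K m) (w : Fin K → ℝ) :
    ∑ k, w k * a k ≤ ⨆ b : Action K m, ∑ k, w k * b.vec k := by
  have hconv : Convex ℝ {a : Fin K → ℝ | ∑ k, w k * a k ≤ ⨆ b : Action K m, ∑ k, w k * b.vec k} :=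
    convex_halfSpace_le (f := fun a : Fin K → ℝ => ∑ k, w k * a k)
      ⟨fun x y => by simp [mul_add, Finset.sum_add_distrib],
        fun c x => by simp [Finset.mul_sum, mul_left_comm]⟩ _
  refine convexHull_min ?_ hconv ha
  rintro _ ⟨b, rfl⟩
  exact le_ciSup (f := fun b : Action K m => ∑ k, w k * b.vec k) (Set.finite_range _).bddAbove b

end Best

/-! ### The corrupted stochastic regime -/

namespace Play

variable {K m d : ℕ} {Ω : Type*} {G : Play K m d Ω} [mΩ : MeasurableSpace Ω]
  {P : Measure Ω} {𝒳 : Set (Ctx d)} {D : Measure (Ctx d)} {T : ℕ} {u u₀ : Ctx d → Action K m}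
  {θ₀ : Fin K → Ctx d} {c : ℝ}

/-- Excess loss of the FTRL iterate of round `t` under the uncorrupted coefficients `θ₀`. -/
def excess (G : Play K m d Ω) (θ₀ : Fin K → Ctx d) (t : ℕ) (ω : Ω) (x : Ctx d) : ℝ :=
  ∑ k, inner ℝ x (θ₀ k) * G.meanAction t ω x k - bestLoss θ₀ m x

/-- Expected total excess loss of the played FTRL iterates under `θ₀`. -/
def totalExcess (G : Play K m d Ω) (P : Measure Ω) (T : ℕ) (θ₀ : Fin K → Ctx d) : ℝ :=
  ∑ t ∈ Finset.Icc 1 T, ∫ ω, G.excess θ₀ t ω (G.X t 0 ω) ∂P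

lemma IsRun.excess_joint (h : G.IsRun P 𝒳 D T) (θ₀ : Fin K → Ctx d) {t : ℕ}
    (ht : t ∈ Set.Icc 1 T) : JointBdd P (G.past T t) (G.excess θ₀ t) :=
  (JointBdd.sum _ fun k _ => (JointBdd.of_snd (ballBdd_inner (θ₀ k))).mul
    (h.meanAction_joint ht k)).sub (JointBdd.of_snd (ballBdd_bestLoss θ₀))

lemma IsRun.mul_mismatch_le_excess (h : G.IsRun P 𝒳 D T) (hm : 1 ≤ m)
    (hgap : ∀ x ∈ 𝒳, ∀ a, 0 ≤ gap θ₀ u₀ x a) (hΔ : 0 < minGap 𝒳 θ₀ u₀) {t : ℕ}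
    (ht : t ∈ Set.Icc 1 T) (ω : Ω) {x : Ctx d} (hx : x ∈ 𝒳) :
    minGap 𝒳 θ₀ u₀ / 2 * (u₀ x).mismatch (G.meanAction t ω x) ≤ G.excess θ₀ t ω x := by
  have h1 := mul_mismatch_le (g := fun k => inner ℝ x (θ₀ k)) hm hΔ.le
    (fun a ha => minGap_le θ₀ hgap hx ha) (h.meanAction_mem ht ω x)
  rw [excess, bestLoss_eq θ₀ (hgap x hx), ← Finset.sum_sub_distrib]
  simpa only [mul_sub] using h1

lemma IsRun.totalExcess_nonneg (h : G.IsRun P 𝒳 D T) (hm : 1 ≤ m)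
    (hgap : ∀ x ∈ 𝒳, ∀ a, 0 ≤ gap θ₀ u₀ x a) (hΔ : 0 < minGap 𝒳 θ₀ u₀) :
    0 ≤ G.totalExcess P T θ₀ := by
  refine Finset.sum_nonneg fun t ht => integral_nonneg_of_ae ?_
  have ht' : t ∈ Set.Icc 1 T := by simpa using ht
  filter_upwards [h.X_mem ht' 0] with ω hω
  refine le_trans ?_ (h.mul_mismatch_le_excess hm hgap hΔ ht' ω hω)
  exact mul_nonneg (by linarith) (Finset.sum_nonneg fun k _ => abs_nonneg _)

/-- Self-bounding: the accumulated entropy is controlled by the excess loss. -/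
lemma IsRun.integral_totalEntropy_le (h : G.IsRun P 𝒳 D T) (hm : 1 ≤ m) (hmK : m < K)
    (hT : 2 ≤ T) (hKT : K ≤ T) (hgap : ∀ x ∈ 𝒳, ∀ a, 0 ≤ gap θ₀ u₀ x a)
    (hΔ : 0 < minGap 𝒳 θ₀ u₀) :
    ∫ ω, G.totalEntropy T ω ∂P ≤
      4 * Real.log T / minGap 𝒳 θ₀ u₀ * G.totalExcess P T θ₀ + 1 := by
  have := h.isProb
  set δ := minGap 𝒳 θ₀ u₀ with hδ
  have hl := half_le_log hT
  have hT0 : (0 : ℝ) < T := by exact_mod_cast (by omega : 0 < T)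
  have hK0 : (0 : ℝ) < K := by exact_mod_cast (by omega : 0 < K)
  have hlog1 : Real.log (K * T) ≤ 2 * Real.log T := by
    rw [Real.log_mul hK0.ne' hT0.ne']
    have : Real.log K ≤ Real.log T := Real.log_le_log hK0 (by exact_mod_cast hKT)
    linarith
  have hlog2 : 1 ≤ Real.log (K * T) := by
    rw [Real.log_mul hK0.ne' hT0.ne']
    have := half_le_log (T := K) (by omega)
    linarith
  have hE : ∀ t ∈ Finset.Icc 1 T, BddMeas P mΩ (fun ω => entropy (G.meanAction t ω (G.X t 0 ω))) :=
    fun t ht => h.entropy_bdd hm hmK.le (by simpa using ht)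
  have hX : ∀ t ∈ Finset.Icc 1 T, BddMeas P mΩ (fun ω => G.excess θ₀ t ω (G.X t 0 ω)) :=
    fun t ht => h.eval_joint (by simpa using ht) (h.excess_joint θ₀ (by simpa using ht))
  have hone : (1 : ℝ) = ∑ _t ∈ Finset.Icc 1 T, 1 / (T : ℝ) := by
    rw [Finset.sum_const, Nat.card_Icc, nsmul_eq_mul, Nat.add_sub_cancel,
      mul_one_div_cancel hT0.ne']
  unfold totalEntropy totalExcess
  rw [integral_finsetSum _ fun t ht => (hE t ht).integrable le_rfl, hone, Finset.mul_sum,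
    ← Finset.sum_add_distrib]
  refine Finset.sum_le_sum fun t ht => ?_
  have ht' : t ∈ Set.Icc 1 T := by simpa using ht
  have i1 := (BddMeas.const (4 * Real.log T / δ)).mul (hX t ht)
  calc _ ≤ ∫ ω, (4 * Real.log T / δ * G.excess θ₀ t ω (G.X t 0 ω) + 1 / (T : ℝ)) ∂P := by
        refine integral_mono_ae ((hE t ht).integrable le_rfl)
          ((i1.add (BddMeas.const _)).integrable le_rfl) ?_
        filter_upwards [h.X_mem ht' 0] with ω hω
        have h1 := h.mul_mismatch_le_excess hm hgap hΔ ht' ω hω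
        have h2 := entropy_le_mismatch (u₀ (G.X t 0 ω)) (h.meanAction_mem ht' ω (G.X t 0 ω))
          (N := K * T) (by positivity) hlog2
        set q := (u₀ (G.X t 0 ω)).mismatch (G.meanAction t ω (G.X t 0 ω))
        have hq : 0 ≤ q := Finset.sum_nonneg fun k _ => abs_nonneg _
        have e : (K : ℝ) / (K * T) = 1 / T := by field_simp
        rw [e] at h2
        calc _ ≤ Real.log (K * T) * q + 1 / T := h2
          _ ≤ 2 * Real.log T * q + 1 / T := by gcongr
          _ = 4 * Real.log T / δ * (δ / 2 * q) + 1 / T := by field_simp; ring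
          _ ≤ _ := by gcongr
    _ = _ := by
        rw [integral_add (i1.integrable le_rfl) (integrable_const _), integral_const_mul,
          integral_const, probReal_univ, one_smul]

lemma IsRun.corruption_nonneg (h : G.IsRun P 𝒳 D T) (hcor : G.IsCorrupted P T θ₀ c) : 0 ≤ c := by
  have := h.isProb
  obtain ⟨ω, hω⟩ := hcor.exists
  refine le_trans (Finset.sum_nonneg fun t _ => ?_) hω
  exact Real.iSup_nonneg fun a => Finset.sum_nonneg fun k _ =>
    mul_nonneg (norm_nonneg _) (a.vec_nonneg k)

/-- A large gap forces large coefficients `θ₀`, hence corruption in every round. -/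
lemma IsRun.mul_le_corruption (h : G.IsRun P 𝒳 D T) (hmK : m < K)
    (hcor : G.IsCorrupted P T θ₀ c) (hgap : ∀ x ∈ 𝒳, ∀ a, 0 ≤ gap θ₀ u₀ x a)
    (hΔ : 2 ≤ minGap 𝒳 θ₀ u₀) : (m : ℝ) * T ≤ c := by
  have := h.isProb
  have := h.isProb_context
  obtain ⟨x, hx, hx1⟩ := (h.context_mem.and h.context_norm).exists
  obtain ⟨b, hb, hbθ⟩ := exists_card_eq_of_gap (g := fun k => inner ℝ x (θ₀ k)) hmK.le
    (fun a ha => minGap_le θ₀ hgap hx ha)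
  have hall : ∀ᵐ ω ∂P, ∀ t ∈ Set.Icc 1 T, ∀ k, ‖G.θ t k ω‖ ≤ 1 := by
    rw [ae_all_iff]; intro t
    rw [Filter.eventually_imp_distrib_left]; intro ht
    exact ae_all_iff.2 fun k => h.θ_norm t ht k
  obtain ⟨ω, hω, hθ⟩ := (hcor.and hall).exists
  refine le_trans ?_ hω
  have hround : ∀ t ∈ Finset.Icc 1 T, (m : ℝ) ≤
      ⨆ a : Action K m, ∑ k, ‖G.θ t k ω - θ₀ k‖ * a.vec k := fun t ht => by
    refine le_trans ?_ (le_ciSup (f := fun a : Action K m => ∑ k, ‖G.θ t k ω - θ₀ k‖ * a.vec k)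
      (Set.finite_range _).bddAbove b)
    rw [sum_mul_vec]
    have h1 : ∀ k ∈ b.1, (1 : ℝ) ≤ ‖G.θ t k ω - θ₀ k‖ := fun k hk => by
      have h2 : 2 ≤ ‖θ₀ k‖ := by
        refine (hΔ.trans (hbθ k hk)).trans ((abs_real_inner_le_norm _ _).trans ?_)
        exact mul_le_of_le_one_left (norm_nonneg _) hx1
      have h3 := hθ t (by simpa using ht) k
      have h4 := norm_sub_norm_le (θ₀ k) (G.θ t k ω)
      rw [norm_sub_rev]
      linarith
    have := Finset.card_nsmul_le_sum _ _ _ h1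
    rwa [hb, nsmul_eq_mul, mul_one] at this
  have := Finset.card_nsmul_le_sum _ _ _ hround
  rw [Nat.card_Icc, nsmul_eq_mul, Nat.add_sub_cancel] at this
  linarith

/-- Passing from `θ_t` to `θ₀` costs the corruption twice, once for the iterates and once for the
comparator. -/
lemma IsRun.totalExcess_le (h : G.IsRun P 𝒳 D T)
    (hopt : G.IsOptimal P 𝒳 T u) (hcor : G.IsCorrupted P T θ₀ c)
    (hgap : ∀ x ∈ 𝒳, ∀ a, 0 ≤ gap θ₀ u₀ x a) :
    G.totalExcess P T θ₀ ≤ G.ftrlRegret P T u + 2 * c := by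
  have := h.isProb
  have := h.isProb_context
  have hS : ∀ t, t ∈ Finset.Icc 1 T → t ∈ Set.Icc 1 T := fun t ht => by simpa using ht
  -- `Φ` is the change of the iterate's loss when `θ_t` is replaced by `θ₀`
  set Φ : ℕ → Ω → Ctx d → ℝ := fun t ω x =>
    ∑ k, (inner ℝ x (θ₀ k) - inner ℝ x (G.θ t k ω)) * G.meanAction t ω x k with hΦ
  -- `Ψ` is the loss of the comparator above the best loss under `θ₀`
  set Ψ : ℕ → Ω → Ctx d → ℝ := fun t ω x =>
    ∑ k, inner ℝ x (G.θ t k ω) * (u x).vec k - bestLoss θ₀ m x with hΨ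
  have jΦ : ∀ t ∈ Finset.Icc 1 T, JointBdd P (G.past T t) (Φ t) := fun t ht =>
    JointBdd.sum _ fun k _ => ((JointBdd.of_snd (ballBdd_inner (θ₀ k))).sub
      (h.inner_joint (hS t ht) k)).mul (h.meanAction_joint (hS t ht) k)
  have jΨ : ∀ t ∈ Finset.Icc 1 T, JointBdd P (G.past T t) (Ψ t) := fun t ht =>
    (JointBdd.sum _ fun k _ => (h.inner_joint (hS t ht) k).mul
      (JointBdd.of_snd (ballBdd_vec hopt.1 k))).sub (JointBdd.of_snd (ballBdd_bestLoss θ₀))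
  have jR : ∀ t ∈ Finset.Icc 1 T, ∀ k, BddMeas P mΩ (fun ω =>
      (G.meanAction t ω (G.X t 0 ω) k - (u (G.X t 0 ω)).vec k) *
        inner ℝ (G.X t 0 ω) (G.θ t k ω)) := fun t ht k =>
    h.eval_joint (hS t ht) (((h.meanAction_joint (hS t ht) k).sub
      (JointBdd.of_snd (ballBdd_vec hopt.1 k))).mul (h.inner_joint (hS t ht) k))
  have hsplit : G.totalExcess P T θ₀ = G.ftrlRegret P T u +
      (∑ t ∈ Finset.Icc 1 T, ∫ ω, Φ t ω (G.X t 0 ω) ∂P +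
        ∑ t ∈ Finset.Icc 1 T, ∫ ω, Ψ t ω (G.X t 0 ω) ∂P) := by
    rw [totalExcess, ftrlRegret, ← Finset.sum_add_distrib, ← Finset.sum_add_distrib]
    refine Finset.sum_congr rfl fun t ht => ?_
    have iΦ := (h.eval_joint (hS t ht) (jΦ t ht)).integrable le_rfl
    have iΨ := (h.eval_joint (hS t ht) (jΨ t ht)).integrable le_rfl
    rw [← integral_finsetSum _ fun k _ => (jR t ht k).integrable le_rfl, ← integral_add' iΦ iΨ,
      ← integral_add' ((BddMeas.sum _ fun k _ => jR t ht k).integrable le_rfl) (iΦ.add iΨ)]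
    congr 1
    ext ω
    simp only [excess, hΦ, hΨ, Pi.add_apply]
    rw [← add_sub_assoc, ← Finset.sum_add_distrib, ← add_sub_assoc, ← Finset.sum_add_distrib]
    congr 1
    exact Finset.sum_congr rfl fun k _ => by ring
  have hcc : ∫ _ : Ω, c ∂P = c := by simp
  have hdiff : ∀ {x : Ctx d}, ‖x‖ ≤ 1 → ∀ v w : Ctx d, |inner ℝ x v - inner ℝ x w| ≤ ‖v - w‖ := by
    intro x hx v w
    rw [← inner_sub_right]
    exact (abs_real_inner_le_norm _ _).trans (mul_le_of_le_one_left (norm_nonneg _) hx)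
  have h1 : ∑ t ∈ Finset.Icc 1 T, ∫ ω, Φ t ω (G.X t 0 ω) ∂P ≤ c := by
    have iΦ := fun t ht => (h.eval_joint (hS t ht) (jΦ t ht)).integrable le_rfl
    rw [← integral_finsetSum _ iΦ]
    refine (integral_mono_ae (integrable_finsetSum _ iΦ) (integrable_const c) ?_).trans hcc.le
    have hX : ∀ᵐ ω ∂P, ∀ t ∈ Finset.Icc 1 T, ‖G.X t 0 ω‖ ≤ 1 := by
      rw [ae_all_iff]; intro t
      rw [Filter.eventually_imp_distrib_left]; intro ht
      exact h.X_norm (hS t ht) 0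
    filter_upwards [hcor, hX] with ω hω hXω
    refine le_trans (Finset.sum_le_sum fun t ht => ?_) hω
    have hmem := h.meanAction_mem (hS t ht) ω (G.X t 0 ω)
    refine le_trans (Finset.sum_le_sum fun k _ => ?_)
      (sum_mul_le_ciSup hmem fun k => ‖G.θ t k ω - θ₀ k‖)
    refine mul_le_mul_of_nonneg_right ?_ ((actionHull_bounds hmem).1 k)
    rw [norm_sub_rev]
    exact (le_abs_self _).trans (hdiff (hXω t ht) _ _)
  have h2 : ∑ t ∈ Finset.Icc 1 T, ∫ ω, Ψ t ω (G.X t 0 ω) ∂P ≤ c := by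
    rw [← Finset.sum_congr rfl fun t ht => h.integral_context (hS t ht) (jΨ t ht),
      ← integral_finsetSum _ fun t ht => h.integrable_context (hS t ht) (jΨ t ht)]
    have hcD : ∫ _ : Ctx d, c ∂D = c := by simp
    refine (integral_mono_ae (integrable_finsetSum _ fun t ht =>
      h.integrable_context (hS t ht) (jΨ t ht)) (integrable_const c) ?_).trans hcD.le
    filter_upwards [h.context_mem, h.context_norm] with x hx hx1
    have iL : ∀ a : Action K m, ∀ t ∈ Finset.Icc 1 T,
        BddMeas P mΩ (fun ω => ∑ k, inner ℝ x (G.θ t k ω) * a.vec k) := fun a t ht =>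
      BddMeas.sum _ fun k _ => (((h.inner_joint (hS t ht) k).slice hx1).mono
        (h.past_le (by have := (hS t ht).2; omega))).mul (BddMeas.const _)
    have e : ∀ a : Action K m, ∑ t ∈ Finset.Icc 1 T, ∫ ω,
        (∑ k, inner ℝ x (G.θ t k ω) * a.vec k - bestLoss θ₀ m x) ∂P =
        G.totalLoss P T x a - T * bestLoss θ₀ m x := fun a => by
      rw [totalLoss, integral_finsetSum _ fun t ht => (iL a t ht).integrable le_rfl]
      rw [Finset.sum_congr rfl fun t ht => integral_sub ((iL a t ht).integrable le_rfl)
        (integrable_const (bestLoss θ₀ m x))]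
      simp [Finset.sum_sub_distrib]
    have h3 := hopt.2 x hx (u₀ x)
    have h4 : ∑ t ∈ Finset.Icc 1 T, ∫ ω,
        (∑ k, inner ℝ x (G.θ t k ω) * (u₀ x).vec k - bestLoss θ₀ m x) ∂P ≤ c := by
      have i4 : ∀ t ∈ Finset.Icc 1 T, Integrable (fun ω =>
          ∑ k, inner ℝ x (G.θ t k ω) * (u₀ x).vec k - bestLoss θ₀ m x) P := fun t ht =>
        ((iL (u₀ x) t ht).sub (BddMeas.const _)).integrable le_rfl
      rw [← integral_finsetSum _ i4]
      refine (integral_mono_ae (integrable_finsetSum _ i4) (integrable_const c) ?_).trans hcc.le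
      filter_upwards [hcor] with ω hω
      refine le_trans (Finset.sum_le_sum fun t ht => ?_) hω
      rw [bestLoss_eq θ₀ (hgap x hx), ← Finset.sum_sub_distrib]
      refine le_trans (Finset.sum_le_sum fun k _ => ?_)
        (le_ciSup (f := fun a : Action K m => ∑ k, ‖G.θ t k ω - θ₀ k‖ * a.vec k)
          (Set.finite_range _).bddAbove (u₀ x))
      rw [← sub_mul]
      exact mul_le_mul_of_nonneg_right ((le_abs_self _).trans (hdiff hx1 _ _))
        ((u₀ x).vec_nonneg k)
    have h5 := e (u x)
    have h6 := e (u₀ x)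
    simp only [hΨ]
    linarith
  linarith

end Play

/-! ### Regret bounds in the three regimes -/

section Absorption

open Play

variable {K m d T : ℕ} {lam : ℝ}

/-- For `T ≥ K` the overhead is absorbed by the bound of the stochastic regimes. -/
lemma overhead_le (hm : 1 ≤ m) (hmK : m < K) (hd : 1 ≤ d) (hT : 2 ≤ T) (hKT : K ≤ T)
    (hlam : 0 < lam) : overhead K m d T lam ≤ 74 * kappa K d T lam ^ 2 * m * Real.log T := by
  have hl := half_le_log hT
  have hh := half_le_mul_log hm hmK
  have hκ := one_le_kappa (K := K) hlam (by omega) hd hT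
  have hκ2 := log_sq_div_le_kappa_sq (K := K) (d := d) (T := T) hlam
  have hm1 : (1 : ℝ) ≤ m := by exact_mod_cast hm
  have hK0 : (0 : ℝ) < K := by exact_mod_cast (by omega : 0 < K)
  have hlog : Real.log ((K : ℝ) / m) ≤ Real.log T := by
    refine Real.log_le_log (by positivity) ((div_le_self hK0.le hm1).trans (by exact_mod_cast hKT))
  have hH : m * Real.log ((K : ℝ) / m) + m ≤ 3 * (m * Real.log T) := by
    have := mul_le_mul_of_nonneg_left hlog (by linarith : (0 : ℝ) ≤ m)
    nlinarith
  have hc : c₁ K m d T lam ≤ 2 * kappa K d T lam := by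
    rw [c₁_eq hlam]
    have hs : 1 / 2 ≤ Real.sqrt (m * Real.log (K / m)) := by
      rw [Real.le_sqrt' (by norm_num)]; linarith
    rw [div_le_iff₀ (by linarith)]
    nlinarith
  have hc₂ : c₂ K lam * Real.log T * Real.log T ≤ 8 * kappa K d T lam ^ 2 := by
    have e : c₂ K lam * Real.log T * Real.log T = 8 * (K * Real.log T ^ 2 / lam) := by
      unfold c₂; ring
    linarith
  have hc₂0 : 0 ≤ c₂ K lam * Real.log T := by unfold c₂; positivity
  have hc0 := c₁_nonneg K m d T lam
  have hκκ : kappa K d T lam ≤ kappa K d T lam ^ 2 := by nlinarith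
  have hκ1 : 1 ≤ kappa K d T lam ^ 2 := hκ.trans hκκ
  set Y := kappa K d T lam ^ 2
  have hY : 0 ≤ m * Real.log T := by positivity
  have h1 : (2 + c₂ K lam * Real.log T + 2 * c₁ K m d T lam) * (m * Real.log (K / m) + m) ≤
      (2 * Y + c₂ K lam * Real.log T + 4 * Y) * (3 * (m * Real.log T)) := by
    refine mul_le_mul (by linarith) hH (by positivity) (by positivity)
  have h2 : c₂ K lam * Real.log T * (3 * (m * Real.log T)) ≤ 24 * Y * m := by
    have := mul_le_mul_of_nonneg_left hc₂ (by linarith : (0 : ℝ) ≤ 3 * m)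
    linarith
  have h3 : Y * m ≤ 2 * (Y * m * Real.log T) := by
    have : 0 ≤ Y * m := by positivity
    nlinarith
  have h4 : (m : ℝ) ≤ Y * m := by nlinarith
  unfold overhead
  linarith

lemma rpow_three_halves (m : ℕ) : (m : ℝ) ^ (3 / 2 : ℝ) = m * Real.sqrt m := by
  rw [Real.sqrt_eq_rpow, show (3 / 2 : ℝ) = 1 + 1 / 2 by norm_num,
    Real.rpow_add' (by positivity) (by norm_num), Real.rpow_one]

/-- The self-bounding argument: an upper bound on the excess loss `F` in terms of its own square root
is resolved by the arithmetic-geometric mean inequality, with `q` the self-bounding constant and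
`r = √m`. -/
lemma self_bounding {κ B F R s q c r : ℝ} (hq : 0 < q) (hr : 1 ≤ r) (hF : 0 ≤ F) (hs : 0 ≤ s)
    (hsq : s ≤ 2 * r ^ 2 * q)
    (hFle : F ≤ B + 10 * κ * Real.sqrt (s + q * F) + 2 * c)
    (hR : R ≤ B + 34 * r ^ 2 * κ * Real.sqrt (s + q * F)) :
    R ≤ B + r * (B + 50 * κ ^ 2 * q + r ^ 2 + 2 * c) + 578 * κ ^ 2 * r ^ 3 * q + r ^ 3 := by
  set y := Real.sqrt (s + q * F) with hy
  have hy2 : y ^ 2 = s + q * F := Real.sq_sqrt (by positivity)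
  have hyq : y ^ 2 / q ≤ 2 * r ^ 2 + F := by
    rw [hy2, div_le_iff₀ hq]; nlinarith
  have h1 : 10 * κ * y ≤ 50 * κ ^ 2 * q + y ^ 2 / q / 2 := by
    have e : 50 * κ ^ 2 * q + y ^ 2 / q / 2 - 10 * κ * y = (10 * κ * q - y) ^ 2 / (2 * q) := by
      field_simp; ring
    have : 0 ≤ (10 * κ * q - y) ^ 2 / (2 * q) := by positivity
    linarith
  have h2 : 34 * r ^ 2 * κ * y ≤ 578 * κ ^ 2 * r ^ 3 * q + r * (y ^ 2 / q) / 2 := by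
    have e : 578 * κ ^ 2 * r ^ 3 * q + r * (y ^ 2 / q) / 2 - 34 * r ^ 2 * κ * y =
        r * (34 * κ * r * q - y) ^ 2 / (2 * q) := by
      field_simp; ring
    have : 0 ≤ r * (34 * κ * r * q - y) ^ 2 / (2 * q) := by positivity
    linarith
  have h3 : F ≤ 2 * (B + 50 * κ ^ 2 * q + r ^ 2 + 2 * c) := by linarith
  have h4 := mul_le_mul_of_nonneg_left (hyq.trans (add_le_add_right h3 _))
    (by linarith : 0 ≤ r)
  nlinarith

end Absorption

namespace Play

variable {K m d : ℕ} {Ω : Type*} {G : Play K m d Ω} [mΩ : MeasurableSpace Ω]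
  {P : Measure Ω} {𝒳 : Set (Ctx d)} {D : Measure (Ctx d)} {T : ℕ} {u u₀ : Ctx d → Action K m}
  {θ₀ : Fin K → Ctx d} {c : ℝ}

/-- The bound follows from self-bounding if `T ≥ K` and the minimal gap is below `2`. Otherwise the
trivial bound `2 m T` on the regret suffices: a larger gap forces corruption of order `m T`. -/
theorem IsRun.regret_le_corrupted (h : G.IsRun P 𝒳 D T) (hm : 1 ≤ m) (hmK : m < K) (hd : 1 ≤ d)
    (hT : 2 ≤ T) (hopt : G.IsOptimal P 𝒳 T u) (hcor : G.IsCorrupted P T θ₀ c)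
    (hgap : ∀ x ∈ 𝒳, ∀ a, 0 ≤ gap θ₀ u₀ x a) (hΔ : 0 < minGap 𝒳 θ₀ u₀) :
    G.regret P T u ≤ 3000 * (kappa K d T (lambdaMin (secondMoment D)) ^ 2 *
      (m : ℝ) ^ (3 / 2 : ℝ) * Real.log (((K : ℝ) - m) * T) / minGap 𝒳 θ₀ u₀ + Real.sqrt m * c) := by
  obtain ⟨hlam, -⟩ := lambdaMin_spec hd h.posDef
  have hc := h.corruption_nonneg hcor
  have htriv := h.regret_le_trivial hopt.1
  have hroot := h.regret_le_rootEntropy hm hmK hd hT hopt.1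
  have hftrl := h.ftrlRegret_le hm hmK hd hT hopt.1
  set lam := lambdaMin (secondMoment D)
  set κ := kappa K d T lam with hκdef
  set δ := minGap 𝒳 θ₀ u₀ with hδ
  have hκ : 1 ≤ κ := one_le_kappa (K := K) hlam (by omega) hd hT
  have hl := half_le_log hT
  have hh := half_le_mul_log hm hmK
  have hm1 : (1 : ℝ) ≤ m := by exact_mod_cast hm
  have hT0 : (0 : ℝ) < T := by exact_mod_cast (by omega : 0 < T)
  have hK0 : (0 : ℝ) < K := by exact_mod_cast (by omega : 0 < K)
  set r := Real.sqrt m with hr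
  have hr2 : r ^ 2 = m := Real.sq_sqrt (by linarith)
  have hr1 : 1 ≤ r := Real.one_le_sqrt.2 hm1
  -- replace `log ((K - m) T)` by `log T`, which is smaller since `K - m ≥ 1`
  set Y := κ ^ 2 * r ^ 3 * (Real.log T / δ) with hY
  have hlogle : Real.log T ≤ Real.log (((K : ℝ) - m) * T) := by
    have : (m : ℝ) + 1 ≤ K := by exact_mod_cast hmK
    exact Real.log_le_log hT0 (by nlinarith)
  have hYle : Y ≤ κ ^ 2 * (m : ℝ) ^ (3 / 2 : ℝ) * Real.log (((K : ℝ) - m) * T) / δ := by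
    have e : Y = κ ^ 2 * (m : ℝ) ^ (3 / 2 : ℝ) * Real.log T / δ := by
      rw [hY, rpow_three_halves, ← hr, ← hr2]; ring
    rw [e]
    gcongr
  suffices hmain : G.regret P T u ≤ 3000 * (Y + r * c) by linarith
  have hrc : 0 ≤ r * c := by positivity
  have hY0 : 0 ≤ Y := by positivity
  rcases le_total 2 δ with hδ2 | hδ2
  · have h1 := h.mul_le_corruption hmK hcor hgap hδ2
    have h2 : c ≤ r * c := le_mul_of_one_le_left hc hr1
    linarith
  have hld : 1 / 4 ≤ Real.log T / δ := by
    rw [le_div_iff₀ hΔ]; linarith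
  have hr3 : 1 ≤ r ^ 3 := one_le_pow₀ hr1
  have hκ2 : 1 ≤ κ ^ 2 := one_le_pow₀ hκ
  have hmr : (m : ℝ) ≤ r ^ 3 := by
    rw [← hr2]; exact pow_le_pow_right₀ hr1 (by norm_num)
  rcases lt_or_ge T K with hKT | hKT
  · have h1 : (T : ℝ) * (1 / 2) ≤ κ ^ 2 := by
      refine le_trans ?_ (mul_log_le_kappa_sq hlam)
      have h2 : (T : ℝ) ≤ K := by exact_mod_cast hKT.le
      have h3 : (1 : ℝ) ≤ d := by exact_mod_cast hd
      calc (T : ℝ) * (1 / 2) ≤ (K * 1) * Real.log T := by gcongr; linarith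
        _ ≤ _ := by gcongr
    have h2 : (T : ℝ) * (1 / 2) * m * (1 / 4) ≤ Y := by
      rw [hY]; gcongr
    linarith
  have hV := h.integral_totalEntropy_le hm hmK hT hKT hgap hΔ
  have hF := h.totalExcess_nonneg hm hgap hΔ
  have hFR := h.totalExcess_le hopt hcor hgap
  set q := 4 * Real.log T / minGap 𝒳 θ₀ u₀ with hq
  set F := G.totalExcess P T θ₀
  have hq0 : 0 < q := by positivity
  have hW : G.rootEntropy P T ≤ Real.sqrt ((m * Real.log (K / m) + 1) + q * F) :=
    (h.rootEntropy_le hm hmK).trans (Real.sqrt_le_sqrt (by linarith))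
  have hB := overhead_le hm hmK hd hT hKT hlam
  have hsq : m * Real.log (K / m) + 1 ≤ 2 * r ^ 2 * q := by
    have hlog : Real.log ((K : ℝ) / m) ≤ Real.log T := by
      refine Real.log_le_log (by positivity)
        ((div_le_self hK0.le hm1).trans (by exact_mod_cast hKT))
    have h1 := mul_le_mul_of_nonneg_left hlog (by linarith : (0 : ℝ) ≤ m)
    have h2 : 2 * Real.log T ≤ q := by
      rw [hq, le_div_iff₀ hΔ]; nlinarith
    have h3 := mul_le_mul_of_nonneg_left h2 (by linarith : (0 : ℝ) ≤ 2 * m)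
    have h4 : 1 * (1 / 2) ≤ m * Real.log T := by gcongr
    rw [hr2]
    linarith
  have key := self_bounding (κ := κ) (B := overhead K m d T lam) (F := F) (R := G.regret P T u)
    (s := m * Real.log (K / m) + 1) (q := q) (c := c) (r := r) hq0 hr1 hF (by linarith) hsq
    (by
      have := mul_le_mul_of_nonneg_left hW (by positivity : 0 ≤ 10 * κ)
      linarith)
    (by
      rw [hr2]
      have := mul_le_mul_of_nonneg_left hW (by positivity : 0 ≤ 34 * m * κ)
      linarith)
  -- every term of the bound is at most a multiple of `Y` or of `r c`
  have hqY : κ ^ 2 * r ^ 3 * q = 4 * Y := by rw [hY, hq]; ring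
  have hrq : r * (κ ^ 2 * q) ≤ 4 * Y := by
    rw [← hqY]
    have : r ≤ r ^ 3 := le_self_pow₀ hr1 (by norm_num)
    have := mul_le_mul_of_nonneg_right this (by positivity : 0 ≤ κ ^ 2 * q)
    linarith
  have hr3Y : r ^ 3 ≤ 4 * Y := by
    have : 1 * r ^ 3 * (1 / 4) ≤ Y := by rw [hY]; gcongr
    linarith
  have hδY : κ ^ 2 * r ^ 3 * Real.log T ≤ 2 * Y := by
    have e : κ ^ 2 * r ^ 3 * Real.log T = δ * Y := by rw [hY]; field_simp
    rw [e]
    exact mul_le_mul_of_nonneg_right hδ2 hY0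
  have hrB : r * overhead K m d T lam ≤ 148 * Y := by
    have h1 := mul_le_mul_of_nonneg_left hB (by linarith : 0 ≤ r)
    have e : r * (74 * κ ^ 2 * m * Real.log T) = 74 * (κ ^ 2 * r ^ 3 * Real.log T) := by
      rw [← hr2]; ring
    rw [← hκdef, e] at h1
    linarith
  have hB' : overhead K m d T lam ≤ 148 * Y := by
    have h1 : κ ^ 2 * m * Real.log T ≤ κ ^ 2 * r ^ 3 * Real.log T := by gcongr
    rw [← hκdef] at hB
    linarith
  linarith

/-- The corrupted regime with `c = 0`; a positive minimal gap makes all gaps nonnegative. -/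
theorem IsRun.regret_le_stochastic (h : G.IsRun P 𝒳 D T) (hm : 1 ≤ m) (hmK : m < K) (hd : 1 ≤ d)
    (hT : 2 ≤ T) (hopt : G.IsOptimal P 𝒳 T u) (hst : G.IsStochastic P T θ₀)
    (hΔ : 0 < minGap 𝒳 θ₀ u) :
    G.regret P T u ≤ 3000 * (kappa K d T (lambdaMin (secondMoment D)) ^ 2 *
      (m : ℝ) ^ (3 / 2 : ℝ) * Real.log (((K : ℝ) - m) * T) / minGap 𝒳 θ₀ u) := by
  have hall : ∀ᵐ ω ∂P, ∀ t ∈ Set.Icc 1 T, ∀ k, G.θ t k ω = θ₀ k := by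
    rw [ae_all_iff]; intro t
    rw [Filter.eventually_imp_distrib_left]; intro ht
    exact ae_all_iff.2 fun k => hst t ht k
  have hcor : G.IsCorrupted P T θ₀ 0 := by
    filter_upwards [hall] with ω hω
    refine (Finset.sum_eq_zero fun t ht => ?_).le
    simp [hω t (by simpa using ht)]
  have := h.regret_le_corrupted hm hmK hd hT hopt hcor (gap_nonneg_of_minGap_pos θ₀ hΔ) hΔ
  simpa using this

end Play

section Adversarial

open Play Filter Topology

/-- A horizon from which on all lower-order terms of the adversarial bound are negligible. -/
lemma exists_horizon (K m : ℕ) (lam : ℝ) :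
    ∃ T₀ : ℕ, 2 ≤ T₀ ∧ ∀ T : ℕ, T₀ ≤ T → (m : ℝ) ≤ Real.log T ∧
      4 * m + (2 + c₂ K lam * Real.log T) * (m * Real.log (K / m) + m) ≤ Real.sqrt T / 2 ∧
      12 * (m : ℝ) ≤ Real.sqrt T := by
  have hlog : Tendsto (fun T : ℕ => Real.log T) atTop atTop :=
    Real.tendsto_log_atTop.comp tendsto_natCast_atTop_atTop
  have hsqrt : Tendsto (fun T : ℕ => Real.sqrt T) atTop atTop :=
    Real.tendsto_sqrt_atTop.comp tendsto_natCast_atTop_atTop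
  have hlo : (fun T : ℕ => Real.log T) =o[atTop] fun T : ℕ => Real.sqrt T := by
    have := (isLittleO_log_rpow_atTop (r := 1 / 2) (by norm_num)).comp_tendsto
      tendsto_natCast_atTop_atTop (k := fun n : ℕ => (n : ℝ))
    simpa only [Function.comp_def, ← Real.sqrt_eq_rpow] using this
  have hconst : (fun _ : ℕ => (1 : ℝ)) =o[atTop] fun T : ℕ => Real.sqrt T :=
    (Asymptotics.isLittleO_const_left.2 (Or.inr (tendsto_norm_atTop_atTop.comp hsqrt)))
  set H : ℝ := m * Real.log (K / m) + m with hH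
  have hsum : (fun T : ℕ => (4 * m + 2 * H) * 1 + (c₂ K lam * H) * Real.log T) =o[atTop]
      fun T : ℕ => Real.sqrt T := (hconst.const_mul_left _).add (hlo.const_mul_left _)
  have hev := hsum.bound (c := 1 / 2) (by norm_num)
  obtain ⟨T₀, hT₀⟩ := eventually_atTop.1 ((hlog.eventually_ge_atTop (m : ℝ)).and
    (hev.and ((hsqrt.eventually_ge_atTop (12 * m : ℝ)))))
  refine ⟨max 2 T₀, le_max_left _ _, fun T hT => ?_⟩
  obtain ⟨h1, h2, h3⟩ := hT₀ T ((le_max_right _ _).trans hT)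
  refine ⟨h1, ?_, h3⟩
  have h4 := (le_abs_self _).trans (by simpa only [Real.norm_eq_abs] using h2)
  rw [abs_of_nonneg (Real.sqrt_nonneg _)] at h4
  linarith

variable {K m d : ℕ} {Ω : Type*} {G : Play K m d Ω} [mΩ : MeasurableSpace Ω]
  {P : Measure Ω} {𝒳 : Set (Ctx d)} {D : Measure (Ctx d)} {T : ℕ} {u : Ctx d → Action K m}

/-- The hypotheses `h1`, `h2` and `h3` hold from some horizon on that depends on `K`, `m` and `λ` only. -/
theorem Play.IsRun.regret_le_adversarial (h : G.IsRun P 𝒳 D T) (hm : 1 ≤ m) (hmK : m < K)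
    (hd : 1 ≤ d) (hT : 2 ≤ T) (hu : Measurable u) (h1 : (m : ℝ) ≤ Real.log T)
    (h2 : 4 * m + (2 + c₂ K (lambdaMin (secondMoment D)) * Real.log T) *
      (m * Real.log (K / m) + m) ≤ Real.sqrt T / 2)
    (h3 : 12 * (m : ℝ) ≤ Real.sqrt T) :
    G.regret P T u ≤ 3000 * (kappa K d T (lambdaMin (secondMoment D)) * m *
      Real.sqrt (Real.log (K / m) * T)) := by
  obtain ⟨hlam, -⟩ := lambdaMin_spec hd h.posDef
  have hR := h.regret_le_sqrt hm hmK hd hT h1 hu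
  set lam := lambdaMin (secondMoment D)
  set κ := kappa K d T lam with hκdef
  have hκ : 1 ≤ κ := one_le_kappa (K := K) hlam (by omega) hd hT
  have hh := half_le_mul_log hm hmK
  have hm1 : (1 : ℝ) ≤ m := by exact_mod_cast hm
  have hlog0 := log_ratio_nonneg hm hmK.le
  set v := (m : ℝ) * Real.log (K / m) with hv
  have hs : 1 / 2 ≤ Real.sqrt v := by
    rw [Real.le_sqrt' (by norm_num)]; linarith
  have hsv : Real.sqrt v ^ 2 = v := Real.sq_sqrt (by linarith)
  have hsm : 1 ≤ Real.sqrt m := Real.one_le_sqrt.2 hm1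
  have hsm2 : Real.sqrt m ^ 2 = m := Real.sq_sqrt (by linarith)
  set S := Real.sqrt m * Real.sqrt v * Real.sqrt T with hS
  have e : (m : ℝ) * Real.sqrt (Real.log (K / m) * T) = S := by
    rw [hS, hv, Real.sqrt_mul hlog0, Real.sqrt_mul (by linarith : (0 : ℝ) ≤ m)]
    nth_rw 1 [← hsm2]
    ring
  have hST : Real.sqrt T / 2 ≤ κ * S := by
    have : 1 * (1 * (1 / 2) * Real.sqrt T) ≤ κ * S := by rw [hS]; gcongr
    linarith
  -- `c₁ (h + m) ≤ 3 m h c₁ = 3 m κ √h` for `h = m ln (K/m)`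
  have hc : c₁ K m d T lam * (v + m) ≤ κ * S := by
    have h5 : v + m ≤ 3 * (m * v) := by nlinarith
    rw [c₁_eq hlam, ← hv, ← hκdef]
    calc κ / Real.sqrt v * (v + m) ≤ κ / Real.sqrt v * (3 * (m * v)) := by gcongr
      _ = κ * (1 * (Real.sqrt v) * (3 * m)) := by
          nth_rw 2 [← hsv]
          field_simp
      _ ≤ κ * (Real.sqrt m * Real.sqrt v * Real.sqrt T) := by
          gcongr
          linarith
  have hov : overhead K m d T lam ≤ 3 * (κ * S) := by
    unfold overhead
    rw [← hv]
    linarith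
  have hκS : 0 ≤ κ * S := by positivity
  rw [mul_assoc κ, e]
  linarith

end Adversarial

end CombBandit

end

open CombBandit in
theorem theorem1 :
    ∃ L : ℝ, 0 < L ∧ ∀ K m d : ℕ, 1 ≤ m → m < K → 1 ≤ d →
      -- adversarial regime
      (∀ lam : ℝ, 0 < lam → ∃ T₀ : ℕ, ∀ T : ℕ, T₀ ≤ T →
        ∀ (Ω : Type*) [MeasurableSpace Ω] (P : Measure Ω) (𝒳 : Set (Ctx d)) (D : Measure (Ctx d))
          (G : Play K m d Ω) (u : Ctx d → Action K m),
          G.IsRun P 𝒳 D T → lambdaMin (secondMoment D) = lam → G.IsOptimal P 𝒳 T u →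
          G.regret P T u ≤ L * (kappa K d T lam * m * Real.sqrt (Real.log (K / m) * T))) ∧
      -- stochastic regime
      (∀ T : ℕ, 2 ≤ T →
        ∀ (Ω : Type*) [MeasurableSpace Ω] (P : Measure Ω) (𝒳 : Set (Ctx d)) (D : Measure (Ctx d))
          (G : Play K m d Ω) (u : Ctx d → Action K m) (θ₀ : Fin K → Ctx d),
          G.IsRun P 𝒳 D T → G.IsOptimal P 𝒳 T u → G.IsStochastic P T θ₀ →
          0 < minGap 𝒳 θ₀ u →
          G.regret P T u ≤ L * (kappa K d T (lambdaMin (secondMoment D)) ^ 2 *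
            (m : ℝ) ^ (3 / 2 : ℝ) * Real.log (((K : ℝ) - m) * T) / minGap 𝒳 θ₀ u)) ∧
      -- corrupted stochastic regime
      (∀ T : ℕ, 2 ≤ T →
        ∀ (Ω : Type*) [MeasurableSpace Ω] (P : Measure Ω) (𝒳 : Set (Ctx d)) (D : Measure (Ctx d))
          (G : Play K m d Ω) (u u₀ : Ctx d → Action K m) (θ₀ : Fin K → Ctx d) (c : ℝ),
          G.IsRun P 𝒳 D T → G.IsOptimal P 𝒳 T u → G.IsCorrupted P T θ₀ c →
          (∀ x ∈ 𝒳, ∀ a, 0 ≤ gap θ₀ u₀ x a) → 0 < minGap 𝒳 θ₀ u₀ →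
          G.regret P T u ≤ L * (kappa K d T (lambdaMin (secondMoment D)) ^ 2 *
            (m : ℝ) ^ (3 / 2 : ℝ) * Real.log (((K : ℝ) - m) * T) / minGap 𝒳 θ₀ u₀
              + Real.sqrt m * c)) := by
  refine ⟨3000, by norm_num, fun K m d hm hmK hd => ⟨fun lam _ => ?_, ?_, ?_⟩⟩
  · obtain ⟨T₀, hT₀, H⟩ := exists_horizon K m lam
    refine ⟨T₀, fun T hT Ω _ P 𝒳 D G u h hlam hopt => ?_⟩
    obtain ⟨h1, h2, h3⟩ := H T hT
    subst hlam
    exact h.regret_le_adversarial hm hmK hd (hT₀.trans hT) hopt.1 h1 h2 h3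
  · intro T hT Ω _ P 𝒳 D G u θ₀ h hopt hst hΔ
    exact h.regret_le_stochastic hm hmK hd hT hopt hst hΔ
  · intro T hT Ω _ P 𝒳 D G u u₀ θ₀ c h hopt hcor hgap hΔ
    exact h.regret_le_corrupted hm hmK hd hT hopt hcor hgap hΔ
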